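/- Let $k$ be a number field, $\mathcal B$ a quaternion algebra over $k$, and $v$ a finite place of $k$ (dyadic places included) at which $\mathcal B$ splits; fix an isomorphism $\mathcal B\otimes_k k_v\cong \mathrm M(2,2)_{k_v}$ and identify the two algebras. Let $\mathcal O_v$ be the ring of integers of $k_v$, $\mathfrak p_v$ its maximal ideal, $q_v=\#(\mathcal O_v/\mathfrak p_v)$, and $|\cdot|_v$ the normalized absolute value on $k_v$. Let $G_{k_v}=\mathrm{GL}(2)_{k_v}\times\mathrm{GL}(2)_{k_v}\times\mathrm{GL}(2)_{k_v}$, where the second factor is the multiplicative group of the opposite algebra of $\mathrm M(2,2)_{k_v}$, act on $V_{k_v}=\mathrm M(2,2)_{k_v}\oplus\mathrm M(2,2)_{k_v}$ by $(gx)(t)=g_{11}\,x(tg_2)\,g_{12}$ for $g=(g_{11},g_{12},g_2)$, where $x=(x_1,x_2)$ and $x(t)=t_1x_1+t_2x_2$ for a row vector $t=(t_1,t_2)$. Let $F_x(t)=\det x(t)$, let $P(x)$ be the discriminant of the binary quadratic form $F_x$, and let $k_v(x)$ be the splitting field of $F_x$ over $k_v$. Let $G_x^\circ$ be the identity component of the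 stabilizer of $x$ as an algebraic group, and $G_{x\,k_v}^\circ$ its group of $k_v$-rational points. Let $dg$ be the Haar measure on $G_{k_v}$ for which $\mathrm{GL}(2)_{\mathcal O_v}^3$ has volume $1$, and $dy$ the Haar measure on $V_{k_v}$ for which $\mathrm M(2,2)_{\mathcal O_v}^2$ has volume $1$. For $x=(1,u)$ with $P(x)\neq0$, let $dg''_x$ be the image, under the isomorphism $$(k_v[u]^\times)^2\to G^\circ_{x\,k_v},\qquad (s_1,s_2)\mapsto(s_1,s_2,g_{s_1s_2}),\qquad g_{s}\,{}^t(s,su)={}^t(1,u),$$ of the product of the Haar measures on $k_v[u]^\times$ which give the unit group of the ring of integral elements of $k_v[u]$ volume $1$. Let $dg'_x$ be the left invariant measure on $G_{k_v}/G_{x\,k_v}^\circ$ with $dg=dg'_x\,dg''_x$, and let $b_{x,v}>0$ be the constant such that $$\int_{G_{k_v}/G^\circ_{x\,k_v}}f(g'x)\,dg'_x=b_{x,v}\int_{G_{k_v}x}f(y)\,|P(y)|_v^{-2}\,dy$$ for all $f$ on $G_{k_v}x$ integrable with respect to $|P(y)|_v^{-2}dy$. The local density is $\varepsilon_v(x)=|P(x)|_v^2/b_{x,v}$.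 Let $x=(1,u)$, with $P(x)\ne 0$, be a standard representative, i.e. $u$ generates the ring of integral elements of $k_v[u]$ over $\mathcal O_v$. If $x$ is of type (ur rm), i.e. $k_v(x)/k_v$ is a ramified quadratic extension, then $$\varepsilon_v(x)=2^{-1}\,|\Delta_{k_v(x)/k_v}|_v^{-1}\,(1-q_v^{-1})(1-q_v^{-2})^3 ,$$ where $|\Delta_{k_v(x)/k_v}|_v=q_v^{\delta}$ denotes the absolute norm of the relative discriminant $\Delta_{k_v(x)/k_v}=\mathfrak p_v^{\delta}$. -/

import Mathlib

open scoped Matrix NumberField TensorProduct ENNReal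
open MeasureTheory IsDedekindDomain

noncomputable section

namespace QuatPair

/-! ### The representation, over an arbitrary field, for the split quaternion algebra -/

section Representation

variable (F : Type*) [Field F]

/-- The `2 × 2` matrix algebra `M(2,2)`. -/
abbrev Mat := Matrix (Fin 2) (Fin 2) F

/-- The group `G = GL(2) × (M(2,2)ᵒᵖ)ˣ × GL(2)` with elements `g = (g₁₁, g₁₂, g₂)`. -/
def PairGroup := (Mat F)ˣ × ((Mat F)ᵐᵒᵖ)ˣ × GL (Fin 2) F

instance : Group (PairGroup F) :=
  inferInstanceAs (Group ((Mat F)ˣ × ((Mat F)ᵐᵒᵖ)ˣ × GL (Fin 2) F))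

/-- The vector space `V = M(2,2) ⊕ M(2,2)` with elements `x = (x₁, x₂)`. -/
def PairSpace := Mat F × Mat F

instance : AddCommGroup (PairSpace F) := inferInstanceAs (AddCommGroup (Mat F × Mat F))

variable {F}

/-- The three components of `g`, as matrices. -/
def PairGroup.g11 (g : PairGroup F) : Mat F := (g.1 : Mat F)
/-- The second component, as an element of `M(2,2)` (not of its opposite). -/
def PairGroup.g12 (g : PairGroup F) : Mat F := MulOpposite.unop (g.2.1 : (Mat F)ᵐᵒᵖ)
/-- The third component. -/
def PairGroup.g2 (g : PairGroup F) : Mat F := (g.2.2 : Mat F)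

theorem g11_mul (g h : PairGroup F) : (g * h).g11 = g.g11 * h.g11 := rfl
theorem g12_mul (g h : PairGroup F) : (g * h).g12 = h.g12 * g.g12 := rfl
theorem g2_mul (g h : PairGroup F) : (g * h).g2 = g.g2 * h.g2 := rfl
theorem g11_one : (1 : PairGroup F).g11 = 1 := rfl
theorem g12_one : (1 : PairGroup F).g12 = 1 := rfl
theorem g2_one : (1 : PairGroup F).g2 = 1 := rfl

/-- The action `(g x)(v) = g₁₁ x(v g₂) g₁₂`, where `x(v) = v₁ x₁ + v₂ x₂` and `v = (v₁, v₂)`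
is a row vector. -/
instance : SMul (PairGroup F) (PairSpace F) where
  smul g x :=
    (g.g11 * (g.g2 0 0 • x.1 + g.g2 0 1 • x.2) * g.g12,
     g.g11 * (g.g2 1 0 • x.1 + g.g2 1 1 • x.2) * g.g12)

theorem smul_def (g : PairGroup F) (x : PairSpace F) : g • x =
    ((g.g11 * (g.g2 0 0 • x.1 + g.g2 0 1 • x.2) * g.g12,
      g.g11 * (g.g2 1 0 • x.1 + g.g2 1 1 • x.2) * g.g12) : Mat F × Mat F) := rfl

instance : MulAction (PairGroup F) (PairSpace F) where
  one_smul x := by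
    rw [smul_def, g11_one, g12_one, g2_one]
    simp only [Matrix.one_apply_eq, one_smul, one_mul, mul_one, zero_smul, add_zero, zero_add,
      Matrix.one_apply_ne (show (0 : Fin 2) ≠ 1 by decide),
      Matrix.one_apply_ne (show (1 : Fin 2) ≠ 0 by decide)]
    rfl
  mul_smul g h x := by
    rw [smul_def, smul_def g, smul_def h, g11_mul, g12_mul, g2_mul]
    refine Prod.ext ?_ ?_ <;>
    · simp only [Matrix.mul_apply, Fin.sum_univ_two, mul_add, add_mul, smul_add, add_smul,
        Matrix.mul_smul, Matrix.smul_mul, smul_smul, mul_assoc]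
      abel

/-- The binary quadratic form `F_x(v) = N(v₁ x₁ + v₂ x₂)`; the reduced norm of `M(2,2)` is the
determinant. -/
def quadForm (x : PairSpace F) (v₁ v₂ : F) : F := (v₁ • x.1 + v₂ • x.2).det

/-- The coefficient of `v₁²` in `F_x`. -/
def coeff0 (x : PairSpace F) : F := quadForm x 1 0
/-- The coefficient of `v₂²` in `F_x`. -/
def coeff2 (x : PairSpace F) : F := quadForm x 0 1
/-- The coefficient of `v₁ v₂` in `F_x`. -/
def coeff1 (x : PairSpace F) : F := quadForm x 1 1 - quadForm x 1 0 - quadForm x 0 1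

theorem quadForm_eq (x : PairSpace F) (v₁ v₂ : F) :
    quadForm x v₁ v₂ = coeff0 x * v₁ ^ 2 + coeff1 x * (v₁ * v₂) + coeff2 x * v₂ ^ 2 := by
  simp only [quadForm, coeff0, coeff1, coeff2, Matrix.det_fin_two, Matrix.add_apply,
    Matrix.smul_apply, smul_eq_mul]
  ring

/-- The discriminant `P(x)` of `F_x`. -/
def disc (x : PairSpace F) : F := coeff1 x ^ 2 - 4 * coeff0 x * coeff2 x

/-- The field `F(x)`: the splitting field of the form `F_x(v)` over `F`. -/
abbrev orbitField (x : PairSpace F) : Type _ :=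
  (Polynomial.C (coeff0 x) * Polynomial.X ^ 2 + Polynomial.C (coeff1 x) * Polynomial.X
    + Polynomial.C (coeff2 x)).SplittingField

/-- The point `w_u = (1, u)`. -/
def w (u : Mat F) : PairSpace F := ((1, u) : Mat F × Mat F)

/-! ### The identity component of the stabilizer -/

/-- The polynomial functions in the matrix entries of `(g₁₁, g₁₂, g₂)`. -/
def regularFunctions (F : Type*) [Field F] : Subalgebra F (PairGroup F → F) :=
  Algebra.adjoin F {f | ∃ i j : Fin 2,
    f = (fun g => g.g11 i j) ∨ f = (fun g => g.g12 i j) ∨ f = (fun g => g.g2 i j)}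

/-- The Zariski topology on `G(F)` (meaningful for `F` algebraically closed): the topology
generated by the non-vanishing loci of polynomials in the matrix entries. -/
@[reducible]
def zariski (F : Type*) [Field F] : TopologicalSpace (PairGroup F) :=
  TopologicalSpace.generateFrom {U | ∃ f ∈ regularFunctions F, U = {g | f g ≠ 0}}

theorem regularFunctions_translate (a : PairGroup F) (f : PairGroup F → F)
    (hf : f ∈ regularFunctions F) : (fun g => f (a * g)) ∈ regularFunctions F := by
  have h11 (i j : Fin 2) : (fun g : PairGroup F => g.g11 i j) ∈ regularFunctions F :=
    Algebra.subset_adjoin ⟨i, j, Or.inl rfl⟩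
  have h12 (i j : Fin 2) : (fun g : PairGroup F => g.g12 i j) ∈ regularFunctions F :=
    Algebra.subset_adjoin ⟨i, j, Or.inr (Or.inl rfl)⟩
  have h2 (i j : Fin 2) : (fun g : PairGroup F => g.g2 i j) ∈ regularFunctions F :=
    Algebra.subset_adjoin ⟨i, j, Or.inr (Or.inr rfl)⟩
  induction hf using Algebra.adjoin_induction with
  | mem f hf =>
    obtain ⟨i, j, rfl | rfl | rfl⟩ := hf
    · have := (regularFunctions F).add_mem ((regularFunctions F).smul_mem (h11 0 j) (a.g11 i 0))
        ((regularFunctions F).smul_mem (h11 1 j) (a.g11 i 1))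
      convert this using 1
      funext g
      simp [g11_mul, Matrix.mul_apply, Fin.sum_univ_two]
    · have := (regularFunctions F).add_mem ((regularFunctions F).smul_mem (h12 i 0) (a.g12 0 j))
        ((regularFunctions F).smul_mem (h12 i 1) (a.g12 1 j))
      convert this using 1
      funext g
      simp [g12_mul, Matrix.mul_apply, Fin.sum_univ_two, mul_comm]
    · have := (regularFunctions F).add_mem ((regularFunctions F).smul_mem (h2 0 j) (a.g2 i 0))
        ((regularFunctions F).smul_mem (h2 1 j) (a.g2 i 1))
      convert this using 1
      funext g
      simp [g2_mul, Matrix.mul_apply, Fin.sum_univ_two]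
  | algebraMap r => exact (regularFunctions F).algebraMap_mem r
  | add f g _ _ hf hg => exact (regularFunctions F).add_mem hf hg
  | mul f g _ _ hf hg => exact (regularFunctions F).mul_mem hf hg

theorem zariski_continuous_mul_left (a : PairGroup F) :
    @Continuous _ _ (zariski F) (zariski F) (fun g => a * g) := by
  let := zariski F
  refine continuous_generateFrom_iff.2 ?_
  rintro _ ⟨f, hf, rfl⟩
  exact TopologicalSpace.isOpen_generateFrom_of_mem
    ⟨_, regularFunctions_translate a f hf, rfl⟩

/-- The connected component of `1` in the stabilizer of `x`, for the Zariski topology. -/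
def geometricComponent (x : PairSpace F) : Set (PairGroup F) :=
  @connectedComponentIn _ (zariski F) (MulAction.stabilizer (PairGroup F) x) 1

theorem one_mem_geometricComponent (x : PairSpace F) : 1 ∈ geometricComponent x :=
  let := zariski F
  mem_connectedComponentIn (one_mem (MulAction.stabilizer (PairGroup F) x))

/-- A left translate of the component that meets the component is contained in it. -/
theorem translate_subset (x : PairSpace F) {a b c : PairGroup F}
    (ha : a ∈ MulAction.stabilizer (PairGroup F) x)
    (hb : b ∈ geometricComponent x) (hab : a * b ∈ geometricComponent x)
    (hc : c ∈ geometricComponent x) : a * c ∈ geometricComponent x := by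
  let := zariski F
  have hsub : geometricComponent x ⊆ MulAction.stabilizer (PairGroup F) x :=
    connectedComponentIn_subset _ _
  have hpre : IsPreconnected ((fun g => a * g) '' geometricComponent x) :=
    isPreconnected_connectedComponentIn.image _ (zariski_continuous_mul_left a).continuousOn
  have hS : (fun g => a * g) '' geometricComponent x ⊆ MulAction.stabilizer (PairGroup F) x := by
    rintro _ ⟨g, hg, rfl⟩
    exact mul_mem ha (hsub hg)
  have := hpre.subset_connectedComponentIn ⟨b, hb, rfl⟩ hS
  have heq : connectedComponentIn (MulAction.stabilizer (PairGroup F) x : Set (PairGroup F)) (a * b)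
      = geometricComponent x := (connectedComponentIn_eq hab).symm
  rw [heq] at this
  exact this ⟨c, hc, rfl⟩

/-- The identity component of the stabilizer, as a subgroup. -/
def geometricIdentityComponent (x : PairSpace F) : Subgroup (PairGroup F) where
  carrier := geometricComponent x
  one_mem' := one_mem_geometricComponent x
  mul_mem' {a b} ha hb := by
    let := zariski F
    refine translate_subset x (connectedComponentIn_subset _ _ ha)
      (one_mem_geometricComponent x) ?_ hb
    rwa [mul_one]
  inv_mem' {a} ha := by
    let := zariski F
    have h := translate_subset x (inv_mem (connectedComponentIn_subset _ _ ha)) ha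
      (by rw [inv_mul_cancel]; exact one_mem_geometricComponent x) (one_mem_geometricComponent x)
    rwa [mul_one] at h

/-- The inclusion `G(F) → G(E)` for a field extension `E / F`. -/
def baseChange (F E : Type*) [Field F] [Field E] [Algebra F E] : PairGroup F →* PairGroup E :=
  let r : Mat F →+* Mat E := (algebraMap F E).mapMatrix
  MonoidHom.prodMap (Units.map r.toMonoidHom)
    (MonoidHom.prodMap (Units.map (RingHom.op r).toMonoidHom) (Units.map r.toMonoidHom))

/-- The inclusion `V(F) → V(E)` for a field extension `E / F`. -/
def baseChangeSpace (F E : Type*) [Field F] [Field E] [Algebra F E] (x : PairSpace F) :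
    PairSpace E :=
  ((x.1.map (algebraMap F E), x.2.map (algebraMap F E)) : Mat E × Mat E)

/-- The group `G_x°(F)` of `F`-rational points of the identity component of the stabilizer
of `x`. -/
def identityComponent (x : PairSpace F) : Subgroup (PairGroup F) :=
  (geometricIdentityComponent (baseChangeSpace F (AlgebraicClosure F) x)).comap
    (baseChange F (AlgebraicClosure F))

/-! ### The isomorphism `ψ_u : (F[u]ˣ)² → G_{w_u}°` -/

/-- The group `F[u]ˣ`. -/
def QuadUnits (u : Mat F) := (Algebra.adjoin F {u})ˣ

instance (u : Mat F) : Group (QuadUnits u) := inferInstanceAs (Group (Algebra.adjoin F {u})ˣ)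

/-- The inclusion `F[u]ˣ → GL(2)`. -/
def QuadUnits.toMat {u : Mat F} : QuadUnits u →* (Mat F)ˣ :=
  Units.map (Algebra.adjoin F {u}).val.toMonoidHom

open Classical in
/-- The unique `g ∈ GL(2)` with `g · ᵗ(s, s u) = ᵗ(1, u)`. -/
def gOf (u : Mat F) (s : Mat F) : GL (Fin 2) F :=
  if h : ∃! g : GL (Fin 2) F,
      g.1 0 0 • s + g.1 0 1 • (s * u) = 1 ∧ g.1 1 0 • s + g.1 1 1 • (s * u) = u
  then h.choose else 1

/-- The map `(s₁, s₂) ↦ (s₁, s₂, g_{s₁ s₂})`. -/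
def psi (u : Mat F) (s : QuadUnits u × QuadUnits u) : PairGroup F :=
  (s.1.toMat, Units.opEquiv.symm (MulOpposite.op s.2.toMat),
    gOf u ((s.1.toMat : Mat F) * (s.2.toMat : Mat F)))

/-! ### Topologies and Borel structures -/

section Topology

variable [TopologicalSpace F]

instance : TopologicalSpace (PairGroup F) :=
  inferInstanceAs (TopologicalSpace ((Mat F)ˣ × ((Mat F)ᵐᵒᵖ)ˣ × GL (Fin 2) F))
instance : MeasurableSpace (PairGroup F) := borel _
instance : BorelSpace (PairGroup F) := ⟨rfl⟩

instance : TopologicalSpace (PairSpace F) := inferInstanceAs (TopologicalSpace (Mat F × Mat F))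
instance : MeasurableSpace (PairSpace F) := borel _
instance : BorelSpace (PairSpace F) := ⟨rfl⟩

instance (u : Mat F) : TopologicalSpace (QuadUnits u) :=
  inferInstanceAs (TopologicalSpace (Algebra.adjoin F {u})ˣ)
instance (u : Mat F) : MeasurableSpace (QuadUnits u) := borel _
instance (u : Mat F) : BorelSpace (QuadUnits u) := ⟨rfl⟩

end Topology

end Representation

/-! ### Normalized Haar measures -/

open Classical in
/-- The Haar measure for which `C` has volume `1` (`0` if it does not exist uniquely). -/
def normalizedHaar {H : Type*} [Group H] [TopologicalSpace H] [MeasurableSpace H]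
    (C : Set H) : Measure H :=
  if h : ∃! μ : Measure H, μ.IsHaarMeasure ∧ μ C = 1 then h.choose else 0

open Classical in
/-- The additive Haar measure for which `C` has volume `1` (`0` if it does not exist uniquely). -/
def normalizedAddHaar {H : Type*} [AddGroup H] [TopologicalSpace H] [MeasurableSpace H]
    (C : Set H) : Measure H :=
  if h : ∃! μ : Measure H, μ.IsAddHaarMeasure ∧ μ C = 1 then h.choose else 0

/-! ### Arithmetic notions -/

/-- The relative discriminant of `L / K`, an ideal of `A` (where `K = Frac A`): the ideal generated
by the discriminants of all `[L : K]`-tuples of elements of `L` integral over `A`. -/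
def relativeDiscriminant (A K L : Type*) [CommRing A] [Field K] [Field L] [Algebra A K]
    [Algebra K L] [Algebra A L] : Ideal A :=
  Ideal.span {d | ∃ b : Fin (Module.finrank K L) → integralClosure A L,
    algebraMap A K d = Algebra.discr K (fun i => (b i : L))}

/-- `L / K` is a quadratic extension which is ramified over the ring `A` with fraction
field `K`. -/
def IsRamifiedQuadratic (A K L : Type*) [CommRing A] [Field K] [Field L] [Algebra A K]
    [Algebra K L] [Algebra A L] : Prop :=
  Module.finrank K L = 2 ∧
    ∃ Q : Ideal (integralClosure A L), Q.IsMaximal ∧ 1 < Q.ramificationIdx A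

section Local

variable {k : Type*} [Field k] [NumberField k] (v : HeightOneSpectrum (𝓞 k))

/-- The completion `k_v`. -/
abbrev Kv := v.adicCompletion k

/-- The ring of integers `𝒪_v` of `k_v`. -/
abbrev Ov := v.adicCompletionIntegers k

/-- The cardinality `q_v` of the residue field of `k_v`. -/
def q : ℕ := Nat.card (IsLocalRing.ResidueField (Ov v))

/-- The maximal compact subgroup `𝒦_v = GL(2)_{𝒪_v} × GL(2)_{𝒪_v} × GL(2)_{𝒪_v}`. -/
def maxCompact : Set (PairGroup (Kv v)) :=
  {g | ∀ i j, (g.g11 i j ∈ Ov v ∧ (g⁻¹).g11 i j ∈ Ov v) ∧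
    (g.g12 i j ∈ Ov v ∧ (g⁻¹).g12 i j ∈ Ov v) ∧ (g.g2 i j ∈ Ov v ∧ (g⁻¹).g2 i j ∈ Ov v)}

/-- The lattice `V_{𝒪_v}` of pairs of integral matrices. -/
def integralPoints : Set (PairSpace (Kv v)) :=
  {x | ∀ i j, x.1 i j ∈ Ov v ∧ x.2 i j ∈ Ov v}

/-- The measure `dg_v` on `G_{k_v}`, with `vol(𝒦_v) = 1`. -/
def haarG : Measure (PairGroup (Kv v)) := normalizedHaar (maxCompact v)

/-- The measure `dx_v` on `V_{k_v}`, with `vol(V_{𝒪_v}) = 1`. -/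
def haarV : Measure (PairSpace (Kv v)) := normalizedAddHaar (integralPoints v)

variable (u : Mat (Kv v))

/-- The maximal compact subgroup of `k_v[u]ˣ`: the unit group of the ring of integral elements
of `k_v[u]`. -/
def integralUnits : Set (QuadUnits u) :=
  {s | IsIntegral (Ov v) (s.toMat : Mat (Kv v)) ∧ IsIntegral (Ov v) (s⁻¹.toMat : Mat (Kv v))}

/-- The normalized Haar measure `d_u^× s` on `k_v[u]ˣ`. -/
def haarQuad : Measure (QuadUnits u) := normalizedHaar (integralUnits v u)

/-- The measure `dg''` on `G_{w_u}°`, the pushforward under `ψ_u` of `d_u^× s₁ d_u^× s₂`; it is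
regarded as a measure on `G_{k_v}` carried by `G_{w_u}°`. -/
def stabilizerMeasure : Measure (PairGroup (Kv v)) :=
  ((haarQuad v u).prod (haarQuad v u)).map (psi u)

/-- `μ'` is left invariant on `G_{k_v} / G_{w_u}°` and satisfies `dg_v = dμ' dg''`. -/
def IsQuotientMeasure (μ' : Measure (PairGroup (Kv v) ⧸ identityComponent (w u))) : Prop :=
  SMulInvariantMeasure (PairGroup (Kv v)) (PairGroup (Kv v) ⧸ identityComponent (w u)) μ' ∧
  ∀ f : PairGroup (Kv v) → ℝ≥0∞, Measurable f →
    ∫⁻ g, f g ∂(haarG v) = ∫⁻ c, ∫⁻ h, f (c.out * h) ∂(stabilizerMeasure v u) ∂μ'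

open Classical in
/-- The measure `dg'` on `G_{k_v} / G_{w_u}°` with `dg_v = dg' dg''`
(`0` if it does not exist uniquely). -/
def quotientMeasure : Measure (PairGroup (Kv v) ⧸ identityComponent (w u)) :=
  if h : ∃! μ', IsQuotientMeasure v u μ' then h.choose else 0

/-- `b > 0` satisfies
`∫_{G / G_x°} f(g' x) dg' = b ∫_{G x} f(y) |P(y)|_v⁻² dy`, where `x = w_u`, for every `f` on `G x`
that is integrable with respect to `|P(y)|_v⁻² dy`. -/
def IsOrbitalConstant (b : ℝ) : Prop :=
  0 < b ∧ ∀ f : PairSpace (Kv v) → ℂ,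
    IntegrableOn (fun y => f y * ((‖disc y‖ ^ 2)⁻¹ : ℝ))
      (MulAction.orbit (PairGroup (Kv v)) (w u)) (haarV v) →
    Integrable (fun c : PairGroup (Kv v) ⧸ identityComponent (w u) => f (c.out • w u))
      (quotientMeasure v u) ∧
    ∫ c, f (c.out • w u) ∂(quotientMeasure v u) =
      b * ∫ y in MulAction.orbit (PairGroup (Kv v)) (w u),
        f y * ((‖disc y‖ ^ 2)⁻¹ : ℝ) ∂(haarV v)

open Classical in
/-- The constant `b_{x,v}` for `x = w_u` (`0` if it does not exist uniquely). -/
def orbitalConstant : ℝ := if h : ∃! b, IsOrbitalConstant v u b then h.choose else 0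

/-- The local density `ε_v(x) = |P(x)|_v² / b_{x,v}` for `x = w_u`. -/
def localDensity : ℝ := ‖disc (w u)‖ ^ 2 / orbitalConstant v u

/-- `w_u = (1, u)` is a standard orbital representative: it is semi-stable, and `u` generates the
ring of integral elements of `k_v[u]` as an `𝒪_v`-algebra. -/
def IsStandardRepresentative : Prop :=
  disc (w u) ≠ 0 ∧
    ∀ a ∈ Algebra.adjoin (Kv v) {u}, IsIntegral (Ov v) a ↔ a ∈ Algebra.adjoin (Ov v) {u}

/-- `w_u` has type (ur rm): `k_v(w_u)` is a ramified quadratic extension of `k_v`. -/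
def IsTypeUrRm : Prop := IsRamifiedQuadratic (Ov v) (Kv v) (orbitField (w u))

/-- The absolute norm `q_v^δ` of the relative discriminant `𝔭_v^δ` of `k_v(w_u) / k_v`. -/
def discNorm : ℕ :=
  Nat.card (Ov v ⧸ relativeDiscriminant (Ov v) (Kv v) (orbitField (w u)))

end Local

end QuatPair

end

noncomputable section

namespace QuatPair

/-! ### Quadratic subalgebras of `M(2,2)` -/

section Quadratic

set_option linter.unusedSectionVars false

variable {F : Type*} [Field F]

theorem PairGroup.ext' {g h : PairGroup F} (h1 : g.g11 = h.g11) (h2 : g.g12 = h.g12)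
    (h3 : g.g2 = h.g2) : g = h :=
  Prod.ext (Units.ext h1) (Prod.ext (Units.ext (MulOpposite.unop_injective h2)) (Units.ext h3))

theorem PairSpace.ext' {x y : PairSpace F} (h1 : x.1 = y.1) (h2 : x.2 = y.2) : x = y :=
  Prod.ext h1 h2

/-- The element of `G` with the given components. -/
def mkG (a b c : (Mat F)ˣ) : PairGroup F := (a, Units.opEquiv.symm (MulOpposite.op b), c)

@[simp] theorem mkG_g11 (a b c : (Mat F)ˣ) : (mkG a b c).g11 = a := rfl
@[simp] theorem mkG_g12 (a b c : (Mat F)ˣ) : (mkG a b c).g12 = b := rfl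
@[simp] theorem mkG_g2 (a b c : (Mat F)ˣ) : (mkG a b c).g2 = c := rfl

theorem smul_w (g : PairGroup F) (u : Mat F) : g • w u =
    ((g.g11 * (g.g2 0 0 • 1 + g.g2 0 1 • u) * g.g12,
      g.g11 * (g.g2 1 0 • 1 + g.g2 1 1 • u) * g.g12) : Mat F × Mat F) := rfl

/-- The conjugate `tr u - u` of `u`. -/
def conjMat (u : Mat F) : Mat F := u.trace • 1 - u

theorem mul_self_eq (u : Mat F) : u * u = u.trace • u - u.det • 1 := by
  ext i j
  fin_cases i <;> fin_cases j <;>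
    simp [Matrix.mul_apply, Fin.sum_univ_two, Matrix.trace_fin_two, Matrix.det_fin_two] <;> ring

theorem disc_w (u : Mat F) : disc (w u) = u.trace ^ 2 - 4 * u.det := by
  simp [disc, coeff0, coeff1, coeff2, quadForm, w, Matrix.det_fin_two, Matrix.trace_fin_two]
  ring

/-- The first coordinate of an element of `F[u]` in the basis `1, u`. -/
def coordX (u s : Mat F) : F :=
  (s.trace * (u.trace ^ 2 - 2 * u.det) - u.trace * (s * u).trace) / disc (w u)

/-- The second coordinate of an element of `F[u]` in the basis `1, u`. -/
def coordY (u s : Mat F) : F := (2 * (s * u).trace - s.trace * u.trace) / disc (w u)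

theorem coordX_lin {u : Mat F} (hu : disc (w u) ≠ 0) (x y : F) :
    coordX u (x • 1 + y • u) = x := by
  rw [coordX, div_eq_iff hu, disc_w, add_mul, smul_mul_assoc, smul_mul_assoc, mul_self_eq]
  simp [Matrix.trace_fin_two, Matrix.det_fin_two]
  ring

theorem coordY_lin {u : Mat F} (hu : disc (w u) ≠ 0) (x y : F) :
    coordY u (x • 1 + y • u) = y := by
  rw [coordY, div_eq_iff hu, disc_w, add_mul, smul_mul_assoc, smul_mul_assoc, mul_self_eq]
  simp [Matrix.trace_fin_two, Matrix.det_fin_two]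
  ring

theorem lin_injective {u : Mat F} (hu : disc (w u) ≠ 0) {x y x' y' : F}
    (h : x • 1 + y • u = x' • 1 + y' • u) : x = x' ∧ y = y' := by
  have h1 := congrArg (coordX u) h
  have h2 := congrArg (coordY u) h
  rw [coordX_lin hu, coordX_lin hu] at h1
  rw [coordY_lin hu, coordY_lin hu] at h2
  exact ⟨h1, h2⟩

theorem lin_mul_lin (u : Mat F) (x y x' y' : F) :
    (x • 1 + y • u) * (x' • 1 + y' • u) =
      (x * x' - u.det * (y * y')) • 1 + (x * y' + y * x' + u.trace * (y * y')) • u := by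
  have : (x • 1 + y • u) * (x' • 1 + y' • u) =
      (x * x') • 1 + (x * y' + y * x') • u + (y * y') • (u * u) := by
    simp only [add_mul, mul_add, smul_mul_assoc, mul_smul_comm, one_mul, mul_one]
    module
  rw [this, mul_self_eq]
  module

theorem det_lin (u : Mat F) (x y : F) :
    (x • 1 + y • u).det = x ^ 2 + x * y * u.trace + y ^ 2 * u.det := by
  simp [Matrix.det_fin_two, Matrix.trace_fin_two]
  ring

theorem trace_lin (u : Mat F) (x y : F) :
    (x • 1 + y • u).trace = 2 * x + y * u.trace := by
  simp [Matrix.trace_fin_two]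
  ring

theorem mem_adjoin_iff {R : Type*} [CommRing R] [Algebra R F] (u : Mat F)
    (ht : ∃ t : R, algebraMap R F t = u.trace) (hd : ∃ d : R, algebraMap R F d = u.det)
    (a : Mat F) : a ∈ Algebra.adjoin R {u} ↔
      ∃ x y : R, a = algebraMap R F x • 1 + algebraMap R F y • u := by
  constructor
  · intro h
    obtain ⟨t, ht⟩ := ht
    obtain ⟨d, hd⟩ := hd
    induction h using Algebra.adjoin_induction with
    | mem a ha => exact ⟨0, 1, by simpa using ha⟩
    | algebraMap r => exact ⟨r, 0, by simp [Algebra.algebraMap_eq_smul_one]⟩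
    | add a b _ _ ha hb =>
      obtain ⟨x, y, rfl⟩ := ha
      obtain ⟨x', y', rfl⟩ := hb
      exact ⟨x + x', y + y', by simp only [map_add]; module⟩
    | mul a b _ _ ha hb =>
      obtain ⟨x, y, rfl⟩ := ha
      obtain ⟨x', y', rfl⟩ := hb
      refine ⟨x * x' - d * (y * y'), x * y' + y * x' + t * (y * y'), ?_⟩
      rw [lin_mul_lin, ← ht, ← hd]
      simp only [map_add, map_sub, map_mul]
  · rintro ⟨x, y, rfl⟩
    have hu : u ∈ Algebra.adjoin R {u} := Algebra.subset_adjoin rfl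
    simp only [algebraMap_smul]
    exact add_mem (Subalgebra.smul_mem _ (one_mem _) _) (Subalgebra.smul_mem _ hu _)

theorem mem_adjoin_self_iff (u a : Mat F) :
    a ∈ Algebra.adjoin F {u} ↔ ∃ x y : F, a = x • 1 + y • u :=
  mem_adjoin_iff u ⟨_, rfl⟩ ⟨_, rfl⟩ a

theorem commute_lin (u : Mat F) (x y : F) : Commute (x • 1 + y • u) u := by
  simp [Commute, SemiconjBy, add_mul, mul_add]

/-- The centralizer of a regular element `u` is `F[u]`. -/
theorem commute_iff {u : Mat F} (hu : disc (w u) ≠ 0) (a : Mat F) :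
    Commute a u ↔ ∃ x y : F, a = x • 1 + y • u := by
  refine ⟨fun h => ?_, ?_⟩
  · have h00 := congrFun (congrFun h 0) 0
    have h01 := congrFun (congrFun h 0) 1
    have h10 := congrFun (congrFun h 1) 0
    simp only [Matrix.mul_apply, Fin.sum_univ_two] at h00 h01 h10
    by_cases hc : u 1 0 = 0
    · by_cases hb : u 0 1 = 0
      · have hd : u 1 1 - u 0 0 ≠ 0 := by
          intro h0
          apply hu
          rw [disc_w, Matrix.trace_fin_two, Matrix.det_fin_two, hc, sub_eq_zero.1 h0]
          ring
        simp only [hb, hc, mul_zero, zero_mul, add_zero, zero_add] at h01 h10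
        have e01 : a 0 1 = 0 := (mul_eq_zero.1 (by linear_combination h01 :
          a 0 1 * (u 1 1 - u 0 0) = 0)).resolve_right hd
        have e10 : a 1 0 = 0 := (mul_eq_zero.1 (by linear_combination -h10 :
          a 1 0 * (u 1 1 - u 0 0) = 0)).resolve_right hd
        refine ⟨a 0 0 - (a 1 1 - a 0 0) / (u 1 1 - u 0 0) * u 0 0,
          (a 1 1 - a 0 0) / (u 1 1 - u 0 0), ?_⟩
        ext i j
        fin_cases i <;> fin_cases j <;> simp [hb, hc, e01, e10]
        field_simp
        ring
      · refine ⟨a 0 0 - a 0 1 / u 0 1 * u 0 0, a 0 1 / u 0 1, ?_⟩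
        ext i j
        fin_cases i <;> fin_cases j <;> simp [hb]
        · field_simp
          linear_combination -h00
        · field_simp
          linear_combination -h01
    · refine ⟨a 0 0 - a 1 0 / u 1 0 * u 0 0, a 1 0 / u 1 0, ?_⟩
      ext i j
      fin_cases i <;> fin_cases j <;> simp [hc]
      · field_simp
        linear_combination h00
      · field_simp
        linear_combination h10
  · rintro ⟨x, y, rfl⟩
    exact commute_lin u x y

theorem lin_mul_inv {u : Mat F} (x y : F) (h : (x • 1 + y • u).det ≠ 0) :
    (x • 1 + y • u)⁻¹ = ((x + y * u.trace) / (x • 1 + y • u).det) • 1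
      + (-y / (x • 1 + y • u).det) • u := by
  refine Matrix.inv_eq_right_inv ?_
  rw [lin_mul_lin]
  have e1 : x * ((x + y * u.trace) / (x • 1 + y • u).det)
      - u.det * (y * (-y / (x • 1 + y • u).det)) = 1 := by
    field_simp
    rw [det_lin]
    ring
  have e2 : x * (-y / (x • 1 + y • u).det) + y * ((x + y * u.trace) / (x • 1 + y • u).det)
      + u.trace * (y * (-y / (x • 1 + y • u).det)) = 0 := by
    field_simp
    ring
  rw [e1, e2]
  simp

/-- A regular element is conjugate to its conjugate `tr u - u`. -/
theorem exists_conj_conjMat (u : Mat F) :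
    ∃ ν : (Mat F)ˣ, (ν : Mat F) * u = conjMat u * ν := by
  have key (p q r : F) (h : p * (u 0 0 - u 1 1) + q * u 1 0 + r * u 0 1 = 0)
      (hd : -p ^ 2 - q * r ≠ 0) : ∃ ν : (Mat F)ˣ, (ν : Mat F) * u = conjMat u * ν := by
    have hdet : (!![p, q; r, -p] : Mat F).det ≠ 0 := by
      rw [Matrix.det_fin_two_of]
      intro h0
      exact hd (by linear_combination h0)
    refine ⟨Matrix.GeneralLinearGroup.mkOfDetNeZero _ hdet, ?_⟩
    change (!![p, q; r, -p] : Mat F) * u = conjMat u * !![p, q; r, -p]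
    ext i j
    fin_cases i <;> fin_cases j <;>
      simp [conjMat, Matrix.mul_apply, Fin.sum_univ_two, Matrix.trace_fin_two]
    · linear_combination h
    · ring
    · ring
    · linear_combination h
  by_cases hc : u 1 0 = 0
  · by_cases hb : u 0 1 = 0
    · exact key 0 1 1 (by simp [hb, hc]) (by simp)
    · exact key (u 0 1) 0 (-(u 0 0 - u 1 1)) (by ring) (by simpa using hb)
  · exact key (u 1 0) (-(u 0 0 - u 1 1)) 0 (by ring) (by simpa using hc)

theorem conjMat_ne {u : Mat F} (h2 : (2 : F) ≠ 0) (hu : disc (w u) ≠ 0) : conjMat u ≠ u := by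
  intro h
  have : u.trace • (1 : Mat F) + (-1 : F) • u = (0 : F) • 1 + (1 : F) • u := by
    rw [conjMat] at h
    rw [zero_smul, zero_add, one_smul, neg_smul, one_smul, ← sub_eq_add_neg, h]
  have := (lin_injective hu this).2
  exact h2 (by linear_combination -this)

end Quadratic

/-! ### The stabilizer of `(1, u)` -/

section Stabilizer

variable {F : Type*} [Field F]

theorem mem_stabilizer_w_iff (u : Mat F) (g : PairGroup F) :
    g ∈ MulAction.stabilizer (PairGroup F) (w u) ↔
      g.g11 * (g.g2 0 0 • 1 + g.g2 0 1 • u) * g.g12 = 1 ∧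
      g.g11 * (g.g2 1 0 • 1 + g.g2 1 1 • u) * g.g12 = u := by
  rw [MulAction.mem_stabilizer_iff, smul_w]
  exact Prod.ext_iff

/-- The elements of the stabilizer of `(1, u)` whose first component commutes with `u`. -/
def centralStab (u : Mat F) : Subgroup (PairGroup F) where
  carrier := {g | g ∈ MulAction.stabilizer (PairGroup F) (w u) ∧ Commute g.g11 u}
  one_mem' := ⟨one_mem _, Commute.one_left u⟩
  mul_mem' ha hb := ⟨mul_mem ha.1 hb.1, ha.2.mul_left hb.2⟩
  inv_mem' {a} ha := ⟨inv_mem ha.1, (show Commute ((a.1 : (Mat F)ˣ) : Mat F) u from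
    ha.2).units_inv_left⟩

theorem mem_centralStab {u : Mat F} {g : PairGroup F} : g ∈ centralStab u ↔
    g ∈ MulAction.stabilizer (PairGroup F) (w u) ∧ Commute g.g11 u := Iff.rfl

theorem isUnit_det_g11 (g : PairGroup F) : IsUnit g.g11.det :=
  (Matrix.isUnit_iff_isUnit_det _).1 g.1.isUnit

theorem isUnit_det_g12 (g : PairGroup F) : IsUnit g.g12.det :=
  (Matrix.isUnit_iff_isUnit_det _).1 ((Units.opEquiv g.2.1).unop.isUnit)

theorem isUnit_det_g2 (g : PairGroup F) : IsUnit g.g2.det :=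
  (Matrix.isUnit_iff_isUnit_det _).1 g.2.2.isUnit

/-- In the stabilizer of `(1, u)`, the third component is determined by the first two. -/
theorem g2_eq_of_mem_stabilizer {u : Mat F} (hu : disc (w u) ≠ 0) {g h : PairGroup F}
    (hg : g ∈ MulAction.stabilizer (PairGroup F) (w u))
    (hh : h ∈ MulAction.stabilizer (PairGroup F) (w u))
    (h1 : g.g11 = h.g11) (h2 : g.g12 = h.g12) : g = h := by
  rw [mem_stabilizer_w_iff] at hg hh
  refine PairGroup.ext' h1 h2 ?_
  have cancel {a b : Mat F} (hab : g.g11 * a * g.g12 = g.g11 * b * g.g12) : a = b := by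
    have h12 : IsUnit g.g12 := (Matrix.isUnit_iff_isUnit_det _).2 (isUnit_det_g12 g)
    have h11 : IsUnit g.g11 := (Matrix.isUnit_iff_isUnit_det _).2 (isUnit_det_g11 g)
    exact h11.mul_left_cancel (h12.mul_right_cancel hab)
  rw [← h1, ← h2] at hh
  have e1 := lin_injective hu (cancel (hg.1.trans hh.1.symm))
  have e2 := lin_injective hu (cancel (hg.2.trans hh.2.symm))
  ext i j
  fin_cases i <;> fin_cases j
  exacts [e1.1, e1.2, e2.1, e2.2]

/-- The first component of an element of the stabilizer normalizes `F[u]`. -/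
theorem stabilizer_dichotomy {u : Mat F} (h2 : (2 : F) ≠ 0) (hu : disc (w u) ≠ 0)
    {g : PairGroup F} (hg : g ∈ MulAction.stabilizer (PairGroup F) (w u)) :
    Commute g.g11 u ∨ g.g11 * conjMat u = u * g.g11 := by
  rw [mem_stabilizer_w_iff] at hg
  obtain ⟨h1, h3⟩ := hg
  set a := g.g2 0 0 • (1 : Mat F) + g.g2 0 1 • u with ha
  set b := g.g2 1 0 • (1 : Mat F) + g.g2 1 1 • u with hb
  have hA : a.det ≠ 0 := by
    intro h0
    have := congrArg Matrix.det h1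
    rw [Matrix.det_mul, Matrix.det_mul, h0] at this
    simp at this
  have hAu : IsUnit a.det := isUnit_iff_ne_zero.2 hA
  have h11 : IsUnit g.g11.det := isUnit_det_g11 g
  have e12 : g.g12 * g.g11 = a⁻¹ := by
    have h4 : a * (g.g12 * g.g11) = 1 := by
      have : g.g12 * (g.g11 * a) = 1 := mul_eq_one_comm.1 h1
      rw [← mul_assoc] at this
      exact mul_eq_one_comm.1 this
    exact (Matrix.inv_eq_right_inv h4).symm
  have hconj : g.g11 * (b * a⁻¹) = u * g.g11 := by
    rw [← e12, ← h3]
    simp only [mul_assoc]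
  obtain ⟨x, y, hxy⟩ : ∃ x y : F, b * a⁻¹ = x • 1 + y • u := by
    rw [← commute_iff hu, lin_mul_inv _ _ hA]
    exact (commute_lin u _ _).mul_left (commute_lin u _ _)
  rw [hxy] at hconj
  have hM : x • 1 + y • u = g.g11⁻¹ * u * g.g11 := by
    rw [mul_assoc, ← hconj, ← mul_assoc, Matrix.nonsing_inv_mul _ h11, one_mul]
  have htr : 2 * x + y * u.trace = u.trace := by
    rw [← trace_lin, hM, Matrix.trace_mul_comm, ← mul_assoc, Matrix.mul_nonsing_inv _ h11, one_mul]
  have hdet : x ^ 2 + x * y * u.trace + y ^ 2 * u.det = u.det := by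
    rw [← det_lin, hM, Matrix.det_mul, Matrix.det_mul, mul_right_comm, ← Matrix.det_mul,
      Matrix.nonsing_inv_mul _ h11, Matrix.det_one, one_mul]
  have hy : (y - 1) * (y + 1) = 0 := by
    have : (y ^ 2 - 1) * disc (w u) = 0 := by
      rw [disc_w]
      linear_combination (2 * x + y * u.trace + u.trace) * htr - 4 * hdet
    have := (mul_eq_zero.1 this).resolve_right hu
    linear_combination this
  rcases mul_eq_zero.1 hy with hy | hy
  · left
    have hy' : y = 1 := by linear_combination hy
    have hx : x = 0 := by
      refine (mul_eq_zero.1 (?_ : 2 * x = 0)).resolve_left h2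
      rw [hy'] at htr
      linear_combination htr
    rw [hx, hy', zero_smul, zero_add, one_smul] at hconj
    exact hconj
  · right
    have hy' : y = -1 := by linear_combination hy
    have hx : x = u.trace := by
      have : 2 * (x - u.trace) = 0 := by
        rw [hy'] at htr
        linear_combination htr
      exact sub_eq_zero.1 ((mul_eq_zero.1 this).resolve_left h2)
    rw [hx, hy', neg_smul, one_smul, ← sub_eq_add_neg] at hconj
    exact hconj

/-- The stabilizer of `(1, u)` contains an element that induces the nontrivial automorphism of
`F[u]`. -/
theorem exists_mem_stabilizer_conj (u : Mat F) :
    ∃ g ∈ MulAction.stabilizer (PairGroup F) (w u), g.g11 * conjMat u = u * g.g11 := by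
  obtain ⟨ν, hν⟩ := exists_conj_conjMat u
  have hν' : (ν : Mat F) * conjMat u = u * ν := by
    rw [conjMat] at hν ⊢
    rw [mul_sub, hν, sub_mul]
    simp
  have hdet : (!![1, 0; u.trace, -1] : Mat F).det ≠ 0 := by
    rw [Matrix.det_fin_two_of]
    simp
  obtain ⟨γ, hγ⟩ : ∃ γ : (Mat F)ˣ, (γ : Mat F) = !![1, 0; u.trace, -1] :=
    ⟨Matrix.GeneralLinearGroup.mkOfDetNeZero _ hdet, rfl⟩
  refine ⟨mkG ν ν⁻¹ γ, ?_, hν'⟩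
  rw [mem_stabilizer_w_iff, mkG_g11, mkG_g12, mkG_g2, hγ]
  constructor
  · simp
  · have : u.trace • (1 : Mat F) + (-1 : F) • u = conjMat u := by rw [conjMat]; module
    simp only [Matrix.of_apply, Matrix.cons_val', Matrix.cons_val_zero,
      Matrix.cons_val_one, Matrix.cons_val_fin_one]
    rw [this, hν', mul_assoc, Units.mul_inv, mul_one]

/-- The matrix `g` with `g · ᵗ(s, s u) = ᵗ(1, u)`. -/
def gMat (u s : Mat F) : Mat F :=
  !![coordX u s⁻¹, coordY u s⁻¹;
    -u.det * coordY u s⁻¹, coordX u s⁻¹ + u.trace * coordY u s⁻¹]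

theorem coord_eq {u : Mat F} (hu : disc (w u) ≠ 0) {s : Mat F} (hs : Commute s u) :
    coordX u s • 1 + coordY u s • u = s := by
  obtain ⟨x, y, rfl⟩ := (commute_iff hu s).1 hs
  rw [coordX_lin hu, coordY_lin hu]

theorem det_gMat {u : Mat F} (hu : disc (w u) ≠ 0) {s : Mat F} (hs : Commute s⁻¹ u) :
    (gMat u s).det = s.det⁻¹ := by
  rw [← Ring.inverse_eq_inv', ← Matrix.det_nonsing_inv]
  conv_rhs => rw [← coord_eq hu hs, det_lin]
  rw [gMat, Matrix.det_fin_two_of]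
  ring

theorem commute_inv {u s : Mat F} (hs : Commute s u) (hdet : IsUnit s.det) : Commute s⁻¹ u := by
  lift s to (Mat F)ˣ using (Matrix.isUnit_iff_isUnit_det s).2 hdet
  rw [← Matrix.coe_units_inv]
  exact hs.units_inv_left

theorem gOf_eq {u : Mat F} (hu : disc (w u) ≠ 0) {s : Mat F} (hs : Commute s u)
    (hdet : IsUnit s.det) : (gOf u s : Mat F) = gMat u s := by
  have hsi := commute_inv hs hdet
  have hg : (gMat u s).det ≠ 0 := by
    rw [det_gMat hu hsi]
    exact inv_ne_zero hdet.ne_zero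
  have lin (x y : F) : x • s + y • (s * u) = s * (x • 1 + y • u) := by simp [mul_add]
  have e0 : s * (coordX u s⁻¹ • 1 + coordY u s⁻¹ • u) = 1 := by
    rw [coord_eq hu hsi, Matrix.mul_nonsing_inv _ hdet]
  have e1 : s * ((-u.det * coordY u s⁻¹) • 1 + (coordX u s⁻¹ + u.trace * coordY u s⁻¹) • u) = u := by
    have : (-u.det * coordY u s⁻¹) • 1 + (coordX u s⁻¹ + u.trace * coordY u s⁻¹) • u =
        (coordX u s⁻¹ • 1 + coordY u s⁻¹ • u) * u := by
      rw [add_mul, smul_mul_assoc, smul_mul_assoc, mul_self_eq, one_mul]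
      module
    rw [this, ← mul_assoc, e0, one_mul]
  have hex : ∃! g : GL (Fin 2) F,
      g.1 0 0 • s + g.1 0 1 • (s * u) = 1 ∧ g.1 1 0 • s + g.1 1 1 • (s * u) = u := by
    refine ⟨Matrix.GeneralLinearGroup.mkOfDetNeZero _ hg, ⟨?_, ?_⟩, ?_⟩
    · rw [lin]; exact e0
    · rw [lin]; exact e1
    · rintro g ⟨h1, h2⟩
      rw [lin] at h1 h2
      have hsu : IsUnit s := (Matrix.isUnit_iff_isUnit_det s).2 hdet
      have k1 := lin_injective hu (hsu.mul_left_cancel (h1.trans e0.symm))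
      have k2 := lin_injective hu (hsu.mul_left_cancel (h2.trans e1.symm))
      ext i j
      fin_cases i <;> fin_cases j
      exacts [k1.1, k1.2, k2.1, k2.2]
  have huniq := hex.unique hex.choose_spec.1 (y₂ := Matrix.GeneralLinearGroup.mkOfDetNeZero _ hg)
    ⟨by rw [lin]; exact e0, by rw [lin]; exact e1⟩
  rw [gOf, dif_pos hex, huniq]
  rfl

theorem QuadUnits.commute {u : Mat F} (s : QuadUnits u) : Commute (s.toMat : Mat F) u := by
  obtain ⟨x, y, h⟩ := (mem_adjoin_self_iff u _).1
    (Units.val (α := Algebra.adjoin F {u}) s).2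
  have h' : (s.toMat : Mat F) = x • 1 + y • u := h
  rw [h']
  exact commute_lin u x y

theorem QuadUnits.toMat_injective (u : Mat F) :
    Function.Injective (QuadUnits.toMat : QuadUnits u →* (Mat F)ˣ) :=
  Units.map_injective Subtype.val_injective

theorem QuadUnits.exists_toMat_eq {u : Mat F} (hu : disc (w u) ≠ 0) (a : (Mat F)ˣ)
    (ha : Commute (a : Mat F) u) : ∃ s : QuadUnits u, s.toMat = a := by
  have h1 := (mem_adjoin_self_iff u _).2 ((commute_iff hu _).1 ha)
  have h2 := (mem_adjoin_self_iff u _).2 ((commute_iff hu _).1 ha.units_inv_left)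
  exact ⟨(⟨⟨a, h1⟩, ⟨_, h2⟩, Subtype.ext (Units.mul_inv a), Subtype.ext (Units.inv_mul a)⟩ :
    (Algebra.adjoin F {u})ˣ), Units.ext rfl⟩

theorem psi_g11 (u : Mat F) (s : QuadUnits u × QuadUnits u) :
    (psi u s).g11 = s.1.toMat := rfl

theorem psi_g12 (u : Mat F) (s : QuadUnits u × QuadUnits u) :
    (psi u s).g12 = s.2.toMat := rfl

theorem psi_g2 {u : Mat F} (hu : disc (w u) ≠ 0) (s : QuadUnits u × QuadUnits u) :
    (psi u s).g2 = gMat u ((s.1.toMat : Mat F) * (s.2.toMat : Mat F)) :=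
  gOf_eq hu (s.1.commute.mul_left s.2.commute)
    ((Matrix.isUnit_iff_isUnit_det _).1 (s.1.toMat.isUnit.mul s.2.toMat.isUnit))

theorem mkG_mem_stabilizer {u : Mat F} (hu : disc (w u) ≠ 0) {g : PairGroup F}
    (h1 : Commute g.g11 u) (h2 : Commute g.g12 u) (h3 : g.g2 = gMat u (g.g11 * g.g12)) :
    g ∈ MulAction.stabilizer (PairGroup F) (w u) := by
  have hdet : IsUnit (g.g11 * g.g12).det := by
    rw [Matrix.det_mul]
    exact (isUnit_det_g11 g).mul (isUnit_det_g12 g)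
  have hsi := commute_inv (h1.mul_left h2) hdet
  have comm {a : Mat F} (ha : Commute a u) : Commute a g.g12 := by
    obtain ⟨x, y, hxy⟩ := (commute_iff hu _).1 h2
    rw [hxy]
    exact ((Commute.one_right a).smul_right x).add_right (ha.smul_right y)
  rw [mem_stabilizer_w_iff, h3]
  have e0 : g.g11 * (coordX u (g.g11 * g.g12)⁻¹ • 1 + coordY u (g.g11 * g.g12)⁻¹ • u) * g.g12
      = 1 := by
    rw [coord_eq hu hsi, mul_assoc, (comm hsi).eq, ← mul_assoc, Matrix.mul_nonsing_inv _ hdet]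
  refine ⟨e0, ?_⟩
  have : (gMat u (g.g11 * g.g12) 1 0) • 1 + (gMat u (g.g11 * g.g12) 1 1) • u =
      (coordX u (g.g11 * g.g12)⁻¹ • 1 + coordY u (g.g11 * g.g12)⁻¹ • u) * u := by
    rw [add_mul, smul_mul_assoc, smul_mul_assoc, mul_self_eq, one_mul]
    simp only [gMat, Matrix.of_apply, Matrix.cons_val', Matrix.cons_val_zero,
      Matrix.cons_val_one, Matrix.cons_val_fin_one]
    module
  rw [this, ← mul_assoc, mul_assoc, ← h2.eq, ← mul_assoc, e0, one_mul]

theorem g12_commute_of_mem_centralStab {u : Mat F} {g : PairGroup F}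
    (hg : g ∈ centralStab u) : Commute g.g12 u := by
  obtain ⟨hg, h1⟩ := hg
  rw [mem_stabilizer_w_iff] at hg
  have h4 : (g.g11 * (g.g2 0 0 • 1 + g.g2 0 1 • u))⁻¹ = g.g12 := Matrix.inv_eq_right_inv hg.1
  rw [← h4]
  refine commute_inv (h1.mul_left (commute_lin u _ _)) ?_
  rw [isUnit_iff_ne_zero]
  intro h0
  have := congrArg Matrix.det hg.1
  rw [Matrix.det_mul, h0] at this
  simp at this

theorem psi_mem_centralStab {u : Mat F} (hu : disc (w u) ≠ 0) (s : QuadUnits u × QuadUnits u) :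
    psi u s ∈ centralStab u :=
  ⟨mkG_mem_stabilizer hu s.1.commute s.2.commute (psi_g2 hu s), s.1.commute⟩

theorem exists_psi_eq {u : Mat F} (hu : disc (w u) ≠ 0) {g : PairGroup F}
    (hg : g ∈ centralStab u) : ∃ s, psi u s = g := by
  obtain ⟨s₁, h₁⟩ := QuadUnits.exists_toMat_eq hu g.1 hg.2
  obtain ⟨s₂, h₂⟩ := QuadUnits.exists_toMat_eq hu (Units.opEquiv g.2.1).unop
    (g12_commute_of_mem_centralStab hg)
  exact ⟨(s₁, s₂), g2_eq_of_mem_stabilizer hu (psi_mem_centralStab hu _).1 hg.1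
    (by rw [psi_g11, h₁]; rfl) (by rw [psi_g12, h₂]; rfl)⟩

theorem psi_mul {u : Mat F} (hu : disc (w u) ≠ 0) (s t : QuadUnits u × QuadUnits u) :
    psi u (s * t) = psi u s * psi u t := by
  have h1 := psi_mem_centralStab hu (s * t)
  have h2 := mul_mem (psi_mem_centralStab hu s) (psi_mem_centralStab hu t)
  refine g2_eq_of_mem_stabilizer hu h1.1 h2.1 ?_ ?_
  · rw [g11_mul, psi_g11, psi_g11, psi_g11, Prod.fst_mul, map_mul, Units.val_mul]
  · rw [g12_mul, psi_g12, psi_g12, psi_g12, Prod.snd_mul, map_mul, Units.val_mul]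
    obtain ⟨x, y, hxy⟩ := (commute_iff hu _).1 s.2.commute
    rw [hxy]
    exact (((Commute.one_right _).smul_right x).add_right (t.2.commute.smul_right y)).symm

end Stabilizer

/-! ### The identity component of the stabilizer of `(1, u)` -/

section Zariski

variable {F : Type*} [Field F]

theorem isClosed_zeroLocus {f : PairGroup F → F} (hf : f ∈ regularFunctions F) :
    @IsClosed _ (zariski F) {g | f g = 0} := by
  let := zariski F
  rw [← isOpen_compl_iff]
  exact TopologicalSpace.isOpen_generateFrom_of_mem ⟨f, hf, rfl⟩

theorem isClosed_intertwiner (a b : Mat F) :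
    @IsClosed _ (zariski F) {g : PairGroup F | g.g11 * a = b * g.g11} := by
  let := zariski F
  have h11 (i j : Fin 2) : (fun g : PairGroup F => g.g11 i j) ∈ regularFunctions F :=
    Algebra.subset_adjoin ⟨i, j, Or.inl rfl⟩
  have : {g : PairGroup F | g.g11 * a = b * g.g11} =
      ⋂ i, ⋂ j, {g | (g.g11 * a) i j - (b * g.g11) i j = 0} := by
    ext g
    simp only [Set.mem_ofPred_eq, Set.mem_iInter, sub_eq_zero]
    exact ⟨fun h i j => by rw [h], fun h => by ext i j; exact h i j⟩
  rw [this]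
  refine isClosed_iInter fun i => isClosed_iInter fun j => isClosed_zeroLocus ?_
  have e : (fun g : PairGroup F => (g.g11 * a) i j - (b * g.g11) i j) =
      (a 0 j • (fun g : PairGroup F => g.g11 i 0) + a 1 j • fun g : PairGroup F => g.g11 i 1) -
      (b i 0 • (fun g : PairGroup F => g.g11 0 j) + b i 1 • fun g : PairGroup F => g.g11 1 j) := by
    funext g
    simp [Matrix.mul_apply, Fin.sum_univ_two, mul_comm]
  rw [e]
  exact sub_mem (add_mem (Subalgebra.smul_mem _ (h11 _ _) _) (Subalgebra.smul_mem _ (h11 _ _) _))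
    (add_mem (Subalgebra.smul_mem _ (h11 _ _) _) (Subalgebra.smul_mem _ (h11 _ _) _))

/-- The property of being a polynomial function. -/
def IsPolyFun (f : F → F) : Prop := ∃ p : Polynomial F, ∀ z, f z = p.eval z

theorem IsPolyFun.const (a : F) : IsPolyFun fun _ : F => a := ⟨Polynomial.C a, by simp⟩

theorem IsPolyFun.add {f g : F → F} (hf : IsPolyFun f) (hg : IsPolyFun g) :
    IsPolyFun fun z => f z + g z := by
  obtain ⟨p, hp⟩ := hf
  obtain ⟨r, hr⟩ := hg
  exact ⟨p + r, by simp [hp, hr]⟩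

theorem IsPolyFun.mul {f g : F → F} (hf : IsPolyFun f) (hg : IsPolyFun g) :
    IsPolyFun fun z => f z * g z := by
  obtain ⟨p, hp⟩ := hf
  obtain ⟨r, hr⟩ := hg
  exact ⟨p * r, by simp [hp, hr]⟩

theorem IsPolyFun.sub {f g : F → F} (hf : IsPolyFun f) (hg : IsPolyFun g) :
    IsPolyFun fun z => f z - g z := by
  obtain ⟨p, hp⟩ := hf
  obtain ⟨r, hr⟩ := hg
  exact ⟨p - r, by simp [hp, hr]⟩

theorem isPolyFun_line (a : Mat F) (i j : Fin 2) :
    IsPolyFun fun z : F => ((1 : Mat F) + z • (a - 1)) i j :=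
  ⟨Polynomial.C ((1 : Mat F) i j) + Polynomial.X * Polynomial.C ((a - 1) i j), by simp⟩

theorem IsPolyFun.mat_mul {f g : F → Mat F} (hf : ∀ i j, IsPolyFun fun z => f z i j)
    (hg : ∀ i j, IsPolyFun fun z => g z i j) (i j : Fin 2) :
    IsPolyFun fun z => (f z * g z) i j := by
  simp only [Matrix.mul_apply, Fin.sum_univ_two]
  exact ((hf i 0).mul (hg 0 j)).add ((hf i 1).mul (hg 1 j))

theorem IsPolyFun.mat_det {f : F → Mat F} (hf : ∀ i j, IsPolyFun fun z => f z i j) :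
    IsPolyFun fun z => (f z).det := by
  simp only [Matrix.det_fin_two]
  exact ((hf 0 0).mul (hf 1 1)).sub ((hf 0 1).mul (hf 1 0))

theorem IsPolyFun.mat_trace {f : F → Mat F} (hf : ∀ i j, IsPolyFun fun z => f z i j) :
    IsPolyFun fun z => (f z).trace := by
  simp only [Matrix.trace_fin_two]
  exact (hf 0 0).add (hf 1 1)

theorem IsPolyFun.mat_adjugate {f : F → Mat F} (hf : ∀ i j, IsPolyFun fun z => f z i j)
    (i j : Fin 2) : IsPolyFun fun z => (f z).adjugate i j := by
  have neg {φ : F → F} (h : IsPolyFun φ) : IsPolyFun fun z => -φ z := by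
    simpa using (IsPolyFun.const 0).sub h
  simp only [Matrix.adjugate_fin_two]
  fin_cases i <;> fin_cases j <;> simp
  exacts [hf 1 1, neg (hf 0 1), neg (hf 1 0), hf 0 0]

theorem IsPolyFun.mat_coordX (u : Mat F) {f : F → Mat F}
    (hf : ∀ i j, IsPolyFun fun z => f z i j) : IsPolyFun fun z => coordX u (f z) := by
  have h1 : IsPolyFun fun z => (f z * u).trace :=
    .mat_trace (.mat_mul hf fun i j => .const (u i j))
  have h2 := ((IsPolyFun.mat_trace hf).mul (.const (u.trace ^ 2 - 2 * u.det))).sub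
    ((IsPolyFun.const u.trace).mul h1)
  have h3 := h2.mul (.const (disc (w u))⁻¹)
  simpa only [coordX, div_eq_mul_inv] using h3

theorem IsPolyFun.mat_coordY (u : Mat F) {f : F → Mat F}
    (hf : ∀ i j, IsPolyFun fun z => f z i j) : IsPolyFun fun z => coordY u (f z) := by
  have h1 : IsPolyFun fun z => (f z * u).trace :=
    .mat_trace (.mat_mul hf fun i j => .const (u i j))
  have h2 := ((IsPolyFun.const 2).mul h1).sub ((IsPolyFun.mat_trace hf).mul (.const u.trace))
  have h3 := h2.mul (.const (disc (w u))⁻¹)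
  simpa only [coordY, div_eq_mul_inv] using h3

theorem coordX_smul (u s : Mat F) (c : F) : coordX u (c • s) = c * coordX u s := by
  simp only [coordX, Matrix.trace_smul, smul_mul_assoc, smul_eq_mul]
  ring

theorem coordY_smul (u s : Mat F) (c : F) : coordY u (c • s) = c * coordY u s := by
  simp only [coordY, Matrix.trace_smul, smul_mul_assoc, smul_eq_mul]
  ring

theorem inv_eq_smul_adjugate (s : Mat F) : s⁻¹ = s.det⁻¹ • s.adjugate := by
  rw [Matrix.inv_def, Ring.inverse_eq_inv']

theorem preirreducibleSpace_cofinite (Z : Type*) [Infinite Z] :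
    PreirreducibleSpace (CofiniteTopology Z) where
  isPreirreducible_univ := by
    rintro s t hs ht ⟨x, -, hx⟩ ⟨y, -, hy⟩
    rw [CofiniteTopology.isOpen_iff] at hs ht
    have hfin := (hs ⟨x, hx⟩).union (ht ⟨y, hy⟩)
    rw [← Set.compl_inter] at hfin
    have : Infinite (CofiniteTopology Z) := Infinite.of_injective _ CofiniteTopology.of.injective
    obtain ⟨z, hz⟩ := hfin.infinite_compl.nonempty
    rw [compl_compl] at hz
    exact ⟨z, trivial, hz⟩

/-- An element of the centralizing part of the stabilizer is joined to `1` by a rational curve. -/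
theorem exists_preconnected_curve [Infinite F] {u : Mat F} (hu : disc (w u) ≠ 0)
    {g : PairGroup F} (hg : g ∈ centralStab u) :
    ∃ Γ : Set (PairGroup F), @IsPreconnected _ (zariski F) Γ ∧ 1 ∈ Γ ∧ g ∈ Γ ∧
      Γ ⊆ MulAction.stabilizer (PairGroup F) (w u) := by
  let := zariski F
  have hg2 := g12_commute_of_mem_centralStab hg
  let s₁ : F → Mat F := fun z => 1 + z • (g.g11 - 1)
  let s₂ : F → Mat F := fun z => 1 + z • (g.g12 - 1)
  have hs₁ (z : F) : Commute (s₁ z) u :=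
    (Commute.one_left u).add_left ((hg.2.sub_left (Commute.one_left u)).smul_left z)
  have hs₂ (z : F) : Commute (s₂ z) u :=
    (Commute.one_left u).add_left ((hg2.sub_left (Commute.one_left u)).smul_left z)
  have p₁ : ∀ i j, IsPolyFun fun z => s₁ z i j := isPolyFun_line _
  have p₂ : ∀ i j, IsPolyFun fun z => s₂ z i j := isPolyFun_line _
  let D : F → F := fun z => (s₁ z * s₂ z).det
  have pD : IsPolyFun D := IsPolyFun.mat_det (IsPolyFun.mat_mul p₁ p₂)
  let Z := {z : F // D z ≠ 0}
  have d₁ (z : Z) : (s₁ z).det ≠ 0 := fun h => z.2 (by simp only [D, Matrix.det_mul, h, zero_mul])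
  have d₂ (z : Z) : (s₂ z).det ≠ 0 := fun h => z.2 (by simp only [D, Matrix.det_mul, h, mul_zero])
  have dg (z : Z) : (gMat u (s₁ z * s₂ z)).det ≠ 0 := by
    rw [det_gMat hu (commute_inv ((hs₁ z).mul_left (hs₂ z)) (isUnit_iff_ne_zero.2 z.2))]
    exact inv_ne_zero z.2
  let c : Z → PairGroup F := fun z =>
    mkG (Matrix.GeneralLinearGroup.mkOfDetNeZero _ (d₁ z))
      (Matrix.GeneralLinearGroup.mkOfDetNeZero _ (d₂ z))
      (Matrix.GeneralLinearGroup.mkOfDetNeZero _ (dg z))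
  have c11 (z : Z) : (c z).g11 = s₁ z := rfl
  have c12 (z : Z) : (c z).g12 = s₂ z := rfl
  have c2 (z : Z) : (c z).g2 = gMat u (s₁ z * s₂ z) := rfl
  have hcmem (z : Z) : c z ∈ MulAction.stabilizer (PairGroup F) (w u) :=
    mkG_mem_stabilizer hu (hs₁ z) (hs₂ z) rfl
  have hpoly (f : PairGroup F → F) (hf : f ∈ regularFunctions F) :
      ∃ (N : ℕ) (p : F → F), IsPolyFun p ∧ ∀ z : Z, f (c z) * D z ^ N = p z := by
    induction hf using Algebra.adjoin_induction with
    | mem f hf =>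
      obtain ⟨i, j, rfl | rfl | rfl⟩ := hf
      · exact ⟨0, _, p₁ i j, fun z => by
          rw [pow_zero, mul_one, ← c11]⟩
      · exact ⟨0, _, p₂ i j, fun z => by
          rw [pow_zero, mul_one, ← c12]⟩
      · have pX := IsPolyFun.mat_coordX u (IsPolyFun.mat_adjugate (IsPolyFun.mat_mul p₁ p₂))
        have pY := IsPolyFun.mat_coordY u (IsPolyFun.mat_adjugate (IsPolyFun.mat_mul p₁ p₂))
        have eX (z : Z) : coordX u (s₁ z * s₂ z)⁻¹ * D z ^ 1 =
            coordX u (s₁ z * s₂ z).adjugate := by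
          rw [inv_eq_smul_adjugate, coordX_smul, pow_one, mul_comm, ← mul_assoc,
            mul_inv_cancel₀ z.2, one_mul]
        have eY (z : Z) : coordY u (s₁ z * s₂ z)⁻¹ * D z ^ 1 =
            coordY u (s₁ z * s₂ z).adjugate := by
          rw [inv_eq_smul_adjugate, coordY_smul, pow_one, mul_comm, ← mul_assoc,
            mul_inv_cancel₀ z.2, one_mul]
        fin_cases i <;> fin_cases j <;> simp only [c2, gMat, Fin.zero_eta, Fin.mk_one,
          Matrix.of_apply, Matrix.cons_val', Matrix.cons_val_zero,
          Matrix.cons_val_one, Matrix.cons_val_fin_one]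
        · exact ⟨1, _, pX, eX⟩
        · exact ⟨1, _, pY, eY⟩
        · exact ⟨1, _, (IsPolyFun.const (-u.det)).mul pY, fun z => by rw [mul_assoc, eY]⟩
        · exact ⟨1, _, pX.add ((IsPolyFun.const u.trace).mul pY),
            fun z => by rw [add_mul, mul_assoc, eY, eX]⟩
    | algebraMap r => exact ⟨0, _, .const r, fun z => by simp⟩
    | add f h _ _ hf hh =>
      obtain ⟨N, p, hp, hpz⟩ := hf
      obtain ⟨M, r, hr, hrz⟩ := hh
      have hpow (n : ℕ) : IsPolyFun fun z => D z ^ n := by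
        obtain ⟨d, hd⟩ := pD
        exact ⟨d ^ n, by simp [hd]⟩
      refine ⟨N + M, _, (hp.mul (hpow M)).add (hr.mul (hpow N)), fun z => ?_⟩
      rw [← hpz, ← hrz, Pi.add_apply]
      ring
    | mul f h _ _ hf hh =>
      obtain ⟨N, p, hp, hpz⟩ := hf
      obtain ⟨M, r, hr, hrz⟩ := hh
      refine ⟨N + M, _, hp.mul hr, fun z => ?_⟩
      rw [← hpz, ← hrz, Pi.mul_apply]
      ring
  have hcont : Continuous (c ∘ CofiniteTopology.of.symm) := by
    refine continuous_generateFrom_iff.2 ?_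
    rintro _ ⟨f, hf, rfl⟩
    obtain ⟨N, p, ⟨P, hP⟩, hp⟩ := hpoly f hf
    rw [CofiniteTopology.isOpen_iff]
    rintro ⟨z₁, hz₀⟩
    obtain ⟨z₀, rfl⟩ := CofiniteTopology.of.surjective z₁
    replace hz₀ : f (c z₀) ≠ 0 := hz₀
    have hP0 : P ≠ 0 := by
      rintro rfl
      have := hp z₀
      rw [hP, Polynomial.eval_zero] at this
      exact (mul_ne_zero hz₀ (pow_ne_zero N z₀.2)) this
    have hfin : {z : F | P.IsRoot z}.Finite := Polynomial.finite_setOfPred_isRoot hP0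
    refine Set.Finite.subset (hfin.preimage (f := fun z => (CofiniteTopology.of.symm z : Z).1)
      (Subtype.val_injective.comp CofiniteTopology.of.symm.injective).injOn) ?_
    intro z hz
    simp only [Set.mem_compl_iff, Set.mem_preimage, Set.mem_ofPred_eq, not_not] at hz
    change P.eval (CofiniteTopology.of.symm z : Z).1 = 0
    rw [← hP, ← hp, (show f (c (CofiniteTopology.of.symm z)) = 0 from hz), zero_mul]
  have hZinf : Infinite Z := by
    obtain ⟨P, hP⟩ := pD
    have hP0 : P ≠ 0 := by
      rintro rfl
      have := hP 0
      simp [D, s₁, s₂] at this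
    have hfin : {z : F | P.IsRoot z}.Finite := Polynomial.finite_setOfPred_isRoot hP0
    have := hfin.infinite_compl.to_subtype
    refine Infinite.of_injective (fun z : ↑({z : F | P.IsRoot z}ᶜ) => (⟨z.1, ?_⟩ : Z)) ?_
    · rw [hP]
      exact z.2
    · intro a b hab
      exact Subtype.ext (congrArg (fun z : Z => z.1) hab)
  have := preirreducibleSpace_cofinite Z
  have h0 : D 0 ≠ 0 := by simp [D, s₁, s₂]
  have h1 : D 1 ≠ 0 := by
    simp only [D, s₁, s₂, one_smul, add_sub_cancel, Matrix.det_mul]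
    exact mul_ne_zero (isUnit_det_g11 g).ne_zero (isUnit_det_g12 g).ne_zero
  refine ⟨Set.range c, ?_, ⟨⟨0, h0⟩, ?_⟩, ⟨⟨1, h1⟩, ?_⟩, Set.range_subset_iff.2 hcmem⟩
  · rw [← CofiniteTopology.of.symm.surjective.range_comp, ← Set.image_univ]
    exact isPreconnected_univ.image _ hcont.continuousOn
  · refine g2_eq_of_mem_stabilizer hu (hcmem ⟨0, h0⟩) (one_mem _) ?_ ?_
    · rw [c11, g11_one]; simp [s₁]
    · rw [c12, g12_one]; simp [s₂]
  · refine g2_eq_of_mem_stabilizer hu (hcmem ⟨1, h1⟩) hg.1 ?_ ?_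
    · rw [c11]; simp [s₁]
    · rw [c12]; simp [s₂]

theorem geometricComponent_w [Infinite F] (h2 : (2 : F) ≠ 0) {u : Mat F} (hu : disc (w u) ≠ 0) :
    geometricComponent (w u) = (centralStab u : Set (PairGroup F)) := by
  let := zariski F
  apply Set.Subset.antisymm
  · intro g hg
    have hS : geometricComponent (w u) ⊆ MulAction.stabilizer (PairGroup F) (w u) :=
      connectedComponentIn_subset _ _
    refine ⟨hS hg, ?_⟩
    by_contra hcomm
    obtain ⟨h, hh, h3, h4⟩ := isPreconnected_closed_iff.1
      (isPreconnected_connectedComponentIn (F := (MulAction.stabilizer (PairGroup F) (w u) :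
        Set (PairGroup F))) (x := 1)) _ _ (isClosed_intertwiner u u)
        (isClosed_intertwiner (conjMat u) u)
        (fun h hh => stabilizer_dichotomy h2 hu (hS hh))
        ⟨1, one_mem_geometricComponent _, by simp [g11_one]⟩
        ⟨g, hg, (stabilizer_dichotomy h2 hu (hS hg)).resolve_left hcomm⟩
    have h11 : IsUnit h.g11 := (Matrix.isUnit_iff_isUnit_det _).2 (isUnit_det_g11 h)
    exact conjMat_ne h2 hu (h11.mul_left_cancel
      ((show h.g11 * conjMat u = u * h.g11 from h4).trans
        (show h.g11 * u = u * h.g11 from h3).symm))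
  · intro g hg
    obtain ⟨Γ, hΓ, h1, hgΓ, hsub⟩ := exists_preconnected_curve hu hg
    exact hΓ.subset_connectedComponentIn h1 hsub hgΓ

theorem baseChangeSpace_w (E : Type*) [Field E] [Algebra F E] (u : Mat F) :
    baseChangeSpace F E (w u) = w (u.map (algebraMap F E)) :=
  Prod.ext (Matrix.map_one _ (map_zero _) (map_one _)) rfl

theorem baseChange_smul (E : Type*) [Field E] [Algebra F E] (g : PairGroup F) (x : PairSpace F) :
    baseChange F E g • baseChangeSpace F E x = baseChangeSpace F E (g • x) := by
  have e11 : (baseChange F E g).g11 = g.g11.map (algebraMap F E) := rfl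
  have e12 : (baseChange F E g).g12 = g.g12.map (algebraMap F E) := rfl
  have e2 : (baseChange F E g).g2 = g.g2.map (algebraMap F E) := rfl
  rw [smul_def, e11, e12, e2]
  refine Prod.ext ?_ ?_ <;>
  · ext i j
    simp [baseChangeSpace, smul_def, Matrix.mul_apply, Fin.sum_univ_two]
    simp only [Algebra.smul_def]

theorem baseChangeSpace_injective (E : Type*) [Field E] [Algebra F E] :
    Function.Injective (baseChangeSpace F E) := by
  intro x y h
  have h' := Prod.ext_iff.1 h
  exact PairSpace.ext' (Matrix.map_injective (algebraMap F E).injective h'.1)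
    (Matrix.map_injective (algebraMap F E).injective h'.2)

/-- The rational points of the identity component of the stabilizer of `(1, u)` are the elements of
the stabilizer whose first component commutes with `u`. -/
theorem identityComponent_w (h2 : (2 : F) ≠ 0) {u : Mat F} (hu : disc (w u) ≠ 0) :
    identityComponent (w u) = centralStab u := by
  have hmap : disc (w (u.map (algebraMap F (AlgebraicClosure F)))) =
      algebraMap F (AlgebraicClosure F) (disc (w u)) := by
    simp [disc_w, Matrix.trace_fin_two, Matrix.det_fin_two, map_ofNat]
  have hu' : disc (w (u.map (algebraMap F (AlgebraicClosure F)))) ≠ 0 := by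
    rw [hmap]
    exact (map_ne_zero _).2 hu
  have h2' : (2 : AlgebraicClosure F) ≠ 0 := by
    have := (map_ne_zero (algebraMap F (AlgebraicClosure F))).2 h2
    rwa [map_ofNat] at this
  ext g
  have : g ∈ identityComponent (w u) ↔ baseChange F (AlgebraicClosure F) g ∈
      geometricComponent (baseChangeSpace F (AlgebraicClosure F) (w u)) := Iff.rfl
  rw [this, baseChangeSpace_w, geometricComponent_w h2' hu', SetLike.mem_coe, mem_centralStab,
    mem_centralStab, MulAction.mem_stabilizer_iff, MulAction.mem_stabilizer_iff,
    ← baseChangeSpace_w, baseChange_smul, (baseChangeSpace_injective _).eq_iff]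
  refine and_congr_right fun _ => ?_
  change g.g11.map (algebraMap F (AlgebraicClosure F)) * u.map _ = u.map _ * g.g11.map _ ↔ _
  rw [← Matrix.map_mul, ← Matrix.map_mul,
    (Matrix.map_injective (algebraMap F (AlgebraicClosure F)).injective).eq_iff]
  rfl

end Zariski

/-! ### Integration over an orbit whose stabilizer contains a subgroup of index two -/

section Orbit

set_option linter.unusedSectionVars false

variable {G X : Type*} [Group G] [TopologicalSpace G] [IsTopologicalGroup G] [PolishSpace G]
  [MeasurableSpace G] [BorelSpace G] [TopologicalSpace X] [PolishSpace X] [MeasurableSpace X]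
  [BorelSpace X] [MulAction G X] [ContinuousSMul G X]

/-- A measure `ν` invariant under `G` and carried by the orbit of `x`, whose stabilizer is
`H ∪ τ H`, and a left invariant measure `l` on `H`. -/
structure OrbitMeasures (x : X) (H : Subgroup G) (τ : G) (l : Measure G) (ν : Measure X) :
    Prop where
  smul_eq_iff : ∀ g : G, g • x = x ↔ g ∈ H ∨ τ⁻¹ * g ∈ H
  notMem : τ ∉ H
  map_mul : ∀ h ∈ H, l.map (h * ·) = l
  ae_mem : ∀ᵐ h ∂l, h ∈ H
  measurableSet_orbit : MeasurableSet (MulAction.orbit G x)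
  map_smul : ∀ g : G, ν.map (g • ·) = ν
  ae_mem_orbit : ∀ᵐ y ∂ν, y ∈ MulAction.orbit G x

/-- A function on `X` that vanishes off the orbit of `x` is measurable when its pullback to the
group is. -/
theorem measurable_of_comp_orbit {x : X} (hO : MeasurableSet (MulAction.orbit G x))
    {Φ : X → ℝ≥0∞} (h0 : ∀ y ∉ MulAction.orbit G x, Φ y = 0)
    (hΦ : Measurable fun g : G => Φ (g • x)) : Measurable Φ := by
  intro s hs
  have hf : Measurable fun g : G => g • x :=
    (continuous_id.smul continuous_const).measurable
  have h1 : MeasurableSet (Φ ⁻¹' s ∩ MulAction.orbit G x) :=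
    (hf.measurableSet_preimage_iff_inter_range hO).1 (hΦ hs)
  have h2 : MeasurableSet (Φ ⁻¹' s ∩ (MulAction.orbit G x)ᶜ) := by
    by_cases h : (0 : ℝ≥0∞) ∈ s
    · convert hO.compl using 1
      exact Set.inter_eq_right.2 fun y hy => by simpa [h0 y hy] using h
    · convert MeasurableSet.empty using 1
      refine Set.eq_empty_of_forall_notMem fun y hy => h ?_
      rw [← h0 y hy.2]
      exact hy.1
  rw [← Set.inter_union_compl (Φ ⁻¹' s) (MulAction.orbit G x)]
  exact h1.union h2

open Classical in
/-- Some `g` with `g • x = y`, for `y` in the orbit of `x`. -/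
def orbitSection (G : Type*) [Group G] [MulAction G X] (x y : X) : G :=
  if h : ∃ g : G, g • x = y then h.choose else 1

theorem orbitSection_smul {x y : X} (h : y ∈ MulAction.orbit G x) :
    orbitSection G x y • x = y := by
  have h' : ∃ g : G, g • x = y := h
  rw [orbitSection, dif_pos h']
  exact h'.choose_spec

/-- The measure on the stabilizer `H ∪ τ H` that extends `l`. -/
def stabMeasure (τ : G) (l : Measure G) : Measure G := l + l.map (τ * ·)

open Classical in
/-- The kernel that sends `g • x` to the measure on `g H ∪ g τ H`. -/
def fibreMeasure (x : X) (τ : G) (l : Measure G) (y : X) : Measure G :=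
  if y ∈ MulAction.orbit G x then (stabMeasure τ l).map (orbitSection G x y * ·) else 0

open Classical in
/-- The kernel that sends `g • x` to the counting measure on the two cosets over it. -/
def fibreCount (x : X) (H : Subgroup G) (τ : G) (y : X) : Measure (G ⧸ H) :=
  if y ∈ MulAction.orbit G x then
    Measure.dirac (orbitSection G x y : G ⧸ H) + Measure.dirac (↑(orbitSection G x y * τ) : G ⧸ H)
  else 0

variable {x : X} {H : Subgroup G} {τ : G} {l : Measure G} {ν : Measure X}

namespace OrbitMeasures

variable (D : OrbitMeasures x H τ l ν)
include D

theorem conj_mem {h : G} (hh : h ∈ H) : τ⁻¹ * (h * τ) ∈ H := by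
  have h1 : (h * τ) • x = x := by
    rw [mul_smul, (D.smul_eq_iff τ).2 (Or.inr (by simp [one_mem])),
      (D.smul_eq_iff h).2 (Or.inl hh)]
  rcases (D.smul_eq_iff _).1 h1 with h2 | h2
  · exact absurd ((H.mul_mem_cancel_left hh).1 h2) D.notMem
  · exact h2

theorem tau_mul_mem {h : G} (hh : h ∈ H) : τ * h * τ ∈ H := by
  have hτ : τ • x = x := (D.smul_eq_iff τ).2 (Or.inr (by simp [one_mem]))
  have h1 : (τ * h * τ) • x = x := by
    rw [mul_smul, mul_smul, hτ, (D.smul_eq_iff h).2 (Or.inl hh), hτ]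
  rcases (D.smul_eq_iff _).1 h1 with h2 | h2
  · exact h2
  · rw [mul_assoc, inv_mul_cancel_left] at h2
    exact absurd ((H.mul_mem_cancel_left hh).1 h2) D.notMem

theorem map_stabMeasure {s : G} (hs : s • x = x) :
    (stabMeasure τ l).map (s * ·) = stabMeasure τ l := by
  have hm (a : G) : Measurable (a * ·) := (continuous_const_mul a).measurable
  have hcomp (a b : G) : (l.map (a * ·)).map (b * ·) = l.map ((b * a) * ·) := by
    rw [Measure.map_map (hm b) (hm a)]
    congr 1
    funext g
    simp [mul_assoc]
  have hH {a : G} (ha : τ⁻¹ * a ∈ H) : l.map (a * ·) = l.map (τ * ·) := by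
    have := hcomp (τ⁻¹ * a) τ
    rw [D.map_mul _ ha, mul_inv_cancel_left] at this
    exact this.symm
  rw [stabMeasure, Measure.map_add _ _ (hm s), hcomp]
  rcases (D.smul_eq_iff s).1 hs with h | h
  · rw [D.map_mul s h, hH (D.conj_mem h)]
  · rw [hH h, add_comm]
    congr 1
    refine D.map_mul _ ?_
    have := D.tau_mul_mem h
    rwa [mul_inv_cancel_left] at this

theorem fibreMeasure_smul (g : G) :
    fibreMeasure x τ l (g • x) = (stabMeasure τ l).map (g * ·) := by
  have hm (a : G) : Measurable (a * ·) := (continuous_const_mul a).measurable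
  have hg : g • x ∈ MulAction.orbit G x := ⟨g, rfl⟩
  rw [fibreMeasure, if_pos hg]
  set σ := orbitSection G x (g • x)
  have hσ : (g⁻¹ * σ) • x = x := by
    rw [mul_smul, orbitSection_smul hg, inv_smul_smul]
  conv_rhs => rw [← D.map_stabMeasure hσ, Measure.map_map (hm _) (hm _)]
  congr 1
  funext h
  simp [mul_assoc]

theorem fibreCount_smul (g : G) : fibreCount x H τ (g • x) =
    Measure.dirac (g : G ⧸ H) + Measure.dirac (↑(g * τ) : G ⧸ H) := by
  have hg : g • x ∈ MulAction.orbit G x := ⟨g, rfl⟩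
  rw [fibreCount, if_pos hg]
  set σ := orbitSection G x (g • x)
  have hσ : (g⁻¹ * σ) • x = x := by
    rw [mul_smul, orbitSection_smul hg, inv_smul_smul]
  rcases (D.smul_eq_iff _).1 hσ with h | h
  · have e1 : (g : G ⧸ H) = σ := QuotientGroup.eq.2 h
    have e2 : (↑(g * τ) : G ⧸ H) = ↑(σ * τ) := by
      refine QuotientGroup.eq.2 ?_
      have := D.conj_mem h
      rwa [mul_inv_rev, mul_assoc, ← mul_assoc g⁻¹]
    rw [e1, e2]
  · have e1 : (↑(g * τ) : G ⧸ H) = σ := by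
      refine QuotientGroup.eq.2 ?_
      rwa [mul_inv_rev, mul_assoc]
    have e2 : (g : G ⧸ H) = ↑(σ * τ) := by
      refine QuotientGroup.eq.2 ?_
      have := D.tau_mul_mem h
      rwa [mul_inv_cancel_left, mul_assoc] at this
    rw [e1, e2, add_comm]

variable [SFinite l]

theorem measurable_fibreMeasure : Measurable (fibreMeasure x τ l) := by
  refine Measure.measurable_of_measurable_coe _ fun A hA => ?_
  refine measurable_of_comp_orbit D.measurableSet_orbit (fun y hy => ?_) ?_
  · rw [fibreMeasure, if_neg hy]; rfl
  · simp_rw [D.fibreMeasure_smul]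
    have hm (a : G) : Measurable (a * ·) := (continuous_const_mul a).measurable
    simp_rw [fun g : G => Measure.map_apply (μ := stabMeasure τ l) (hm g) hA]
    have : SFinite (stabMeasure τ l) := by unfold stabMeasure; infer_instance
    exact measurable_measure_prodMk_left (ν := stabMeasure τ l)
      (continuous_mul.measurable hA : MeasurableSet ((fun p : G × G => p.1 * p.2) ⁻¹' A))

theorem measurable_fibreCount : Measurable (fibreCount x H τ) := by
  refine Measure.measurable_of_measurable_coe _ fun A hA => ?_
  refine measurable_of_comp_orbit D.measurableSet_orbit (fun y hy => ?_) ?_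
  · rw [fibreCount, if_neg hy]; rfl
  · simp_rw [D.fibreCount_smul]
    simp only [Measure.coe_add, Pi.add_apply, Measure.dirac_apply' _ hA]
    have h1 : Measurable (A.indicator (1 : G ⧸ H → ℝ≥0∞)) := measurable_one.indicator hA
    exact (h1.comp QuotientGroup.measurable_coe).add
      (h1.comp (QuotientGroup.measurable_coe.comp (continuous_mul_const τ).measurable))

/-- The measure on `G` obtained by integrating the measures on the fibres of the orbit map. -/
theorem bind_apply {A : Set G} (hA : MeasurableSet A) :
    ν.bind (fibreMeasure x τ l) A = ∫⁻ y, fibreMeasure x τ l y A ∂ν :=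
  Measure.bind_apply hA D.measurable_fibreMeasure.aemeasurable

theorem isMulLeftInvariant_bind : (ν.bind (fibreMeasure x τ l)).IsMulLeftInvariant := by
  have hm (a : G) : Measurable (a * ·) := (continuous_const_mul a).measurable
  refine ⟨fun a => ?_⟩
  ext A hA
  rw [Measure.map_apply (hm a) hA, D.bind_apply (hm a hA), D.bind_apply hA]
  have hmeas : Measurable fun y => fibreMeasure x τ l y A :=
    (Measure.measurable_coe hA).comp D.measurable_fibreMeasure
  conv_rhs => rw [← D.map_smul a, lintegral_map hmeas (continuous_const_smul a).measurable]
  refine lintegral_congr_ae ?_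
  filter_upwards [D.ae_mem_orbit] with y hy
  obtain ⟨g, rfl⟩ := hy
  change fibreMeasure x τ l (g • x) ((a * ·) ⁻¹' A) = fibreMeasure x τ l (a • g • x) A
  rw [smul_smul, D.fibreMeasure_smul, D.fibreMeasure_smul, Measure.map_apply (hm g) (hm a hA),
    Measure.map_apply (hm (a * g)) hA, ← Set.preimage_comp]
  congr 1
  ext h
  simp [mul_assoc]

theorem smulInvariantMeasure_bind (c : ℝ≥0∞) :
    SMulInvariantMeasure G (G ⧸ H) (c • ν.bind (fibreCount x H τ)) := by
  refine ⟨fun a A hA => ?_⟩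
  have hmA : MeasurableSet ((fun z : G ⧸ H => a • z) ⁻¹' A) := by
    have : Measurable fun z : G ⧸ H => a • z := QuotientGroup.measurable_from_quotient.2
      (QuotientGroup.measurable_coe.comp (continuous_const_mul a).measurable)
    exact this hA
  rw [Measure.smul_apply, Measure.smul_apply,
    Measure.bind_apply hA D.measurable_fibreCount.aemeasurable,
    Measure.bind_apply hmA D.measurable_fibreCount.aemeasurable]
  congr 1
  have hcount : Measurable fun y => fibreCount x H τ y A :=
    (Measure.measurable_coe hA).comp D.measurable_fibreCount
  conv_rhs => rw [← D.map_smul a, lintegral_map hcount (continuous_const_smul a).measurable]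
  refine lintegral_congr_ae ?_
  filter_upwards [D.ae_mem_orbit] with y hy
  obtain ⟨g, rfl⟩ := hy
  change fibreCount x H τ (g • x) _ = fibreCount x H τ (a • g • x) A
  rw [smul_smul, D.fibreCount_smul, D.fibreCount_smul]
  simp only [Measure.coe_add, Pi.add_apply, Measure.dirac_apply' _ hA, Measure.dirac_apply' _ hmA]
  rw [mul_assoc]
  rfl

theorem out_mul_smul (c : G ⧸ H) (g : G) (h : (g : G ⧸ H) = c) : c.out • x = g • x := by
  have h1 : (c.out : G ⧸ H) = g := by rw [h]; exact QuotientGroup.out_eq' c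
  have h2 := QuotientGroup.eq.1 h1
  have h3 := (D.smul_eq_iff _).2 (Or.inl h2)
  rw [mul_smul, inv_smul_eq_iff] at h3
  exact h3.symm

theorem measurable_out_smul : Measurable fun c : G ⧸ H => c.out • x := by
  refine QuotientGroup.measurable_from_quotient.2 ?_
  have : (fun c : G ⧸ H => c.out • x) ∘ ((↑) : G → G ⧸ H) = fun g : G => g • x := by
    funext g
    exact D.out_mul_smul _ g rfl
  rw [this]
  exact (continuous_id.smul continuous_const).measurable

theorem map_bind_fibreCount (c : ℝ≥0∞) :
    (c • ν.bind (fibreCount x H τ)).map (fun c : G ⧸ H => c.out • x) = (2 * c) • ν := by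
  ext A hA
  have hm := D.measurable_out_smul
  rw [Measure.map_apply hm hA, Measure.smul_apply, Measure.smul_apply,
    Measure.bind_apply (hm hA) D.measurable_fibreCount.aemeasurable]
  have : ∫⁻ y, fibreCount x H τ y ((fun c : G ⧸ H => c.out • x) ⁻¹' A) ∂ν =
      ∫⁻ y, 2 * A.indicator 1 y ∂ν := by
    refine lintegral_congr_ae ?_
    filter_upwards [D.ae_mem_orbit] with y hy
    obtain ⟨g, rfl⟩ := hy
    have hτ : τ • x = x := (D.smul_eq_iff τ).2 (Or.inr (by simp [one_mem]))
    have hp (a : G) : (a : G ⧸ H) ∈ ((fun c : G ⧸ H => c.out • x) ⁻¹' A) ↔ a • x ∈ A := by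
      rw [Set.mem_preimage, D.out_mul_smul _ a rfl]
    change fibreCount x H τ (g • x) _ = 2 * A.indicator 1 (g • x)
    rw [D.fibreCount_smul]
    simp only [Measure.coe_add, Pi.add_apply, Measure.dirac_apply' _ (hm hA)]
    by_cases hgA : g • x ∈ A
    · rw [Set.indicator_of_mem ((hp g).2 hgA),
        Set.indicator_of_mem ((hp (g * τ)).2 (by rwa [mul_smul, hτ])), Set.indicator_of_mem hgA]
      simp [one_add_one_eq_two]
    · rw [Set.indicator_of_notMem (mt (hp g).1 hgA),
        Set.indicator_of_notMem (mt (hp (g * τ)).1 (by rwa [mul_smul, hτ])),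
        Set.indicator_of_notMem hgA]
      simp
  rw [this, lintegral_const_mul _ (measurable_one.indicator hA), lintegral_indicator_one hA,
    smul_eq_mul, smul_eq_mul]
  ring

/-- The inner integral of the quotient integral formula. -/
theorem lintegral_out_mul {f : G → ℝ≥0∞} (hf : Measurable f) (c : G ⧸ H) (g : G)
    (h : (g : G ⧸ H) = c) : ∫⁻ h, f (c.out * h) ∂l = ∫⁻ h, f (g * h) ∂l := by
  have h1 : (c.out : G ⧸ H) = g := by rw [h]; exact QuotientGroup.out_eq' c
  have h2 := QuotientGroup.eq.1 h1
  conv_rhs => rw [← D.map_mul _ (H.inv_mem h2)]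
  have hfg : Measurable fun h => f (g * h) := hf.comp (continuous_const_mul g).measurable
  rw [lintegral_map hfg
    (continuous_const_mul _).measurable]
  simp [mul_assoc]

theorem measurable_lintegral_out_mul {f : G → ℝ≥0∞} (hf : Measurable f) :
    Measurable fun c : G ⧸ H => ∫⁻ h, f (c.out * h) ∂l := by
  refine QuotientGroup.measurable_from_quotient.2 ?_
  have : (fun c : G ⧸ H => ∫⁻ h, f (c.out * h) ∂l) ∘ ((↑) : G → G ⧸ H) =
      fun g : G => ∫⁻ h, f (g * h) ∂l := by
    funext g
    exact D.lintegral_out_mul hf _ g rfl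
  rw [this]
  exact Measurable.lintegral_prod_right' (f := fun p : G × G => f (p.1 * p.2))
    (hf.comp continuous_mul.measurable)

theorem lintegral_bind_fibreCount {f : G → ℝ≥0∞} (hf : Measurable f) :
    ∫⁻ c, ∫⁻ h, f (c.out * h) ∂l ∂(ν.bind (fibreCount x H τ)) =
      ∫⁻ g, f g ∂(ν.bind (fibreMeasure x τ l)) := by
  have hF := D.measurable_lintegral_out_mul hf
  rw [Measure.lintegral_bind D.measurable_fibreCount.aemeasurable hF.aemeasurable,
    Measure.lintegral_bind D.measurable_fibreMeasure.aemeasurable hf.aemeasurable]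
  refine lintegral_congr_ae ?_
  filter_upwards [D.ae_mem_orbit] with y hy
  obtain ⟨g, rfl⟩ := hy
  change ∫⁻ c, _ ∂(fibreCount x H τ (g • x)) = ∫⁻ h, f h ∂(fibreMeasure x τ l (g • x))
  have hm (a : G) : Measurable (a * ·) := (continuous_const_mul a).measurable
  have hfg : Measurable fun h => f (g * h) := hf.comp (hm g)
  rw [D.fibreCount_smul, D.fibreMeasure_smul, lintegral_add_measure, lintegral_dirac' _ hF,
    lintegral_dirac' _ hF, lintegral_map hf (hm g), stabMeasure, lintegral_add_measure,
    lintegral_map hfg (hm τ), D.lintegral_out_mul hf _ g rfl,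
    D.lintegral_out_mul hf _ (g * τ) rfl]
  simp only [mul_assoc]

/-- The measure of a set that meets the fibres through a subgroup `U`. -/
theorem bind_fibreMeasure_subgroup (U : Subgroup G) (hU : MeasurableSet (U : Set G))
    (hUx : MeasurableSet ((fun g : G => g • x) '' U)) (hτ : ∀ g ∈ U, τ⁻¹ * g ∉ H) :
    ν.bind (fibreMeasure x τ l) U = l U * ν ((fun g : G => g • x) '' U) := by
  have hm (a : G) : Measurable (a * ·) := (continuous_const_mul a).measurable
  rw [D.bind_apply hU, ← lintegral_indicator_const hUx]
  refine lintegral_congr_ae ?_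
  filter_upwards [D.ae_mem_orbit] with y hy
  by_cases hy' : y ∈ (fun g : G => g • x) '' U
  · obtain ⟨g, hg, rfl⟩ := hy'
    rw [Set.indicator_of_mem (Set.mem_image_of_mem _ hg)]
    change fibreMeasure x τ l (g • x) U = _
    rw [D.fibreMeasure_smul, Measure.map_apply (hm g) hU]
    have hpre : (g * ·) ⁻¹' (U : Set G) = U := by
      ext h
      exact U.mul_mem_cancel_left hg
    rw [hpre, stabMeasure, Measure.add_apply, Measure.map_apply (hm τ) hU]
    have : l ((τ * ·) ⁻¹' (U : Set G)) = 0 := by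
      refine measure_mono_null (t := {h | ¬ h ∈ H}) (fun h hh hhH => hτ _ hh ?_) D.ae_mem
      simpa using hhH
    rw [this, add_zero]
  · rw [Set.indicator_of_notMem hy']
    obtain ⟨g, rfl⟩ := hy
    change fibreMeasure x τ l (g • x) U = 0
    have hs : ∀ᵐ s ∂(stabMeasure τ l), s • x = x := by
      rw [stabMeasure, ae_add_measure_iff]
      have hH : ∀ h ∈ H, h • x = x := fun h hh => (D.smul_eq_iff h).2 (Or.inl hh)
      refine ⟨D.ae_mem.mono hH, ?_⟩
      have hms : MeasurableSet {s : G | s • x = x} :=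
        (isClosed_eq (continuous_id.smul continuous_const) continuous_const).measurableSet
      rw [ae_map_iff (hm τ).aemeasurable hms]
      refine D.ae_mem.mono fun h hh => ?_
      rw [mul_smul, hH h hh]
      exact (D.smul_eq_iff τ).2 (Or.inr (by simp [one_mem]))
    rw [D.fibreMeasure_smul, Measure.map_apply (hm g) hU]
    refine measure_mono_null (t := {s | ¬ s • x = x}) (fun s hs hsx => hy' ⟨g * s, hs, ?_⟩) hs
    change (g * s) • x = g • x
    rw [mul_smul, hsx]

/-- Uniqueness of the quotient measure. -/
theorem quotientMeasure_unique [SigmaCompactSpace G] [IsFiniteMeasureOnCompacts l] (hl : l ≠ 0)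
    {μ : Measure G} {μ₁ μ₂ : Measure (G ⧸ H)}
    (h₁ : ∀ f : G → ℝ≥0∞, Measurable f →
      ∫⁻ g, f g ∂μ = ∫⁻ c, ∫⁻ h, f (c.out * h) ∂l ∂μ₁)
    (h₂ : ∀ f : G → ℝ≥0∞, Measurable f →
      ∫⁻ g, f g ∂μ = ∫⁻ c, ∫⁻ h, f (c.out * h) ∂l ∂μ₂) : μ₁ = μ₂ := by
  let C : ℕ → Set G := compactCovering G
  have hC (n : ℕ) : IsCompact (C n) := isCompact_compactCovering G n
  have hCm (n : ℕ) : MeasurableSet (C n) := (hC n).measurableSet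
  let ξ : ℕ → G ⧸ H → ℝ≥0∞ := fun n c => ∫⁻ h, (C n).indicator 1 (c.out * h) ∂l
  have hξ (n : ℕ) : Measurable (ξ n) :=
    D.measurable_lintegral_out_mul (measurable_one.indicator (hCm n))
  have hξ_eq (n : ℕ) (c : G ⧸ H) : ξ n c = l ((c.out * ·) ⁻¹' C n) := by
    rw [← lintegral_indicator_one ((continuous_const_mul _).measurable (hCm n))]
    rfl
  have hξ_top (n : ℕ) (c : G ⧸ H) : ξ n c ≠ ∞ := by
    rw [hξ_eq]
    exact ((Homeomorph.mulLeft c.out).isCompact_preimage.2 (hC n)).measure_lt_top.ne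
  refine Measure.ext_of_iUnion_eq_univ (s := fun n => {c | ξ n c ≠ 0}) ?_ fun n => ?_
  · refine Set.eq_univ_of_forall fun c => ?_
    by_contra hc
    simp only [Set.mem_iUnion, Set.mem_ofPred_eq, not_exists, not_not] at hc
    refine hl (Measure.measure_univ_eq_zero.1 ?_)
    have : (Set.univ : Set G) = ⋃ n, (c.out * ·) ⁻¹' C n := by
      rw [← Set.preimage_iUnion, iUnion_compactCovering, Set.preimage_univ]
    rw [this, measure_iUnion_null_iff]
    exact fun n => (hξ_eq n c) ▸ hc n
  · ext A hA
    have hE : MeasurableSet {c | ξ n c ≠ 0} := (hξ n) (measurableSet_singleton 0).compl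
    rw [Measure.restrict_apply hA, Measure.restrict_apply hA]
    let φ : G ⧸ H → ℝ≥0∞ := (A ∩ {c | ξ n c ≠ 0}).indicator fun c => (ξ n c)⁻¹
    have hφ : Measurable φ := (hξ n).inv.indicator (hA.inter hE)
    let f : G → ℝ≥0∞ := fun g => φ g * (C n).indicator 1 g
    have hf : Measurable f := (hφ.comp QuotientGroup.measurable_coe).mul
      (measurable_one.indicator (hCm n))
    have key (c : G ⧸ H) : ∫⁻ h, f (c.out * h) ∂l =
        (A ∩ {c | ξ n c ≠ 0}).indicator 1 c := by
      have : ∫⁻ h, f (c.out * h) ∂l = ∫⁻ h, φ c * (C n).indicator 1 (c.out * h) ∂l := by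
        refine lintegral_congr_ae ?_
        filter_upwards [D.ae_mem] with h hh
        have : ((c.out * h : G) : G ⧸ H) = c := by
          rw [QuotientGroup.mk_mul_of_mem _ hh]
          exact QuotientGroup.out_eq' c
        simp only [f, this]
      have hmeas : Measurable fun h => (C n).indicator (1 : G → ℝ≥0∞) (c.out * h) :=
        (measurable_one.indicator (hCm n)).comp (continuous_const_mul _).measurable
      rw [this, lintegral_const_mul _ hmeas]
      by_cases hc : c ∈ A ∩ {c | ξ n c ≠ 0}
      · simp only [φ, Set.indicator_of_mem hc]
        exact ENNReal.inv_mul_cancel hc.2 (hξ_top n c)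
      · simp only [φ, Set.indicator_of_notMem hc, zero_mul]
    have := (h₁ f hf).symm.trans (h₂ f hf)
    simp_rw [key] at this
    rwa [lintegral_indicator_one (hA.inter hE), lintegral_indicator_one (hA.inter hE)] at this

/-- A Haar measure of `G` decomposes along the fibres of the orbit map. -/
theorem eq_smul_bind [LocallyCompactSpace G] (μ : Measure G) [μ.IsHaarMeasure] {K : Set G}
    (hK : IsCompact K)
    (hK' : (interior K).Nonempty) (h0 : ν.bind (fibreMeasure x τ l) K ≠ 0)
    (htop : ν.bind (fibreMeasure x τ l) K ≠ ∞) :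
    μ = (μ K / ν.bind (fibreMeasure x τ l) K) • ν.bind (fibreMeasure x τ l) := by
  have := D.isMulLeftInvariant_bind
  have := Measure.isHaarMeasure_of_isCompact_nonempty_interior _ K hK hK' h0 htop
  have h := Measure.isMulLeftInvariant_eq_smul μ (ν.bind (fibreMeasure x τ l))
  have hc : (μ.haarScalarFactor (ν.bind (fibreMeasure x τ l)) : ℝ≥0∞) =
      μ K / ν.bind (fibreMeasure x τ l) K := by
    rw [ENNReal.eq_div_iff h0 htop, mul_comm]
    conv_rhs => rw [h]
    rfl
  conv_lhs => rw [h]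
  rw [← hc]
  rfl

end OrbitMeasures

end Orbit

/-! ### Normalized Haar measures -/

section Haar

theorem normalizedHaar_spec {H : Type*} [Group H] [TopologicalSpace H] [IsTopologicalGroup H]
    [MeasurableSpace H] [BorelSpace H] [LocallyCompactSpace H] [SecondCountableTopology H]
    {C : Set H} (hC : IsCompact C) (hC' : (interior C).Nonempty) :
    (normalizedHaar C).IsHaarMeasure ∧ normalizedHaar C C = 1 := by
  let K₀ : TopologicalSpace.PositiveCompacts H := ⟨⟨C, hC⟩, hC'⟩
  have h : ∃! μ : Measure H, μ.IsHaarMeasure ∧ μ C = 1 := by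
    refine ⟨Measure.haarMeasure K₀, ⟨inferInstance, Measure.haarMeasure_self⟩, ?_⟩
    rintro μ ⟨hμ, hμC⟩
    have := Measure.haarMeasure_unique μ K₀
    rwa [show μ K₀ = 1 from hμC, one_smul] at this
  rw [normalizedHaar, dif_pos h]
  exact h.choose_spec.1

theorem normalizedAddHaar_spec {H : Type*} [AddGroup H] [TopologicalSpace H]
    [IsTopologicalAddGroup H] [MeasurableSpace H] [BorelSpace H] [LocallyCompactSpace H]
    [SecondCountableTopology H] {C : Set H} (hC : IsCompact C) (hC' : (interior C).Nonempty) :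
    (normalizedAddHaar C).IsAddHaarMeasure ∧ normalizedAddHaar C C = 1 := by
  let K₀ : TopologicalSpace.PositiveCompacts H := ⟨⟨C, hC⟩, hC'⟩
  have h : ∃! μ : Measure H, μ.IsAddHaarMeasure ∧ μ C = 1 := by
    refine ⟨Measure.addHaarMeasure K₀, ⟨inferInstance, Measure.addHaarMeasure_self⟩, ?_⟩
    rintro μ ⟨hμ, hμC⟩
    have := Measure.addHaarMeasure_unique μ K₀
    rwa [show μ K₀ = 1 from hμC, one_smul] at this
  rw [normalizedAddHaar, dif_pos h]
  exact h.choose_spec.1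

end Haar

/-! ### The local field `k_v` -/

section LocalField

open WithZero HeightOneSpectrum NumberField NumberField.HeightOneSpectrum

variable {k : Type*} [Field k] [NumberField k] (v : HeightOneSpectrum (𝓞 k))

theorem norm_le_one_iff (x : Kv v) : ‖x‖ ≤ 1 ↔ x ∈ Ov v := by
  rw [mem_adicCompletionIntegers]
  exact Valued.toNormedField.norm_le_one_iff

theorem exists_uniformizer : ∃ ϖ : Ov v, Irreducible ϖ ∧
    ‖(ϖ : Kv v)‖ = ((Ideal.absNorm v.asIdeal : ℕ) : ℝ)⁻¹ := by
  obtain ⟨π, hπ⟩ := v.valuation_exists_uniformizer k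
  have hv : Valued.v (π : Kv v) = WithZero.exp (-1 : ℤ) := by
    rw [← hπ]; exact valuedAdicCompletion_eq_valuation' v π
  have hmem : (π : Kv v) ∈ Ov v := by
    rw [mem_adicCompletionIntegers, hv]
    exact WithZero.exp_le_exp.2 (by norm_num)
  have hlt : Valued.v (π : Kv v) < 1 := by
    rw [hv]
    exact WithZero.exp_lt_exp.2 (by norm_num)
  refine ⟨⟨π, hmem⟩, ⟨?_, ?_⟩, ?_⟩
  · rw [adicCompletionIntegers.isUnit_iff_valued_eq_one]
    exact hlt.ne
  · intro a b hab
    simp only [adicCompletionIntegers.isUnit_iff_valued_eq_one]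
    by_contra! h
    have ha : Valued.v (a : Kv v) < 1 := lt_of_le_of_ne a.2 h.1
    have hb : Valued.v (b : Kv v) < 1 := lt_of_le_of_ne b.2 h.2
    have hab' : Valued.v (a : Kv v) * Valued.v (b : Kv v) = WithZero.exp (-1 : ℤ) := by
      rw [← hv, ← map_mul]
      exact congrArg _ (congrArg Subtype.val hab).symm
    have hne : Valued.v (a : Kv v) * Valued.v (b : Kv v) ≠ 0 := by
      rw [hab']
      exact WithZero.exp_ne_zero
    rw [← WithZero.exp_log (left_ne_zero_of_mul hne)] at ha hab'
    rw [← WithZero.exp_log (right_ne_zero_of_mul hne), ← WithZero.exp_add] at hab'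
    rw [← WithZero.exp_log (right_ne_zero_of_mul hne)] at hb
    rw [← WithZero.exp_zero] at ha hb
    have h1 := WithZero.exp_lt_exp.1 ha
    have h2 := WithZero.exp_lt_exp.1 hb
    have h3 := WithZero.exp_injective hab'
    omega
  · rw [FinitePlace.norm_def]
    change ((WithZeroMulInt.toNNReal (absNorm_ne_zero v) (Valued.v (π : Kv v)) : NNReal) : ℝ) = _
    rw [hv, WithZeroMulInt.toNNReal_neg_apply _ WithZero.exp_ne_zero]
    change (((Ideal.absNorm v.asIdeal : NNReal) ^ (-1 : ℤ) : NNReal) : ℝ) = _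
    rw [zpow_neg_one]
    simp

theorem mem_maximalIdeal_iff (x : Ov v) :
    x ∈ IsLocalRing.maximalIdeal (Ov v) ↔ ‖(x : Kv v)‖ < 1 := by
  rw [IsLocalRing.mem_maximalIdeal, mem_nonunits_iff,
    adicCompletionIntegers.isUnit_iff_valued_eq_one, Valued.toNormedField.norm_lt_one_iff]
  exact ⟨fun h => lt_of_le_of_ne x.2 h, fun h => h.ne⟩

theorem exists_ringOfIntegers_sub_mem (x : Ov v) :
    ∃ a : 𝓞 k, algebraMap (𝓞 k) (Ov v) a - x ∈ IsLocalRing.maximalIdeal (Ov v) := by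
  have hd : DenseRange (algebraMap k (Kv v)) := denseRange_algebraMap k v
  obtain ⟨y, hy⟩ := hd.exists_dist_lt (x : Kv v) one_pos
  rw [dist_eq_norm] at hy
  have hy1 : algebraMap k (Kv v) y ∈ Ov v := by
    have h := (norm_le_one_iff v _).1 hy.le
    simpa using sub_mem x.2 h
  have hy2 : v.valuation k y ≤ 1 := by
    rw [← valuedAdicCompletion_eq_valuation']
    exact hy1
  obtain ⟨a, ha⟩ := exists_valuation_sub_lt_of_integer v hy2 1
  refine ⟨a, ?_⟩
  have h1 : ‖algebraMap k (Kv v) (algebraMap (𝓞 k) k a - y)‖ < 1 := by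
    rw [Valued.toNormedField.norm_lt_one_iff]
    exact (valuedAdicCompletion_eq_valuation' v _).trans_lt ha
  rw [mem_maximalIdeal_iff]
  have h2 : ((algebraMap (𝓞 k) (Ov v) a - x : Ov v) : Kv v) =
      algebraMap k (Kv v) (algebraMap (𝓞 k) k a - y) - (x - algebraMap k (Kv v) y) := by
    rw [map_sub, sub_sub_sub_cancel_right]
    rfl
  rw [h2]
  rw [sub_eq_add_neg]
  exact (IsUltrametricDist.norm_add_le_max _ _).trans_lt (max_lt h1 (by rwa [norm_neg]))

theorem residue_comp_surjective : Function.Surjective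
    ((IsLocalRing.residue (Ov v)).comp (algebraMap (𝓞 k) (Ov v))) := by
  intro z
  obtain ⟨x, rfl⟩ := IsLocalRing.residue_surjective z
  obtain ⟨a, ha⟩ := exists_ringOfIntegers_sub_mem v x
  refine ⟨a, ?_⟩
  rw [RingHom.comp_apply, ← sub_eq_zero, ← map_sub]
  exact (IsLocalRing.residue_eq_zero_iff _).2 ha

theorem ker_residue_comp : RingHom.ker
    ((IsLocalRing.residue (Ov v)).comp (algebraMap (𝓞 k) (Ov v))) = v.asIdeal := by
  ext a
  rw [RingHom.mem_ker, RingHom.comp_apply, IsLocalRing.residue_eq_zero_iff, mem_maximalIdeal_iff,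
    ← FinitePlace.norm_lt_one_iff_mem k]
  rfl

/-- The residue fields of `k_v` and of `v` agree. -/
def residueEquiv : 𝓞 k ⧸ v.asIdeal ≃+* IsLocalRing.ResidueField (Ov v) :=
  (Ideal.quotEquivOfEq (ker_residue_comp v).symm).trans
    (RingHom.quotientKerEquivOfSurjective (residue_comp_surjective v))

instance : Finite (IsLocalRing.ResidueField (Ov v)) := by
  have := v.asIdeal.finiteQuotientOfFreeOfNeBot v.ne_bot
  exact Finite.of_equiv _ (residueEquiv v).toEquiv

theorem q_eq : q v = Ideal.absNorm v.asIdeal := by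
  rw [q, Ideal.absNorm_apply, Submodule.cardQuot_apply]
  exact (Nat.card_congr (residueEquiv v).toEquiv).symm

instance : ProperSpace (Kv v) := by
  have := (Valued.integer.properSpace_iff_completeSpace_and_isDiscreteValuationRing_integer_and_finite_residueField (K := Kv v)).2 ⟨inferInstance, inferInstanceAs (IsDiscreteValuationRing (Ov v)), inferInstanceAs (Finite (IsLocalRing.ResidueField (Ov v)))⟩
  exact this

instance : LocallyCompactSpace (Kv v) := inferInstance

instance : SecondCountableTopology (Kv v) := by
  have : Countable k := by
    have h := Algebraic.countable ℚ k
    rw [Set.eq_univ_of_forall (s := {x : k | IsAlgebraic ℚ x}) fun x =>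
      Algebra.IsAlgebraic.isAlgebraic x] at h
    exact Set.countable_univ_iff.1 h
  have hd : DenseRange (algebraMap k (Kv v)) := denseRange_algebraMap k v
  have : TopologicalSpace.SeparableSpace (Kv v) :=
    ⟨_, Set.countable_range _, hd⟩
  exact UniformSpace.secondCountable_of_separable (Kv v)

end LocalField

/-! ### Characters of `GL(2)` -/

section Characters

open scoped NNReal

variable {F : Type*} [Field F]

/-- A scalar matrix as an element of `GL(2)`. -/
def scalarGL : Fˣ →* (Mat F)ˣ := Units.map (algebraMap F (Mat F)).toMonoidHom

theorem scalarGL_val (a : Fˣ) : ((scalarGL a : (Mat F)ˣ) : Mat F) = (a : F) • 1 := by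
  rw [← Algebra.algebraMap_eq_smul_one]; rfl

theorem map_ne_zero_of_group {Γ : Type*} [Group Γ] (χ : Γ →* ℝ≥0) (g : Γ) : χ g ≠ 0 :=
  ((Group.isUnit g).map χ).ne_zero

theorem char_transvection (h2 : (2 : F) ≠ 0) (χ : (Mat F)ˣ →* ℝ≥0) {i j : Fin 2} (hij : i ≠ j)
    (c : F) (t : (Mat F)ˣ) (ht : (t : Mat F) = Matrix.transvection i j c) : χ t = 1 := by
  have hd : (Matrix.diagonal (Function.update (1 : Fin 2 → F) i 2)).det ≠ 0 := by
    rw [Matrix.det_diagonal, Fin.prod_univ_two]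
    fin_cases i <;> simpa using h2
  obtain ⟨d, hd'⟩ : ∃ d : (Mat F)ˣ,
      (d : Mat F) = Matrix.diagonal (Function.update (1 : Fin 2 → F) i 2) :=
    ⟨Matrix.GeneralLinearGroup.mkOfDetNeZero _ hd, rfl⟩
  have h : d * t = t * t * d := by
    ext a b
    simp only [Units.val_mul, ht, hd']
    fin_cases i <;> fin_cases j <;> first | exact absurd rfl hij | skip
    all_goals fin_cases a <;> fin_cases b <;>
      simp [Matrix.mul_apply, Fin.sum_univ_two, Matrix.transvection, Matrix.single, mul_two]
    all_goals ring
  have h' := congrArg χ h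
  rw [map_mul, map_mul, map_mul, mul_comm] at h'
  have h1 := mul_right_cancel₀ (map_ne_zero_of_group χ d) h'
  have h3 : χ t * 1 = χ t * χ t := by rw [mul_one]; exact h1
  exact (mul_left_cancel₀ (map_ne_zero_of_group χ t) h3).symm

theorem char_diagonal_sq (χ : (Mat F)ˣ →* ℝ≥0) (a b : Fˣ) (t : (Mat F)ˣ)
    (ht : (t : Mat F) = Matrix.diagonal ![(a : F), b]) : χ t ^ 2 = χ (scalarGL (a * b)) := by
  have hs : (!![0, 1; 1, 0] : Mat F).det ≠ 0 := by simp [Matrix.det_fin_two_of]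
  obtain ⟨s, hs'⟩ : ∃ s : (Mat F)ˣ, (s : Mat F) = !![0, 1; 1, 0] :=
    ⟨Matrix.GeneralLinearGroup.mkOfDetNeZero _ hs, rfl⟩
  have h : s * t * (s * t) = scalarGL (a * b) * (s * s) := by
    ext i j
    simp only [Units.val_mul, ht, hs', scalarGL_val]
    fin_cases i <;> fin_cases j <;>
      simp [Matrix.mul_apply, Fin.sum_univ_two, Matrix.vecMul_diagonal, mul_comm]
  have h' := congrArg χ h
  simp only [map_mul] at h'
  have h0 := map_ne_zero_of_group χ s
  have h3 : χ t ^ 2 * (χ s * χ s) = χ (scalarGL (a * b)) * (χ s * χ s) := by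
    rw [map_mul, map_mul, ← h']
    ring
  exact mul_right_cancel₀ (mul_ne_zero h0 h0) h3

/-- A character of `GL(2)` with positive real values is determined by its values on scalars. -/
theorem char_eq_of_scalar (h2 : (2 : F) ≠ 0) (χ ψ : (Mat F)ˣ →* ℝ≥0)
    (h : ∀ a : Fˣ, χ (scalarGL a) = ψ (scalarGL a)) : χ = ψ := by
  have key : ∀ M : Mat F, M.det ≠ 0 → ∀ t : (Mat F)ˣ, (t : Mat F) = M → χ t = ψ t := by
    intro M hM
    refine Matrix.diagonal_transvection_induction_of_det_ne_zero
      (fun M => ∀ t : (Mat F)ˣ, (t : Mat F) = M → χ t = ψ t) M hM ?_ ?_ ?_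
    · intro D hD t ht
      rw [Matrix.det_diagonal, Fin.prod_univ_two] at hD
      have ht' : (t : Mat F) = Matrix.diagonal
          ![((Units.mk0 _ (left_ne_zero_of_mul hD) : Fˣ) : F),
            (Units.mk0 _ (right_ne_zero_of_mul hD) : Fˣ)] := by
        rw [ht]
        congr 1
        funext i
        fin_cases i <;> rfl
      have h1 := char_diagonal_sq χ _ _ t ht'
      rw [h, ← char_diagonal_sq ψ _ _ t ht'] at h1
      exact (pow_left_inj₀ zero_le zero_le two_ne_zero).1 h1
    · rintro ⟨i, j, hij, c⟩ t ht
      rw [char_transvection h2 χ hij c t ht, char_transvection h2 ψ hij c t ht]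
    · intro A B hA hB ihA ihB t ht
      obtain ⟨a, rfl⟩ : ∃ a : (Mat F)ˣ, (a : Mat F) = A :=
        ⟨Matrix.GeneralLinearGroup.mkOfDetNeZero _ hA, rfl⟩
      obtain ⟨b, rfl⟩ : ∃ b : (Mat F)ˣ, (b : Mat F) = B :=
        ⟨Matrix.GeneralLinearGroup.mkOfDetNeZero _ hB, rfl⟩
      have : t = a * b := Units.ext ht
      rw [this, map_mul, map_mul, ihA a rfl, ihB b rfl]
  ext t
  exact congrArg _ (key t ((Matrix.isUnit_iff_isUnit_det _).1 t.isUnit).ne_zero t rfl)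

end Characters

/-! ### Measures of subgroups of finite index -/

section Index

@[to_additive]
theorem relIndex_mul_measure {Γ : Type*} [Group Γ] [MeasurableSpace Γ] [MeasurableMul Γ]
    (μ : Measure Γ) [μ.IsMulLeftInvariant] {A B : Subgroup Γ} (hAB : A ≤ B)
    (hA : MeasurableSet (A : Set Γ)) (hi : A.relIndex B ≠ 0) :
    (A.relIndex B : ℝ≥0∞) * μ A = μ B := by
  have hfin : (A.subgroupOf B).FiniteIndex := ⟨hi⟩
  have : Fintype (B ⧸ A.subgroupOf B) := Fintype.ofFinite _
  have hm (b : Γ) : MeasurableSet ((b * ·) ⁻¹' (A : Set Γ)) := measurable_const_mul b hA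
  have hU : (B : Set Γ) = ⋃ c : B ⧸ A.subgroupOf B, ((c.out : Γ)⁻¹ * ·) ⁻¹' (A : Set Γ) := by
    ext b
    simp only [SetLike.mem_coe, Set.mem_iUnion, Set.mem_preimage]
    constructor
    · intro hb
      refine ⟨((⟨b, hb⟩ : B) : B ⧸ A.subgroupOf B), ?_⟩
      have := QuotientGroup.eq.1
        (QuotientGroup.out_eq' ((⟨b, hb⟩ : B) : B ⧸ A.subgroupOf B))
      exact this
    · rintro ⟨c, hc⟩
      simpa using mul_mem c.out.2 (hAB hc)
  have hdisj : Pairwise (Function.onFun Disjoint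
      fun c : B ⧸ A.subgroupOf B => ((c.out : Γ)⁻¹ * ·) ⁻¹' (A : Set Γ)) := by
    intro c d hcd
    refine Set.disjoint_left.2 fun b hc hd => hcd ?_
    rw [← QuotientGroup.out_eq' c, ← QuotientGroup.out_eq' d]
    refine QuotientGroup.eq.2 ?_
    have := A.mul_mem (show _ ∈ A from hc) (A.inv_mem (show _ ∈ A from hd))
    simpa [Subgroup.mem_subgroupOf] using this
  rw [hU, measure_iUnion hdisj fun c => hm _]
  simp only [measure_preimage_mul, tsum_fintype, Finset.sum_const, nsmul_eq_mul,
    Finset.card_univ]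
  rw [Subgroup.relIndex, Subgroup.index, Nat.card_eq_fintype_card]

end Index

/-! ### Haar measure and multiplication by scalars -/

section Scaling

set_option linter.unusedSectionVars false

open scoped NNReal Pointwise
open NumberField NumberField.HeightOneSpectrum

variable {k : Type*} [Field k] [NumberField k] (v : HeightOneSpectrum (𝓞 k))

/-- A uniformizer of `k_v`. -/
def unif : Ov v := (exists_uniformizer v).choose

theorem irreducible_unif : Irreducible (unif v) := (exists_uniformizer v).choose_spec.1

theorem norm_unif : ‖(unif v : Kv v)‖ = (q v : ℝ)⁻¹ := by
  rw [q_eq]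
  exact (exists_uniformizer v).choose_spec.2

theorem one_lt_q : 1 < q v := by
  rw [q_eq]
  exact one_lt_absNorm v

theorem unif_ne_zero : (unif v : Kv v) ≠ 0 := by
  intro h
  exact (irreducible_unif v).ne_zero (Subtype.ext h)

/-- The uniformizer as a unit of `k_v`. -/
def unifUnit : (Kv v)ˣ := Units.mk0 _ (unif_ne_zero v)

theorem isUnit_iff_norm_eq_one (a : Ov v) : IsUnit a ↔ ‖(a : Kv v)‖ = 1 := by
  have h := mem_maximalIdeal_iff v a
  rw [IsLocalRing.mem_maximalIdeal, mem_nonunits_iff] at h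
  have h1 := (norm_le_one_iff v a).2 a.2
  refine ⟨fun ha => le_antisymm h1 (not_lt.1 fun hlt => h.2 hlt ha), fun ha => ?_⟩
  by_contra hna
  exact (h.1 hna).ne ha

theorem exists_eq_mul_zpow (a : (Kv v)ˣ) :
    ∃ (n : ℤ) (u : (Kv v)ˣ), ‖(u : Kv v)‖ = 1 ∧ a = u * unifUnit v ^ n := by
  have key (a : (Kv v)ˣ) (ha : (a : Kv v) ∈ Ov v) :
      ∃ (n : ℤ) (u : (Kv v)ˣ), ‖(u : Kv v)‖ = 1 ∧ a = u * unifUnit v ^ n := by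
    obtain ⟨n, u, hu⟩ := IsDiscreteValuationRing.eq_unit_mul_pow_irreducible
      (x := (⟨a, ha⟩ : Ov v)) (fun h => a.ne_zero (congrArg Subtype.val h)) (irreducible_unif v)
    have hu1 := (isUnit_iff_norm_eq_one v u).1 u.isUnit
    have hu0 : ((u : Ov v) : Kv v) ≠ 0 := norm_ne_zero_iff.1 (by rw [hu1]; exact one_ne_zero)
    refine ⟨n, Units.mk0 _ hu0, hu1, Units.ext ?_⟩
    rw [zpow_natCast, Units.val_mul, Units.val_pow_eq_pow_val]
    exact congrArg Subtype.val hu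
  by_cases ha : (a : Kv v) ∈ Ov v
  · exact key a ha
  · have ha' : ((a⁻¹ : (Kv v)ˣ) : Kv v) ∈ Ov v := by
      rw [← norm_le_one_iff] at ha ⊢
      rw [Units.val_inv_eq_inv_val, norm_inv]
      exact inv_le_one_of_one_le₀ (not_le.1 ha).le
    obtain ⟨n, u, hu, h⟩ := key _ ha'
    refine ⟨-n, u⁻¹, ?_, ?_⟩
    · rw [Units.val_inv_eq_inv_val, norm_inv, hu, inv_one]
    · rw [← inv_inv a, h, mul_inv, zpow_neg]

/-- Positive characters of `k_vˣ` that agree on units and on a uniformizer agree. -/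
theorem char_eq_of_unif (χ ψ : (Kv v)ˣ →* ℝ≥0) (h : ∀ u : (Kv v)ˣ, ‖(u : Kv v)‖ = 1 → χ u = ψ u)
    (hϖ : χ (unifUnit v) = ψ (unifUnit v)) : χ = ψ := by
  ext a
  obtain ⟨n, u, hu, rfl⟩ := exists_eq_mul_zpow v a
  have hz : χ (unifUnit v ^ n) = ψ (unifUnit v ^ n) := by
    have h1 : (Units.map χ (toUnits (unifUnit v))) = Units.map ψ (toUnits (unifUnit v)) :=
      Units.ext hϖ
    have h2 := congrArg (fun z : ℝ≥0ˣ => ((z ^ n : ℝ≥0ˣ) : ℝ≥0)) h1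
    simp only [← map_zpow] at h2
    exact h2
  rw [map_mul, map_mul, h u hu, hz]

variable {ι : Type*} [Fintype ι]

/-- The lattice `𝒪_v^ι`. -/
def stdLattice (ι : Type*) : AddSubgroup (ι → Kv v) where
  carrier := {f | ∀ i, f i ∈ Ov v}
  zero_mem' _ := zero_mem _
  add_mem' hf hg i := add_mem (hf i) (hg i)
  neg_mem' hf i := neg_mem (hf i)

theorem isCompact_Ov : IsCompact (Ov v : Set (Kv v)) := by
  have : (Ov v : Set (Kv v)) = Metric.closedBall 0 1 := by
    ext x
    rw [SetLike.mem_coe, ← norm_le_one_iff, mem_closedBall_zero_iff]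
  rw [this]
  exact isCompact_closedBall 0 1

theorem isOpen_Ov : IsOpen (Ov v : Set (Kv v)) := by
  have : (Ov v : Set (Kv v)) = Metric.closedBall 0 1 := by
    ext x
    rw [SetLike.mem_coe, ← norm_le_one_iff, mem_closedBall_zero_iff]
  rw [this]
  exact IsUltrametricDist.isOpen_closedBall 0 one_ne_zero

theorem stdLattice_eq_pi : (stdLattice v ι : Set (ι → Kv v)) =
    Set.univ.pi fun _ => (Ov v : Set (Kv v)) := by
  ext f
  simp [stdLattice, Set.mem_pi]

theorem isCompact_stdLattice : IsCompact (stdLattice v ι : Set (ι → Kv v)) := by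
  rw [stdLattice_eq_pi]
  exact isCompact_univ_pi fun _ => isCompact_Ov v

theorem isOpen_stdLattice : IsOpen (stdLattice v ι : Set (ι → Kv v)) := by
  rw [stdLattice_eq_pi]
  exact isOpen_set_pi Set.finite_univ fun _ _ => isOpen_Ov v

theorem mem_Ov_unif_iff (x : Kv v) : (∃ h : x ∈ Ov v, (⟨x, h⟩ : Ov v) ∈
    IsLocalRing.maximalIdeal (Ov v)) ↔ (unif v : Kv v)⁻¹ * x ∈ Ov v := by
  rw [(irreducible_unif v).maximalIdeal_eq]
  constructor
  · rintro ⟨h, hx⟩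
    obtain ⟨y, hy⟩ := Ideal.mem_span_singleton'.1 hx
    have : x = y * unif v := (congrArg Subtype.val hy).symm
    rw [this, mul_comm, mul_assoc, mul_inv_cancel₀ (unif_ne_zero v), mul_one]
    exact y.2
  · intro h
    have hx : x = unif v * ((unif v : Kv v)⁻¹ * x) := by
      rw [← mul_assoc, mul_inv_cancel₀ (unif_ne_zero v), one_mul]
    refine ⟨hx ▸ mul_mem (unif v).2 h, Ideal.mem_span_singleton'.2 ⟨⟨_, h⟩, Subtype.ext ?_⟩⟩
    rw [mul_comm]
    exact hx.symm

/-- Reduction of `𝒪_v^ι` modulo the maximal ideal. -/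
def latticeReduction (ι : Type*) : stdLattice v ι →+ (ι → IsLocalRing.ResidueField (Ov v)) where
  toFun f i := IsLocalRing.residue (Ov v) ⟨f.1 i, f.2 i⟩
  map_zero' := by
    funext i
    exact map_zero (IsLocalRing.residue (Ov v))
  map_add' f g := by
    funext i
    exact map_add (IsLocalRing.residue (Ov v)) ⟨f.1 i, f.2 i⟩ ⟨g.1 i, g.2 i⟩

theorem latticeReduction_surjective : Function.Surjective (latticeReduction v ι) := by
  intro z
  choose x hx using fun i => IsLocalRing.residue_surjective (z i)
  exact ⟨⟨fun i => (x i : Kv v), fun i => (x i).2⟩, funext hx⟩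

theorem relIndex_unif_smul_stdLattice :
    ((stdLattice v ι).map (DistribSMul.toAddMonoidHom (ι → Kv v) (unif v : Kv v))).relIndex
      (stdLattice v ι) = q v ^ Fintype.card ι := by
  have hker : ((stdLattice v ι).map
      (DistribSMul.toAddMonoidHom (ι → Kv v) (unif v : Kv v))).addSubgroupOf
      (stdLattice v ι) = (latticeReduction v ι).ker := by
    ext f
    rw [AddSubgroup.mem_addSubgroupOf, AddMonoidHom.mem_ker, AddSubgroup.mem_map]
    have h1 : latticeReduction v ι f = 0 ↔ ∀ i, (unif v : Kv v)⁻¹ * f.1 i ∈ Ov v := by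
      rw [funext_iff]
      refine forall_congr' fun i => ?_
      rw [← mem_Ov_unif_iff]
      change IsLocalRing.residue (Ov v) _ = 0 ↔ _
      rw [IsLocalRing.residue_eq_zero_iff]
      exact ⟨fun h => ⟨_, h⟩, fun ⟨_, h⟩ => h⟩
    rw [h1]
    constructor
    · rintro ⟨g, hg, hgf⟩ i
      have : f.1 i = unif v * g i := by rw [← hgf]; rfl
      rw [this, ← mul_assoc, inv_mul_cancel₀ (unif_ne_zero v), one_mul]
      exact hg i
    · intro h
      refine ⟨fun i => (unif v : Kv v)⁻¹ * f.1 i, h, ?_⟩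
      funext i
      change (unif v : Kv v) * _ = _
      rw [← mul_assoc, mul_inv_cancel₀ (unif_ne_zero v), one_mul]
  rw [AddSubgroup.relIndex, hker, AddSubgroup.index_ker,
    AddMonoidHom.range_eq_top.2 (latticeReduction_surjective v), AddSubgroup.card_top,
    Nat.card_fun, Nat.card_eq_fintype_card (α := ι)]
  rfl

variable {W Γ : Type*} [AddCommGroup W] [TopologicalSpace W] [IsTopologicalAddGroup W]
  [LocallyCompactSpace W] [Group Γ] [DistribMulAction Γ W] [ContinuousConstSMul Γ W]

/-- Multiplication by `a` scales the Haar measure of `k_v^d` by `|a|^d`. -/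
theorem distribHaarChar_scalar (j : (Kv v)ˣ →* Γ) (e : W ≃+ (ι → Kv v)) (he : Continuous e)
    (he' : Continuous e.symm) (hj : ∀ a w, e (j a • w) = (a : Kv v) • e w) (a : (Kv v)ˣ) :
    distribHaarChar W (j a) = ‖(a : Kv v)‖₊ ^ Fintype.card ι := by
  borelize W
  let μ : Measure W := Measure.addHaar
  let Λ : AddSubgroup W := (stdLattice v ι).comap e.toAddMonoidHom
  have hΛo : IsOpen (Λ : Set W) := (isOpen_stdLattice v).preimage he
  have hΛc : IsCompact (Λ : Set W) := by
    have : (Λ : Set W) = e.symm '' (stdLattice v ι : Set (ι → Kv v)) := by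
      ext w
      exact ⟨fun h => ⟨e w, h, e.symm_apply_apply w⟩, by rintro ⟨f, hf, rfl⟩; simpa [Λ] using hf⟩
    rw [this]
    exact (isCompact_stdLattice v).image he'
  have h0 : μ Λ ≠ 0 := (hΛo.measure_pos μ ⟨0, zero_mem _⟩).ne'
  have htop : μ Λ ≠ ∞ := hΛc.measure_lt_top.ne
  let ψ : (Kv v)ˣ →* ℝ≥0 :=
    { toFun a := ‖(a : Kv v)‖₊ ^ Fintype.card ι
      map_one' := by simp
      map_mul' a b := by rw [Units.val_mul, nnnorm_mul, mul_pow] }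
  refine DFunLike.congr_fun (char_eq_of_unif v ((distribHaarChar W).comp j) ψ ?_ ?_) a
  · intro u hu
    have hset : j u • (Λ : Set W) = Λ := by
      have hsub (u : (Kv v)ˣ) (hu : ‖(u : Kv v)‖ = 1) : j u • (Λ : Set W) ⊆ Λ := by
        rintro _ ⟨w, hw, rfl⟩
        intro i
        change e (j u • w) i ∈ Ov v
        rw [hj]
        exact mul_mem ((norm_le_one_iff v _).1 hu.le) (hw i)
      refine (hsub u hu).antisymm fun w hw => ?_
      rw [Set.mem_smul_set_iff_inv_smul_mem, ← map_inv]
      exact hsub u⁻¹ (by rw [Units.val_inv_eq_inv_val, norm_inv, hu, inv_one])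
        (Set.smul_mem_smul_set hw)
    have hψ : ψ u = 1 := by
      change ‖(u : Kv v)‖₊ ^ _ = 1
      rw [show ‖(u : Kv v)‖₊ = 1 from NNReal.eq hu, one_pow]
    rw [hψ]
    exact distribHaarChar_eq_of_measure_smul_eq_mul (μ := μ) h0 htop (by rw [hset]; simp)
  · have hle : (((stdLattice v ι).map
        (DistribSMul.toAddMonoidHom (ι → Kv v) (unif v : Kv v))).comap e.toAddMonoidHom) ≤
        Λ := by
      refine AddSubgroup.comap_mono ?_
      rintro _ ⟨f, hf, rfl⟩ i
      exact mul_mem (unif v).2 (hf i)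
    have hidx : (((stdLattice v ι).map
        (DistribSMul.toAddMonoidHom (ι → Kv v) (unif v : Kv v))).comap
          e.toAddMonoidHom).relIndex Λ = q v ^ Fintype.card ι := by
      rw [AddSubgroup.relIndex_comap, AddSubgroup.map_comap_eq_self_of_surjective e.surjective,
        relIndex_unif_smul_stdLattice]
    have hset : j (unifUnit v) • (Λ : Set W) = (((stdLattice v ι).map
        (DistribSMul.toAddMonoidHom (ι → Kv v) (unif v : Kv v))).comap
          e.toAddMonoidHom : AddSubgroup W) := by
      ext w
      constructor
      · rintro ⟨y, hy, rfl⟩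
        exact ⟨e y, hy, (hj (unifUnit v) y).symm⟩
      · rintro ⟨f, hf, hfw⟩
        refine ⟨e.symm f, ?_, ?_⟩
        · change e (e.symm f) ∈ stdLattice v ι
          rwa [e.apply_symm_apply]
        · apply e.injective
          change e (j (unifUnit v) • e.symm f) = e w
          rw [hj, e.apply_symm_apply]
          exact hfw
    have hq0 : (q v : ℝ≥0∞) ≠ 0 := by exact_mod_cast (one_lt_q v).ne_bot
    have hopen : IsOpen (j (unifUnit v) • (Λ : Set W)) := hΛo.smul _
    have hrel := relIndex_add_measure μ hle (by rw [← hset]; exact hopen.measurableSet)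
      (by rw [hidx]; exact pow_ne_zero _ (one_lt_q v).ne_bot)
    rw [hidx, ← hset] at hrel
    refine distribHaarChar_eq_of_measure_smul_eq_mul (μ := μ) h0 htop ?_
    have hψ : ψ (unifUnit v) = ((q v : ℝ≥0) ^ Fintype.card ι)⁻¹ := by
      change ‖(unif v : Kv v)‖₊ ^ _ = _
      rw [← inv_pow]
      congr 1
      exact NNReal.eq (by rw [coe_nnnorm, norm_unif]; simp)
    rw [hψ, ← hrel, ← mul_assoc, ENNReal.coe_inv (pow_ne_zero _ (by exact_mod_cast
      (one_lt_q v).ne_bot))]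
    push_cast
    rw [ENNReal.inv_mul_cancel (pow_ne_zero _ hq0) (ENNReal.pow_ne_top (by simp)), one_mul]

end Scaling

/-! ### Topology of the group and of the representation -/

section UnitsTopology

set_option linter.unusedSectionVars false

variable {M : Type*} [Monoid M] [TopologicalSpace M] [ContinuousMul M] [T1Space M]

theorem units_locallyCompactSpace [LocallyCompactSpace M] : LocallyCompactSpace Mˣ :=
  have : LocallyCompactSpace Mᵐᵒᵖ :=
    MulOpposite.opHomeomorph.symm.isClosedEmbedding.locallyCompactSpace
  Units.isClosedEmbedding_embedProduct.locallyCompactSpace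

theorem units_polishSpace [PolishSpace M] : PolishSpace Mˣ :=
  have : PolishSpace Mᵐᵒᵖ := MulOpposite.opHomeomorph.symm.isClosedEmbedding.polishSpace
  Units.isClosedEmbedding_embedProduct.polishSpace

theorem units_isOpen {C : Set M} (hC : IsOpen C) :
    IsOpen {a : Mˣ | (a : M) ∈ C ∧ ((a⁻¹ : Mˣ) : M) ∈ C} :=
  (hC.preimage Units.continuous_val).inter (hC.preimage Units.continuous_coe_inv)

theorem units_isCompact {C : Set M} (hC : IsCompact C) :
    IsCompact {a : Mˣ | (a : M) ∈ C ∧ ((a⁻¹ : Mˣ) : M) ∈ C} := by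
  have h := Units.isClosedEmbedding_embedProduct.isCompact_preimage
    (hC.prod (hC.image MulOpposite.continuous_op))
  convert h using 1
  ext a
  simp [Units.embedProduct]

end UnitsTopology

section PairTopology

set_option linter.unusedSectionVars false

variable {F : Type*} [NormedField F]

instance : IsTopologicalGroup (PairGroup F) :=
  inferInstanceAs (IsTopologicalGroup ((Mat F)ˣ × ((Mat F)ᵐᵒᵖ)ˣ × GL (Fin 2) F))

instance : T2Space (PairGroup F) :=
  inferInstanceAs (T2Space ((Mat F)ˣ × ((Mat F)ᵐᵒᵖ)ˣ × GL (Fin 2) F))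

instance : IsTopologicalAddGroup (PairSpace F) :=
  inferInstanceAs (IsTopologicalAddGroup (Mat F × Mat F))

theorem continuous_g11 : Continuous (PairGroup.g11 : PairGroup F → Mat F) :=
  Units.continuous_val.comp continuous_fst

theorem continuous_g12 : Continuous (PairGroup.g12 : PairGroup F → Mat F) :=
  MulOpposite.continuous_unop.comp (Units.continuous_val.comp (continuous_fst.comp continuous_snd))

theorem continuous_g2 : Continuous (PairGroup.g2 : PairGroup F → Mat F) :=
  Units.continuous_val.comp (continuous_snd.comp continuous_snd)

theorem PairSpace.continuous_fst : Continuous (fun x : PairSpace F => x.1) :=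
  _root_.continuous_fst (X := Mat F) (Y := Mat F)

theorem PairSpace.continuous_snd : Continuous (fun x : PairSpace F => x.2) :=
  _root_.continuous_snd (X := Mat F) (Y := Mat F)

theorem PairSpace.continuous_mk {X : Type*} [TopologicalSpace X] {f g : X → Mat F}
    (hf : Continuous f) (hg : Continuous g) :
    Continuous fun x => ((f x, g x) : PairSpace F) :=
  @Continuous.prodMk (Mat F) (Mat F) X _ _ _ f g hf hg

instance : ContinuousSMul (PairGroup F) (PairSpace F) where
  continuous_smul := by
    have h11 := (continuous_g11 (F := F)).comp
      (_root_.continuous_fst (X := PairGroup F) (Y := PairSpace F))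
    have h12 := (continuous_g12 (F := F)).comp
      (_root_.continuous_fst (X := PairGroup F) (Y := PairSpace F))
    have h2 (i j : Fin 2) := ((continuous_g2 (F := F)).comp
      (_root_.continuous_fst (X := PairGroup F) (Y := PairSpace F))).matrix_elem i j
    have hx := (PairSpace.continuous_fst (F := F)).comp
      (_root_.continuous_snd (X := PairGroup F) (Y := PairSpace F))
    have hy := (PairSpace.continuous_snd (F := F)).comp
      (_root_.continuous_snd (X := PairGroup F) (Y := PairSpace F))
    exact PairSpace.continuous_mk
      ((h11.mul (((h2 0 0).smul hx).add ((h2 0 1).smul hy))).mul h12)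
      ((h11.mul (((h2 1 0).smul hx).add ((h2 1 1).smul hy))).mul h12)

instance : DistribMulAction (PairGroup F) (PairSpace F) where
  smul_zero g := by
    rw [smul_def]
    change ((g.g11 * (g.g2 0 0 • (0 : Mat F) + g.g2 0 1 • (0 : Mat F)) * g.g12,
      g.g11 * (g.g2 1 0 • (0 : Mat F) + g.g2 1 1 • (0 : Mat F)) * g.g12) : Mat F × Mat F) = 0
    simp
  smul_add g x y := by
    rw [smul_def, smul_def g x, smul_def g y]
    refine PairSpace.ext' ?_ ?_
    · change g.g11 * (g.g2 0 0 • (x.1 + y.1) + g.g2 0 1 • (x.2 + y.2)) * g.g12 =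
        g.g11 * (g.g2 0 0 • x.1 + g.g2 0 1 • x.2) * g.g12 +
          g.g11 * (g.g2 0 0 • y.1 + g.g2 0 1 • y.2) * g.g12
      simp only [smul_add, mul_add, add_mul]
      abel
    · change g.g11 * (g.g2 1 0 • (x.1 + y.1) + g.g2 1 1 • (x.2 + y.2)) * g.g12 =
        g.g11 * (g.g2 1 0 • x.1 + g.g2 1 1 • x.2) * g.g12 +
          g.g11 * (g.g2 1 0 • y.1 + g.g2 1 1 • y.2) * g.g12
      simp only [smul_add, mul_add, add_mul]
      abel

theorem continuous_quadForm (a b : F) : Continuous fun x : PairSpace F => quadForm x a b :=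
  ((PairSpace.continuous_fst.const_smul a).add (PairSpace.continuous_snd.const_smul b)).matrix_det

theorem continuous_disc : Continuous (disc : PairSpace F → F) := by
  have h (a b : F) := continuous_quadForm (F := F) a b
  exact ((((h 1 1).sub (h 1 0)).sub (h 0 1)).pow 2).sub
    ((continuous_const.mul (h 1 0)).mul (h 0 1))

variable [ProperSpace F]

instance : LocallyCompactSpace (Mat F) := inferInstanceAs (LocallyCompactSpace (Fin 2 → Fin 2 → F))

instance : LocallyCompactSpace (PairSpace F) :=
  inferInstanceAs (LocallyCompactSpace (Mat F × Mat F))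

instance : LocallyCompactSpace (PairGroup F) :=
  have : LocallyCompactSpace (Mat F)ᵐᵒᵖ :=
    MulOpposite.opHomeomorph.symm.isClosedEmbedding.locallyCompactSpace
  have h1 : LocallyCompactSpace (Mat F)ˣ := units_locallyCompactSpace
  have _h2 : LocallyCompactSpace ((Mat F)ᵐᵒᵖ)ˣ := units_locallyCompactSpace
  have _h3 : LocallyCompactSpace (GL (Fin 2) F) := h1
  inferInstanceAs (LocallyCompactSpace ((Mat F)ˣ × ((Mat F)ᵐᵒᵖ)ˣ × GL (Fin 2) F))

variable [SecondCountableTopology F]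

instance : PolishSpace (Mat F) := inferInstanceAs (PolishSpace (Fin 2 → Fin 2 → F))

instance : PolishSpace (PairSpace F) := inferInstanceAs (PolishSpace (Mat F × Mat F))

instance : PolishSpace (PairGroup F) :=
  have : PolishSpace (Mat F)ᵐᵒᵖ := MulOpposite.opHomeomorph.symm.isClosedEmbedding.polishSpace
  have h1 : PolishSpace (Mat F)ˣ := units_polishSpace
  have _h2 : PolishSpace ((Mat F)ᵐᵒᵖ)ˣ := units_polishSpace
  have _h3 : PolishSpace (GL (Fin 2) F) := h1
  inferInstanceAs (PolishSpace ((Mat F)ˣ × ((Mat F)ᵐᵒᵖ)ˣ × GL (Fin 2) F))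

theorem isClosed_adjoin {u : Mat F} (hu : disc (w u) ≠ 0) :
    IsClosed (Algebra.adjoin F {u} : Set (Mat F)) := by
  have : (Algebra.adjoin F {u} : Set (Mat F)) = {a | a * u = u * a} := by
    ext a
    exact (mem_adjoin_self_iff u a).trans (commute_iff hu a).symm
  rw [this]
  exact isClosed_eq (continuous_id.mul continuous_const) (continuous_const.mul continuous_id)

instance (u : Mat F) : IsTopologicalGroup (QuadUnits u) :=
  inferInstanceAs (IsTopologicalGroup (Algebra.adjoin F {u})ˣ)

theorem quadUnits_locallyCompactSpace {u : Mat F} (hu : disc (w u) ≠ 0) :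
    LocallyCompactSpace (QuadUnits u) :=
  have : LocallyCompactSpace (Algebra.adjoin F {u}) :=
    (isClosed_adjoin hu).isClosedEmbedding_subtypeVal.locallyCompactSpace
  units_locallyCompactSpace (M := Algebra.adjoin F {u})

theorem quadUnits_polishSpace {u : Mat F} (hu : disc (w u) ≠ 0) : PolishSpace (QuadUnits u) :=
  have : PolishSpace (Algebra.adjoin F {u}) :=
    (isClosed_adjoin hu).isClosedEmbedding_subtypeVal.polishSpace
  units_polishSpace (M := Algebra.adjoin F {u})

end PairTopology

/-! ### The normalized measures on the group, the representation and the stabilizer -/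

section LocalMeasures

open NumberField NumberField.HeightOneSpectrum

variable {k : Type*} [Field k] [NumberField k] (v : HeightOneSpectrum (𝓞 k))

/-- The integral matrices. -/
def intMat : Set (Mat (Kv v)) := {a | ∀ i j, a i j ∈ Ov v}

theorem intMat_eq_pi : intMat v =
    Set.univ.pi fun _ => Set.univ.pi fun _ => (Ov v : Set (Kv v)) := by
  ext a
  exact ⟨fun h i _ j _ => h i j, fun h i j => h i trivial j trivial⟩

theorem isCompact_intMat : IsCompact (intMat v) := by
  rw [intMat_eq_pi]
  exact isCompact_univ_pi fun _ => isCompact_univ_pi fun _ => isCompact_Ov v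

theorem isOpen_intMat : IsOpen (intMat v) := by
  rw [intMat_eq_pi]
  exact isOpen_set_pi Set.finite_univ fun _ _ => isOpen_set_pi Set.finite_univ fun _ _ => isOpen_Ov v

theorem maxCompact_eq_prod : maxCompact v =
    {a : (Mat (Kv v))ˣ | (a : Mat (Kv v)) ∈ intMat v ∧ ((a⁻¹ : (Mat (Kv v))ˣ) : Mat (Kv v)) ∈ intMat v} ×ˢ
      ({a : (Mat (Kv v))ᵐᵒᵖˣ | (a : (Mat (Kv v))ᵐᵒᵖ) ∈ MulOpposite.unop ⁻¹' intMat v ∧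
          ((a⁻¹ : (Mat (Kv v))ᵐᵒᵖˣ) : (Mat (Kv v))ᵐᵒᵖ) ∈ MulOpposite.unop ⁻¹' intMat v} ×ˢ
        {a : (Mat (Kv v))ˣ | (a : Mat (Kv v)) ∈ intMat v ∧
          ((a⁻¹ : (Mat (Kv v))ˣ) : Mat (Kv v)) ∈ intMat v}) := by
  ext g
  constructor
  · intro h
    exact ⟨⟨fun i j => (h i j).1.1, fun i j => (h i j).1.2⟩,
      ⟨fun i j => (h i j).2.1.1, fun i j => (h i j).2.1.2⟩,
      ⟨fun i j => (h i j).2.2.1, fun i j => (h i j).2.2.2⟩⟩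
  · rintro ⟨h1, h2, h3⟩ i j
    exact ⟨⟨h1.1 i j, h1.2 i j⟩, ⟨h2.1 i j, h2.2 i j⟩, h3.1 i j, h3.2 i j⟩

theorem isCompact_maxCompact : IsCompact (maxCompact v) := by
  rw [maxCompact_eq_prod]
  have h2 : IsCompact (MulOpposite.unop ⁻¹' intMat v) := by
    exact MulOpposite.opHomeomorph.symm.isClosedEmbedding.isCompact_preimage (isCompact_intMat v)
  exact (units_isCompact (isCompact_intMat v)).prod
    ((units_isCompact h2).prod (units_isCompact (isCompact_intMat v)))

theorem isOpen_maxCompact : IsOpen (maxCompact v) := by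
  rw [maxCompact_eq_prod]
  have h2 : IsOpen (MulOpposite.unop ⁻¹' intMat v) :=
    (isOpen_intMat v).preimage MulOpposite.continuous_unop
  exact (units_isOpen (isOpen_intMat v)).prod
    ((units_isOpen h2).prod (units_isOpen (isOpen_intMat v)))

theorem one_mem_intMat : (1 : Mat (Kv v)) ∈ intMat v := fun i j => by
  rw [Matrix.one_apply]
  split_ifs
  exacts [one_mem _, zero_mem _]

theorem mul_mem_intMat {a b : Mat (Kv v)} (ha : a ∈ intMat v) (hb : b ∈ intMat v) :
    a * b ∈ intMat v := fun i j => by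
  rw [Matrix.mul_apply]
  exact sum_mem fun l _ => mul_mem (ha i l) (hb l j)

theorem one_mem_maxCompact : (1 : PairGroup (Kv v)) ∈ maxCompact v := by
  intro i j
  rw [inv_one, g11_one, g12_one, g2_one]
  have := one_mem_intMat v i j
  exact ⟨⟨this, this⟩, ⟨this, this⟩, this, this⟩

theorem haarG_spec : (haarG v).IsHaarMeasure ∧ haarG v (maxCompact v) = 1 :=
  normalizedHaar_spec (isCompact_maxCompact v)
    ⟨1, by rw [(isOpen_maxCompact v).interior_eq]; exact one_mem_maxCompact v⟩

theorem integralPoints_eq_prod : integralPoints v = intMat v ×ˢ intMat v := by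
  ext x
  exact ⟨fun h => ⟨fun i j => (h i j).1, fun i j => (h i j).2⟩,
    fun h i j => ⟨h.1 i j, h.2 i j⟩⟩

theorem isCompact_integralPoints : IsCompact (integralPoints v) := by
  rw [integralPoints_eq_prod]
  exact (isCompact_intMat v).prod (isCompact_intMat v)

theorem isOpen_integralPoints : IsOpen (integralPoints v) := by
  rw [integralPoints_eq_prod]
  exact (isOpen_intMat v).prod (isOpen_intMat v)

theorem zero_mem_integralPoints : (0 : PairSpace (Kv v)) ∈ integralPoints v :=
  fun _ _ => ⟨zero_mem (Ov v), zero_mem (Ov v)⟩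

theorem haarV_spec : (haarV v).IsAddHaarMeasure ∧ haarV v (integralPoints v) = 1 :=
  normalizedAddHaar_spec (isCompact_integralPoints v)
    ⟨0, by rw [(isOpen_integralPoints v).interior_eq]; exact zero_mem_integralPoints v⟩

instance : (haarG v).IsHaarMeasure := (haarG_spec v).1

instance : (haarV v).IsAddHaarMeasure := (haarV_spec v).1

variable {v} {u : Mat (Kv v)}

theorem exists_norm_le_of_fg (S : Submodule (Ov v) (Mat (Kv v))) (hS : S.FG) :
    ∃ C : ℝ, ∀ a ∈ S, ∀ i j, ‖a i j‖ ≤ C := by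
  obtain ⟨s, rfl⟩ := hS
  refine ⟨∑ b ∈ s, ∑ i, ∑ j, ‖b i j‖, fun a ha => ?_⟩
  have h0 : 0 ≤ ∑ b ∈ s, ∑ i, ∑ j, ‖b i j‖ := by positivity
  induction ha using Submodule.span_induction with
  | mem b hb =>
    intro i j
    have h1 := Finset.single_le_sum (f := fun b : Mat (Kv v) => ∑ i, ∑ j, ‖b i j‖)
      (fun _ _ => by positivity) hb
    have h2 := Finset.single_le_sum (f := fun i => ∑ j, ‖b i j‖)
      (fun _ _ => by positivity) (Finset.mem_univ i)
    have h3 := Finset.single_le_sum (f := fun j => ‖b i j‖)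
      (fun _ _ => by positivity) (Finset.mem_univ j)
    exact h3.trans (h2.trans h1)
  | zero => intro i j; simpa using h0
  | add a b _ _ ha hb =>
    intro i j
    exact (IsUltrametricDist.norm_add_le_max _ _).trans (max_le (ha i j) (hb i j))
  | smul r a _ ha =>
    intro i j
    change ‖(r : Kv v) * a i j‖ ≤ _
    rw [norm_mul]
    exact (mul_le_of_le_one_left (norm_nonneg _) ((norm_le_one_iff v _).2 r.2)).trans (ha i j)

theorem det_mem_of_isIntegral {a : Mat (Kv v)} (ha : IsIntegral (Ov v) a) : a.det ∈ Ov v := by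
  obtain ⟨C, hC⟩ := exists_norm_le_of_fg _ ha.fg_adjoin_singleton
  rw [← norm_le_one_iff]
  by_contra! h
  have hpow (n : ℕ) : ‖a.det‖ ^ n ≤ C * C := by
    have hn (i j : Fin 2) : ‖(a ^ n) i j‖ ≤ C :=
      hC _ (pow_mem (Algebra.subset_adjoin (Set.mem_singleton a)) n) i j
    have h0 : 0 ≤ C := (norm_nonneg _).trans (hn 0 0)
    rw [← norm_pow, ← Matrix.det_pow, Matrix.det_fin_two, sub_eq_add_neg]
    refine (IsUltrametricDist.norm_add_le_max _ _).trans (max_le ?_ ?_)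
    · rw [norm_mul]
      exact mul_le_mul (hn _ _) (hn _ _) (norm_nonneg _) h0
    · rw [norm_neg, norm_mul]
      exact mul_le_mul (hn _ _) (hn _ _) (norm_nonneg _) h0
  obtain ⟨n, hn⟩ := pow_unbounded_of_one_lt (C * C) h
  exact (hpow n).not_gt hn

theorem trace_mem_of_isIntegral {a : Mat (Kv v)} (ha : IsIntegral (Ov v) a) :
    a.trace ∈ Ov v := by
  have h1 := det_mem_of_isIntegral ha
  have h2 := det_mem_of_isIntegral (IsIntegral.of_mem_of_fg _ ha.fg_adjoin_singleton (a + 1)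
    (add_mem (Algebra.subset_adjoin rfl) (one_mem _)))
  have h3 : a.trace = (a + 1).det - a.det - 1 := by
    simp [Matrix.det_fin_two, Matrix.trace_fin_two]
    ring
  rw [h3]
  exact sub_mem (sub_mem h2 h1) (one_mem _)

theorem IsStandardRepresentative.isIntegral (hstd : IsStandardRepresentative v u) :
    IsIntegral (Ov v) u :=
  (hstd.2 u (Algebra.subset_adjoin rfl)).2 (Algebra.subset_adjoin rfl)

theorem IsStandardRepresentative.det_mem (hstd : IsStandardRepresentative v u) :
    u.det ∈ Ov v := det_mem_of_isIntegral hstd.isIntegral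

theorem IsStandardRepresentative.trace_mem (hstd : IsStandardRepresentative v u) :
    u.trace ∈ Ov v := trace_mem_of_isIntegral hstd.isIntegral

theorem IsStandardRepresentative.isIntegral_lin_iff (hstd : IsStandardRepresentative v u)
    (x y : Kv v) : IsIntegral (Ov v) (x • 1 + y • u) ↔ x ∈ Ov v ∧ y ∈ Ov v := by
  rw [hstd.2 _ ((mem_adjoin_self_iff u _).2 ⟨x, y, rfl⟩),
    mem_adjoin_iff (R := Ov v) u ⟨⟨_, hstd.trace_mem⟩, rfl⟩ ⟨⟨_, hstd.det_mem⟩, rfl⟩]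
  constructor
  · rintro ⟨x', y', h⟩
    obtain ⟨rfl, rfl⟩ := lin_injective hstd.1 h
    exact ⟨x'.2, y'.2⟩
  · rintro ⟨hx, hy⟩
    exact ⟨⟨x, hx⟩, ⟨y, hy⟩, rfl⟩

theorem continuous_coordX (u : Mat (Kv v)) : Continuous (coordX u) := by
  unfold coordX
  exact ((continuous_id.matrix_trace.mul continuous_const).sub
    (continuous_const.mul (continuous_id.mul continuous_const).matrix_trace)).div_const _

theorem continuous_coordY (u : Mat (Kv v)) : Continuous (coordY u) := by
  unfold coordY
  exact ((continuous_const.mul (continuous_id.mul continuous_const).matrix_trace).sub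
    (continuous_id.matrix_trace.mul continuous_const)).div_const _

/-- The integral elements of `k_v[u]`. -/
def integralElements (u : Mat (Kv v)) : Set (Algebra.adjoin (Kv v) {u}) :=
  {a | IsIntegral (Ov v) (a : Mat (Kv v))}

theorem IsStandardRepresentative.isOpen_integralElements (hstd : IsStandardRepresentative v u) :
    IsOpen (integralElements u) := by
  have : integralElements u =
      (fun a : Algebra.adjoin (Kv v) {u} => coordX u (a : Mat (Kv v))) ⁻¹' (Ov v) ∩
      (fun a : Algebra.adjoin (Kv v) {u} => coordY u (a : Mat (Kv v))) ⁻¹' (Ov v) := by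
    ext ⟨a, ha⟩
    obtain ⟨x, y, rfl⟩ := (mem_adjoin_self_iff u a).1 ha
    change IsIntegral (Ov v) (x • 1 + y • u) ↔
      coordX u (x • 1 + y • u) ∈ Ov v ∧ coordY u (x • 1 + y • u) ∈ Ov v
    rw [coordX_lin hstd.1, coordY_lin hstd.1]
    exact hstd.isIntegral_lin_iff x y
  rw [this]
  exact ((isOpen_Ov v).preimage ((continuous_coordX u).comp continuous_subtype_val)).inter
    ((isOpen_Ov v).preimage ((continuous_coordY u).comp continuous_subtype_val))

theorem IsStandardRepresentative.isCompact_integralElements (hstd : IsStandardRepresentative v u) :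
    IsCompact (integralElements u) := by
  rw [Topology.IsEmbedding.subtypeVal.isCompact_iff]
  have : (Subtype.val : Algebra.adjoin (Kv v) {u} → Mat (Kv v)) '' integralElements u =
      (fun p : Kv v × Kv v => p.1 • (1 : Mat (Kv v)) + p.2 • u) ''
        ((Ov v : Set (Kv v)) ×ˢ (Ov v : Set (Kv v))) := by
    ext a
    constructor
    · rintro ⟨⟨a, ha⟩, hi, rfl⟩
      obtain ⟨x, y, rfl⟩ := (mem_adjoin_self_iff u a).1 ha
      exact ⟨(x, y), (hstd.isIntegral_lin_iff x y).1 hi, rfl⟩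
    · rintro ⟨⟨x, y⟩, hxy, rfl⟩
      exact ⟨⟨_, (mem_adjoin_self_iff u _).2 ⟨x, y, rfl⟩⟩,
        (hstd.isIntegral_lin_iff x y).2 hxy, rfl⟩
  rw [this]
  exact ((isCompact_Ov v).prod (isCompact_Ov v)).image
    ((continuous_fst.smul continuous_const).add (continuous_snd.smul continuous_const))

theorem IsStandardRepresentative.isOpen_integralUnits (hstd : IsStandardRepresentative v u) :
    IsOpen (integralUnits v u) :=
  units_isOpen (M := Algebra.adjoin (Kv v) {u}) hstd.isOpen_integralElements

theorem IsStandardRepresentative.isCompact_integralUnits (hstd : IsStandardRepresentative v u) :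
    IsCompact (integralUnits v u) :=
  units_isCompact (M := Algebra.adjoin (Kv v) {u}) hstd.isCompact_integralElements

theorem one_mem_integralUnits (u : Mat (Kv v)) : 1 ∈ integralUnits v u := by
  rw [integralUnits, Set.mem_ofPred_eq, inv_one, map_one, Units.val_one]
  exact ⟨isIntegral_one, isIntegral_one⟩

theorem IsStandardRepresentative.haarQuad_spec (hstd : IsStandardRepresentative v u) :
    (haarQuad v u).IsHaarMeasure ∧ haarQuad v u (integralUnits v u) = 1 :=
  have := quadUnits_locallyCompactSpace hstd.1
  have := quadUnits_polishSpace hstd.1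
  normalizedHaar_spec hstd.isCompact_integralUnits
    ⟨1, by rw [hstd.isOpen_integralUnits.interior_eq]; exact one_mem_integralUnits u⟩

theorem continuous_toMat (u : Mat (Kv v)) :
    Continuous (QuadUnits.toMat : QuadUnits u →* (Mat (Kv v))ˣ) :=
  Continuous.units_map (Algebra.adjoin (Kv v) {u}).val.toMonoidHom continuous_subtype_val

theorem psi_inv (hu : disc (w u) ≠ 0) (s : QuadUnits u × QuadUnits u) :
    psi u s⁻¹ = (psi u s)⁻¹ :=
  map_inv (MonoidHom.mk' (psi u) (psi_mul hu)) s

theorem continuous_psi_g2 (hu : disc (w u) ≠ 0) : Continuous fun s => (psi u s).g2 := by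
  have h : (fun s => (psi u s).g2) = fun s : QuadUnits u × QuadUnits u =>
      !![coordX u ((s.1.toMat * s.2.toMat)⁻¹ : (Mat (Kv v))ˣ),
          coordY u ((s.1.toMat * s.2.toMat)⁻¹ : (Mat (Kv v))ˣ);
        -u.det * coordY u ((s.1.toMat * s.2.toMat)⁻¹ : (Mat (Kv v))ˣ),
          coordX u ((s.1.toMat * s.2.toMat)⁻¹ : (Mat (Kv v))ˣ) +
            u.trace * coordY u ((s.1.toMat * s.2.toMat)⁻¹ : (Mat (Kv v))ˣ)] := by
    funext s
    rw [psi_g2 hu, gMat, Matrix.coe_units_inv, Units.val_mul]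
  have hc : Continuous fun s : QuadUnits u × QuadUnits u =>
      (((s.1.toMat * s.2.toMat)⁻¹ : (Mat (Kv v))ˣ) : Mat (Kv v)) :=
    Units.continuous_coe_inv.comp (((continuous_toMat u).comp continuous_fst).mul
      ((continuous_toMat u).comp continuous_snd))
  have hX := (continuous_coordX u).comp hc
  have hY := (continuous_coordY u).comp hc
  rw [h]
  refine continuous_matrix fun i j => ?_
  fin_cases i <;> fin_cases j
  · exact hX
  · exact hY
  · exact continuous_const.mul hY
  · exact hX.add (continuous_const.mul hY)

theorem continuous_psi (hu : disc (w u) ≠ 0) : Continuous (psi u) := by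
  refine ((continuous_toMat u).comp continuous_fst).prodMk
    ((?_ : Continuous fun s : QuadUnits u × QuadUnits u =>
      Units.opEquiv.symm (MulOpposite.op s.2.toMat)).prodMk ?_)
  · rw [Units.continuous_iff]
    exact ⟨MulOpposite.continuous_op.comp (Units.continuous_val.comp
        ((continuous_toMat u).comp continuous_snd)),
      MulOpposite.continuous_op.comp (Units.continuous_coe_inv.comp
        ((continuous_toMat u).comp continuous_snd))⟩
  · rw [Units.continuous_iff]
    refine ⟨continuous_psi_g2 hu, ?_⟩
    have h := (continuous_psi_g2 hu).comp continuous_inv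
    refine h.congr fun s => ?_
    change (psi u s⁻¹).g2 = _
    rw [psi_inv hu]
    rfl

theorem isClosed_centralStab (u : Mat (Kv v)) : IsClosed (centralStab u : Set (PairGroup (Kv v))) :=
  (isClosed_eq (continuous_id.smul continuous_const) continuous_const).inter
    (isClosed_eq (continuous_g11.mul continuous_const) (continuous_const.mul continuous_g11))

section Stabilizer

theorem IsStandardRepresentative.stabilizerMeasure_apply (hstd : IsStandardRepresentative v u)
    {A : Set (PairGroup (Kv v))} (hA : MeasurableSet A) :
    stabilizerMeasure v u A = ((haarQuad v u).prod (haarQuad v u)) (psi u ⁻¹' A) :=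
  have := quadUnits_polishSpace hstd.1
  Measure.map_apply (continuous_psi hstd.1).measurable hA

theorem IsStandardRepresentative.sFinite_stabilizerMeasure (hstd : IsStandardRepresentative v u) :
    SFinite (stabilizerMeasure v u) := by
  have := quadUnits_polishSpace hstd.1
  have := quadUnits_locallyCompactSpace hstd.1
  have := hstd.haarQuad_spec.1
  unfold stabilizerMeasure
  infer_instance

theorem IsStandardRepresentative.ae_mem_centralStab (hstd : IsStandardRepresentative v u) :
    ∀ᵐ h ∂(stabilizerMeasure v u), h ∈ centralStab u := by
  have h : stabilizerMeasure v u (centralStab u : Set (PairGroup (Kv v)))ᶜ = 0 := by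
    rw [hstd.stabilizerMeasure_apply (isClosed_centralStab u).measurableSet.compl,
      Set.preimage_compl, Set.eq_univ_of_forall (s := psi u ⁻¹' centralStab u)
        (psi_mem_centralStab hstd.1), Set.compl_univ, measure_empty]
  exact h

theorem IsStandardRepresentative.map_mul_stabilizerMeasure (hstd : IsStandardRepresentative v u)
    {h : PairGroup (Kv v)} (hh : h ∈ centralStab u) :
    (stabilizerMeasure v u).map (h * ·) = stabilizerMeasure v u := by
  have := quadUnits_polishSpace hstd.1
  have := quadUnits_locallyCompactSpace hstd.1
  have := hstd.haarQuad_spec.1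
  obtain ⟨t, rfl⟩ := exists_psi_eq hstd.1 hh
  have hm := (continuous_psi hstd.1).measurable
  rw [stabilizerMeasure, Measure.map_map (measurable_const_mul _) hm,
    show (psi u t * ·) ∘ psi u = psi u ∘ (t * ·) from
      funext fun s => (psi_mul hstd.1 t s).symm,
    ← Measure.map_map hm (measurable_const_mul _), map_mul_left_eq_self]

theorem IsStandardRepresentative.stabilizerMeasure_ne_zero (hstd : IsStandardRepresentative v u) :
    stabilizerMeasure v u ≠ 0 := by
  have := quadUnits_polishSpace hstd.1
  have := quadUnits_locallyCompactSpace hstd.1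
  have := hstd.haarQuad_spec.1
  rw [stabilizerMeasure, Ne, Measure.map_eq_zero_iff (continuous_psi hstd.1).aemeasurable]
  exact NeZero.ne _

/-- The measure on the stabilizer is finite on compact sets if some open subgroup has finite
volume. -/
theorem IsStandardRepresentative.isFiniteMeasureOnCompacts_stabilizerMeasure
    (hstd : IsStandardRepresentative v u) (U : Subgroup (PairGroup (Kv v)))
    (hU : IsOpen (U : Set (PairGroup (Kv v)))) (hfin : stabilizerMeasure v u U ≠ ∞) :
    IsFiniteMeasureOnCompacts (stabilizerMeasure v u) := by
  refine ⟨fun {C} hC => ?_⟩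
  have htr (g : PairGroup (Kv v)) : stabilizerMeasure v u ((g⁻¹ * ·) ⁻¹' U) < ∞ := by
    have hm : MeasurableSet ((g⁻¹ * ·) ⁻¹' (U : Set (PairGroup (Kv v)))) :=
      (hU.preimage (continuous_const_mul _)).measurableSet
    by_cases hg : ∃ h ∈ centralStab u, g⁻¹ * h ∈ U
    · obtain ⟨h, hh, hgh⟩ := hg
      rw [← hstd.map_mul_stabilizerMeasure hh, Measure.map_apply (measurable_const_mul _) hm]
      convert hfin.lt_top using 2
      ext x
      change g⁻¹ * (h * x) ∈ U ↔ x ∈ U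
      rw [← mul_assoc]
      exact U.mul_mem_cancel_left hgh
    · push Not at hg
      rw [measure_eq_zero_iff_ae_notMem.2]
      · exact ENNReal.zero_lt_top
      · filter_upwards [hstd.ae_mem_centralStab] with h hh using hg h hh
  refine hC.induction_on (p := fun C => stabilizerMeasure v u C < ∞) (by simp)
    (fun s t hst ht => (measure_mono hst).trans_lt ht)
    (fun s t hs ht => (measure_union_le _ _).trans_lt (ENNReal.add_lt_top.2 ⟨hs, ht⟩))
    fun g _ => ⟨_, mem_nhdsWithin_of_mem_nhds ?_, htr g⟩
  refine (hU.preimage (continuous_const_mul g⁻¹)).mem_nhds ?_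
  change g⁻¹ * g ∈ U
  rw [inv_mul_cancel]
  exact one_mem U

end Stabilizer

end LocalMeasures

/-! ### The invariant measure on an orbit -/

section InvariantMeasure

open scoped NNReal Pointwise
open NumberField NumberField.HeightOneSpectrum

section

variable {F : Type*} [Field F]

theorem quadForm_smul (g : PairGroup F) (x : PairSpace F) (a b : F) :
    quadForm (g • x) a b = g.g11.det * g.g12.det *
      quadForm x (a * g.g2 0 0 + b * g.g2 1 0) (a * g.g2 0 1 + b * g.g2 1 1) := by
  have h : a • (g • x).1 + b • (g • x).2 = g.g11 * ((a * g.g2 0 0 + b * g.g2 1 0) • x.1 +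
      (a * g.g2 0 1 + b * g.g2 1 1) • x.2) * g.g12 := by
    change a • (g.g11 * (g.g2 0 0 • x.1 + g.g2 0 1 • x.2) * g.g12) +
      b • (g.g11 * (g.g2 1 0 • x.1 + g.g2 1 1 • x.2) * g.g12) = _
    simp only [add_smul, mul_smul, smul_add, mul_add, add_mul, Matrix.mul_smul, Matrix.smul_mul]
    abel
  rw [quadForm, h, Matrix.det_mul, Matrix.det_mul, quadForm]
  ring

theorem disc_smul (g : PairGroup F) (x : PairSpace F) :
    disc (g • x) = (g.g11.det * g.g12.det * g.g2.det) ^ 2 * disc x := by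
  simp only [disc, coeff0, coeff1, coeff2, quadForm_smul]
  simp only [quadForm_eq x]
  rw [Matrix.det_fin_two g.g2]
  ring

/-- The action of the first factor. -/
def inclFst : (Mat F)ˣ →* PairGroup F := MonoidHom.inl _ _

/-- The action of the second factor, made covariant by transposition. -/
def inclSnd : (Mat F)ˣ →* PairGroup F :=
  (MonoidHom.inr (Mat F)ˣ (((Mat F)ᵐᵒᵖ)ˣ × GL (Fin 2) F)).comp
    ((MonoidHom.inl ((Mat F)ᵐᵒᵖ)ˣ (GL (Fin 2) F)).comp
      (Units.map (Matrix.transposeRingEquiv (Fin 2) F).toRingHom.toMonoidHom))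

/-- The action of the third factor. -/
def inclThd : (Mat F)ˣ →* PairGroup F :=
  (MonoidHom.inr (Mat F)ˣ (((Mat F)ᵐᵒᵖ)ˣ × GL (Fin 2) F)).comp
    (MonoidHom.inr ((Mat F)ᵐᵒᵖ)ˣ (GL (Fin 2) F))

theorem smul_eq_of_scalar {g : PairGroup F} {a b c : F} (h1 : g.g11 = a • 1) (h2 : g.g12 = b • 1)
    (h3 : g.g2 = c • 1) (x : PairSpace F) :
    g • x = (((a * b * c) • x.1, (a * b * c) • x.2) : Mat F × Mat F) := by
  have e1 : g.g2 0 0 = c ∧ g.g2 0 1 = 0 ∧ g.g2 1 0 = 0 ∧ g.g2 1 1 = c := by simp [h3]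
  rw [smul_def, h1, h2, e1.1, e1.2.1, e1.2.2.1, e1.2.2.2]
  have key (y z : Mat F) : (a • (1 : Mat F)) * (c • y + (0 : F) • z) * (b • 1) =
      (a * b * c) • y := by
    rw [zero_smul, add_zero, Matrix.smul_mul, Matrix.mul_smul, one_mul, mul_one, smul_smul,
      smul_smul]
    congr 1
    ring
  refine PairSpace.ext' (key x.1 x.2) ?_
  refine Eq.trans ?_ (key x.2 x.1)
  rw [add_comm (c • (x.2 : Mat F))]

theorem inclFst_scalar_smul (a : Fˣ) (x : PairSpace F) : inclFst (scalarGL a) • x =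
    (((a : F) • x.1, (a : F) • x.2) : Mat F × Mat F) := by
  have h := smul_eq_of_scalar (g := inclFst (scalarGL a)) (b := 1) (c := 1) (scalarGL_val a)
    (one_smul _ _).symm (one_smul _ _).symm x
  rwa [mul_one, mul_one] at h

theorem inclSnd_scalar_smul (a : Fˣ) (x : PairSpace F) : inclSnd (scalarGL a) • x =
    (((a : F) • x.1, (a : F) • x.2) : Mat F × Mat F) := by
  have h12 : (inclSnd (scalarGL a)).g12 = (a : F) • 1 := by
    change ((scalarGL a : (Mat F)ˣ) : Mat F)ᵀ = _
    rw [scalarGL_val, Matrix.transpose_smul, Matrix.transpose_one]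
  have h := smul_eq_of_scalar (g := inclSnd (scalarGL a)) (a := 1) (c := 1)
    (one_smul _ _).symm h12 (one_smul _ _).symm x
  rwa [mul_one, one_mul] at h

theorem inclThd_scalar_smul (a : Fˣ) (x : PairSpace F) : inclThd (scalarGL a) • x =
    (((a : F) • x.1, (a : F) • x.2) : Mat F × Mat F) := by
  have h := smul_eq_of_scalar (g := inclThd (scalarGL a)) (a := 1) (b := 1)
    (one_smul _ _).symm (one_smul _ _).symm (scalarGL_val a) x
  rwa [mul_one, one_mul] at h

theorem exists_eq_incl (g : PairGroup F) : ∃ a b c : (Mat F)ˣ,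
    g = inclFst a * inclSnd b * inclThd c ∧ (a : Mat F).det = g.g11.det ∧
      (b : Mat F).det = g.g12.det ∧ (c : Mat F).det = g.g2.det := by
  let b : (Mat F)ˣ := ⟨g.g12ᵀ, (g⁻¹).g12ᵀ,
    by rw [← Matrix.transpose_mul, ← g12_mul, mul_inv_cancel, g12_one, Matrix.transpose_one],
    by rw [← Matrix.transpose_mul, ← g12_mul, inv_mul_cancel, g12_one, Matrix.transpose_one]⟩
  refine ⟨g.1, b, g.2.2, PairGroup.ext' ?_ ?_ ?_, rfl, Matrix.det_transpose _, rfl⟩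
  · rw [g11_mul, g11_mul]
    change g.g11 = g.g11 * 1 * 1
    simp
  · rw [g12_mul, g12_mul]
    change g.g12 = 1 * (g.g12ᵀᵀ * 1)
    simp
  · rw [g2_mul, g2_mul]
    change g.g2 = 1 * 1 * g.g2
    simp

end

variable {k : Type*} [Field k] [NumberField k] (v : HeightOneSpectrum (𝓞 k))

theorem two_ne_zero_Kv : (2 : Kv v) ≠ 0 := by
  have : CharZero (Kv v) := charZero_of_injective_algebraMap (algebraMap k (Kv v)).injective
  exact two_ne_zero

/-- The coordinates of a pair of matrices. -/
def pairCoord : PairSpace (Kv v) ≃+ (Fin 2 × Fin 2 × Fin 2 → Kv v) where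
  toFun x p := (if p.1 = 0 then x.1 else x.2) p.2.1 p.2.2
  invFun f := ((Matrix.of fun i j => f (0, i, j), Matrix.of fun i j => f (1, i, j)) :
    Mat (Kv v) × Mat (Kv v))
  left_inv x := rfl
  right_inv f := by
    funext ⟨l, i, j⟩
    fin_cases l <;> rfl
  map_add' x y := by
    funext ⟨l, i, j⟩
    fin_cases l <;> rfl

theorem continuous_pairCoord : Continuous (pairCoord v) := by
  refine continuous_pi fun ⟨l, i, j⟩ => ?_
  fin_cases l
  · exact PairSpace.continuous_fst.matrix_elem i j
  · exact PairSpace.continuous_snd.matrix_elem i j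

theorem continuous_pairCoord_symm : Continuous (pairCoord v).symm :=
  PairSpace.continuous_mk
    (continuous_matrix fun i j => continuous_apply ((0, i, j) : Fin 2 × Fin 2 × Fin 2))
    (continuous_matrix fun i j => continuous_apply ((1, i, j) : Fin 2 × Fin 2 × Fin 2))

/-- The character `‖det‖ⁿ` of `GL(2)`. -/
def normDet (n : ℕ) : (Mat (Kv v))ˣ →* ℝ≥0 where
  toFun a := ‖(a : Mat (Kv v)).det‖₊ ^ n
  map_one' := by simp
  map_mul' a b := by rw [Units.val_mul, Matrix.det_mul, nnnorm_mul, mul_pow]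

theorem normDet_apply (n : ℕ) (a : (Mat (Kv v))ˣ) :
    normDet v n a = ‖(a : Mat (Kv v)).det‖₊ ^ n := rfl

/-- A homomorphism from `GL(2)` under which the scalars act as scalars on `k_v^(2n)` scales Haar
measure by `|det|^n`. -/
theorem distribHaarChar_eq_normDet {W Γ ι : Type*} [AddCommGroup W] [TopologicalSpace W]
    [IsTopologicalAddGroup W] [LocallyCompactSpace W] [Group Γ] [DistribMulAction Γ W]
    [ContinuousConstSMul Γ W] [Fintype ι] (j : (Mat (Kv v))ˣ →* Γ) (e : W ≃+ (ι → Kv v))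
    (he : Continuous e) (he' : Continuous e.symm)
    (hj : ∀ a w, e (j (scalarGL a) • w) = (a : Kv v) • e w) {n : ℕ}
    (hn : Fintype.card ι = 2 * n) (g : (Mat (Kv v))ˣ) :
    distribHaarChar W (j g) = ‖(g : Mat (Kv v)).det‖₊ ^ n := by
  rw [← normDet_apply]
  refine DFunLike.congr_fun (char_eq_of_scalar (two_ne_zero_Kv v)
    ((distribHaarChar W).comp j) (normDet v n) fun a => ?_) g
  have h := distribHaarChar_scalar v (j.comp scalarGL) e he he' hj a
  rw [hn] at h
  rw [normDet_apply, scalarGL_val, Matrix.det_smul, Matrix.det_one, Fintype.card_fin, mul_one,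
    nnnorm_pow, ← pow_mul]
  exact h

theorem distribHaarChar_pairSpace (g : PairGroup (Kv v)) :
    distribHaarChar (PairSpace (Kv v)) g = ‖g.g11.det * g.g12.det * g.g2.det‖₊ ^ 4 := by
  have key (j : (Mat (Kv v))ˣ →* PairGroup (Kv v))
      (hj : ∀ (a : (Kv v)ˣ) (x : PairSpace (Kv v)), j (scalarGL a) • x =
        (((a : Kv v) • x.1, (a : Kv v) • x.2) : Mat (Kv v) × Mat (Kv v)))
      (g : (Mat (Kv v))ˣ) :
      distribHaarChar (PairSpace (Kv v)) (j g) = ‖(g : Mat (Kv v)).det‖₊ ^ 4 := by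
    refine distribHaarChar_eq_normDet v j (pairCoord v) (continuous_pairCoord v)
      (continuous_pairCoord_symm v) (fun a x => ?_) (by simp) g
    rw [hj]
    funext ⟨l, i, j⟩
    fin_cases l <;> rfl
  obtain ⟨a, b, c, hg, ha, hb, hc⟩ := exists_eq_incl g
  rw [hg, map_mul, map_mul, key inclFst inclFst_scalar_smul, key inclSnd inclSnd_scalar_smul,
    key inclThd inclThd_scalar_smul, ← hg, nnnorm_mul, nnnorm_mul, mul_pow, mul_pow, ha, hb, hc]

/-- The density `|P(y)|⁻²`. -/
def discDensity (y : PairSpace (Kv v)) : ℝ≥0∞ := ENNReal.ofReal (‖disc y‖ ^ 2)⁻¹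

theorem measurable_discDensity : Measurable (discDensity v) :=
  ((continuous_disc.norm.pow 2).measurable.inv).ennreal_ofReal

/-- The measure `|P(y)|⁻² dy` on the orbit of `x`. -/
def orbitNu (x : PairSpace (Kv v)) : Measure (PairSpace (Kv v)) :=
  ((haarV v).restrict (MulAction.orbit (PairGroup (Kv v)) x)).withDensity (discDensity v)

theorem map_smul_haarV (g : PairGroup (Kv v)) : (haarV v).map (g • ·) =
    (distribHaarChar (PairSpace (Kv v)) g⁻¹ : ℝ≥0∞) • haarV v := by
  ext A hA
  rw [Measure.map_apply (measurable_const_smul g) hA, Measure.smul_apply, smul_eq_mul,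
    distribHaarChar_mul, ← Set.preimage_smul_inv, inv_inv]

theorem discDensity_smul (g : PairGroup (Kv v)) (y : PairSpace (Kv v)) :
    discDensity v y = distribHaarChar (PairSpace (Kv v)) g * discDensity v (g • y) := by
  have hd : g.g11.det * g.g12.det * g.g2.det ≠ 0 :=
    mul_ne_zero (mul_ne_zero (isUnit_det_g11 g).ne_zero (isUnit_det_g12 g).ne_zero)
      (isUnit_det_g2 g).ne_zero
  rw [discDensity, discDensity, disc_smul, distribHaarChar_pairSpace,
    ← ENNReal.ofReal_coe_nnreal, ← ENNReal.ofReal_mul (NNReal.coe_nonneg _)]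
  congr 1
  have hd' := norm_ne_zero_iff.2 hd
  rw [NNReal.coe_pow, coe_nnnorm, norm_mul (_ ^ 2), norm_pow]
  generalize ‖g.g11.det * g.g12.det * g.g2.det‖ = r at hd'
  rw [mul_pow, mul_inv, ← pow_mul, ← mul_assoc, mul_inv_cancel₀ (pow_ne_zero _ hd'), one_mul]

theorem map_smul_orbitNu (x : PairSpace (Kv v)) (hO : MeasurableSet (MulAction.orbit (PairGroup (Kv v)) x))
    (g : PairGroup (Kv v)) : (orbitNu v x).map (g • ·) = orbitNu v x := by
  have hd := measurable_discDensity v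
  have hg : Measurable fun y : PairSpace (Kv v) => g • y := measurable_const_smul g
  have hν (f : PairSpace (Kv v) → ℝ≥0∞) (hf : Measurable f) : ∫⁻ y, f y ∂(orbitNu v x) =
      ∫⁻ y, (MulAction.orbit (PairGroup (Kv v)) x).indicator (discDensity v * f) y ∂(haarV v) := by
    rw [orbitNu, lintegral_withDensity_eq_lintegral_mul _ hd hf, lintegral_indicator hO]
  refine Measure.ext_of_lintegral _ fun f hf => ?_
  rw [lintegral_map hf hg, hν (fun y => f (g • y)) (hf.comp hg), hν f hf]
  set Φ := (MulAction.orbit (PairGroup (Kv v)) x).indicator (discDensity v * f) with hΦ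
  have hΦm : Measurable Φ := (hd.mul hf).indicator hO
  have h1 : (MulAction.orbit (PairGroup (Kv v)) x).indicator
      (discDensity v * fun y => f (g • y)) =
      fun y => (distribHaarChar (PairSpace (Kv v)) g : ℝ≥0∞) * Φ (g • y) := by
    funext y
    have hiff : g • y ∈ MulAction.orbit (PairGroup (Kv v)) x ↔
        y ∈ MulAction.orbit (PairGroup (Kv v)) x := by
      rw [← MulAction.orbit_eq_iff, MulAction.orbit_smul, MulAction.orbit_eq_iff]
    by_cases hy : y ∈ MulAction.orbit (PairGroup (Kv v)) x
    · rw [hΦ, Set.indicator_of_mem hy, Set.indicator_of_mem (hiff.2 hy), Pi.mul_apply,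
        Pi.mul_apply, ← mul_assoc, ← discDensity_smul]
    · rw [hΦ, Set.indicator_of_notMem hy, Set.indicator_of_notMem (mt hiff.1 hy), mul_zero]
  rw [h1]
  change ∫⁻ y, _ * (Φ ∘ fun y => g • y) y ∂_ = _
  rw [lintegral_const_mul _ (hΦm.comp hg)]
  change _ * ∫⁻ y, Φ (g • y) ∂_ = _
  rw [← lintegral_map hΦm hg, map_smul_haarV,
    lintegral_smul_measure, smul_eq_mul, ← mul_assoc, ← ENNReal.coe_mul, ← map_mul,
    mul_inv_cancel, map_one, ENNReal.coe_one, one_mul]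

theorem ae_mem_orbitNu (x : PairSpace (Kv v)) (hO : MeasurableSet (MulAction.orbit (PairGroup (Kv v)) x)) :
    ∀ᵐ y ∂(orbitNu v x), y ∈ MulAction.orbit (PairGroup (Kv v)) x :=
  (withDensity_absolutelyContinuous _ _).ae_le (ae_restrict_mem hO)

end InvariantMeasure

/-! ### The group is unimodular -/

section Unimodular

open scoped NNReal

theorem modularCharacter_of_central {Γ : Type*} [Group Γ] [TopologicalSpace Γ]
    [IsTopologicalGroup Γ] [LocallyCompactSpace Γ] [PolishSpace Γ]
    {z : Γ} (hz : ∀ g, g * z = z * g) :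
    Measure.modularCharacter z = 1 := by
  borelize Γ
  let μ : Measure Γ := Measure.haar
  have h := Measure.map_right_mul_eq_modularCharacterFun_smul μ z
  rw [show (· * z) = (z * ·) from funext hz, map_mul_left_eq_self] at h
  let C : TopologicalSpace.PositiveCompacts Γ := Classical.arbitrary _
  have hC := congrArg (fun m : Measure Γ => m C) h
  have h0 : μ C ≠ 0 := (Measure.measure_pos_of_nonempty_interior μ C.interior_nonempty).ne'
  have htop : μ C ≠ ∞ := C.isCompact.measure_lt_top.ne
  have h1 : (Measure.modularCharacterFun z : ℝ≥0∞) * μ C = 1 * μ C := by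
    rw [one_mul]
    exact hC.symm
  exact_mod_cast (ENNReal.mul_left_inj h0 htop).1 h1

variable {k : Type*} [Field k] [NumberField k] (v : HeightOneSpectrum (𝓞 k))

theorem scalarGL_comm {F : Type*} [Field F] (a : Fˣ) (b : Mat F) :
    b * ((scalarGL a : (Mat F)ˣ) : Mat F) = ((scalarGL a : (Mat F)ˣ) : Mat F) * b := by
  rw [scalarGL_val, Matrix.mul_smul, Matrix.smul_mul, one_mul, mul_one]

theorem modularCharacter_pairGroup (g : PairGroup (Kv v)) : Measure.modularCharacter g = 1 := by
  have key (j : (Mat (Kv v))ˣ →* PairGroup (Kv v))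
      (hj : ∀ (a : (Kv v)ˣ) (g : PairGroup (Kv v)), g * j (scalarGL a) = j (scalarGL a) * g)
      (b : (Mat (Kv v))ˣ) : Measure.modularCharacter (j b) = 1 :=
    DFunLike.congr_fun (char_eq_of_scalar (two_ne_zero_Kv v) (Measure.modularCharacter.comp j) 1
      fun a => modularCharacter_of_central (hj a)) b
  obtain ⟨a, b, c, hg, -⟩ := exists_eq_incl g
  rw [hg, map_mul, map_mul, key inclFst, key inclSnd, key inclThd, one_mul, one_mul]
  · refine fun a g => PairGroup.ext' ?_ ?_ (scalarGL_comm a g.g2)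
    · exact (mul_one _).trans (one_mul _).symm
    · exact (one_mul _).trans (mul_one _).symm
  · refine fun a g => PairGroup.ext' ?_ ?_ ?_
    · exact (mul_one _).trans (one_mul _).symm
    · change ((scalarGL a : (Mat (Kv v))ˣ) : Mat (Kv v))ᵀ * g.g12 =
        g.g12 * ((scalarGL a : (Mat (Kv v))ˣ) : Mat (Kv v))ᵀ
      rw [scalarGL_val, Matrix.transpose_smul, Matrix.transpose_one, Matrix.mul_smul,
        Matrix.smul_mul, one_mul, mul_one]
    · exact (mul_one _).trans (one_mul _).symm
  · refine fun a g => PairGroup.ext' (scalarGL_comm a g.g11) ?_ ?_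
    · exact (one_mul _).trans (mul_one _).symm
    · exact (mul_one _).trans (one_mul _).symm

instance : (haarG v).IsMulRightInvariant := by
  refine ⟨fun g => ?_⟩
  rw [Measure.map_right_mul_eq_modularCharacterFun_smul]
  have h : Measure.modularCharacterFun g = 1 := modularCharacter_pairGroup v g
  rw [h, one_smul]

theorem haarG_conj (g : PairGroup (Kv v)) (A : Set (PairGroup (Kv v))) :
    haarG v ((fun x => g * x * g⁻¹) ⁻¹' A) = haarG v A := by
  rw [show (fun x => g * x * g⁻¹) ⁻¹' A = (g * ·) ⁻¹' ((· * g⁻¹) ⁻¹' A) from rfl,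
    measure_preimage_mul, measure_preimage_mul_right]

end Unimodular

/-! ### The index of a congruence subgroup of a unit group -/

section UnitIndex

set_option linter.unusedSectionVars false

variable {E G S : Type*} [Ring E] [Group G] [Ring S] (ι : G →* E) (R : Subring E) {z : E}

/-- The elements of `G` which become units of the subring `R`. -/
def unitSubgroup : Subgroup G where
  carrier := {g | ι g ∈ R ∧ ι g⁻¹ ∈ R}
  one_mem' := by simp [one_mem]
  mul_mem' ha hb := ⟨by rw [map_mul]; exact mul_mem ha.1 hb.1,
    by rw [mul_inv_rev, map_mul]; exact mul_mem hb.2 ha.2⟩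
  inv_mem' ha := ⟨ha.2, by rw [inv_inv]; exact ha.1⟩

/-- The additive group `zⁿ R`. -/
def scaled (z : E) (n : ℕ) : AddSubgroup E := R.toAddSubgroup.map (AddMonoidHom.mulLeft (z ^ n))

variable {R} in
theorem mem_scaled {n : ℕ} {a : E} : a ∈ scaled R z n ↔ ∃ r ∈ R, z ^ n * r = a := Iff.rfl

variable {R} in
theorem mul_mem_scaled (hz : ∀ a, z * a = a * z) {n : ℕ} {a r : E} (ha : a ∈ scaled R z n)
    (hr : r ∈ R) : a * r ∈ scaled R z n ∧ r * a ∈ scaled R z n := by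
  obtain ⟨s, hs, rfl⟩ := mem_scaled.1 ha
  have hzn : r * z ^ n = z ^ n * r := (Commute.pow_left (hz r) n).symm
  exact ⟨⟨s * r, R.mul_mem hs hr, (mul_assoc _ _ _).symm⟩,
    ⟨r * s, R.mul_mem hr hs, by
      change z ^ n * (r * s) = r * (z ^ n * s)
      rw [← mul_assoc, ← mul_assoc, hzn]⟩⟩

/-- The units of `R` that are congruent to `1` modulo `zⁿ`. -/
def congrSubgroup (hz : ∀ a, z * a = a * z) (n : ℕ) : Subgroup G where
  carrier := {g | g ∈ unitSubgroup ι R ∧ ι g - 1 ∈ scaled R z n}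
  one_mem' := ⟨one_mem _, by rw [map_one, sub_self]; exact zero_mem _⟩
  mul_mem' {a b} ha hb := ⟨mul_mem ha.1 hb.1, by
    have h : ι (a * b) - 1 = (ι a - 1) * ι b + (ι b - 1) := by
      rw [map_mul]
      noncomm_ring
    rw [h]
    exact add_mem (mul_mem_scaled hz ha.2 hb.1.1).1 hb.2⟩
  inv_mem' {a} ha := ⟨inv_mem ha.1, by
    have h : ι a⁻¹ - 1 = -(ι a⁻¹ * (ι a - 1)) := by
      rw [mul_sub, ← map_mul, inv_mul_cancel, map_one]
      noncomm_ring
    rw [h]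
    exact neg_mem (mul_mem_scaled hz ha.2 ha.1.2).2⟩

variable (hz : ∀ a, z * a = a * z) (f : R →+* S)

theorem congrSubgroup_le (n : ℕ) : congrSubgroup ι R hz n ≤ unitSubgroup ι R := fun _ h => h.1

theorem scaled_succ (n : ℕ) :
    scaled R z (n + 1) = (scaled R z n).map (AddMonoidHom.mulLeft z) := by
  rw [scaled, scaled, AddSubgroup.map_map]
  congr 1
  ext a
  simp [pow_succ', mul_assoc]

theorem scaled_zero : scaled R z 0 = R.toAddSubgroup := by
  ext a
  simp [scaled]

variable {R} in
theorem scaled_succ_le (hzR : z ∈ R) (n : ℕ) : scaled R z (n + 1) ≤ scaled R z n := by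
  rintro _ ⟨r, hr, rfl⟩
  exact ⟨z * r, R.mul_mem hzR hr, by
    change z ^ n * (z * r) = z ^ (n + 1) * r
    rw [pow_succ, mul_assoc]⟩

variable (hf : Function.Surjective f) (hker : ∀ r : R, f r = 0 ↔ (r : E) ∈ scaled R z 1)
  (hz0 : ∀ a, z * a = 0 → a = 0) (hzR : z ∈ R)

include hf hker in
theorem relIndex_scaled_one : (scaled R z 1).relIndex R.toAddSubgroup = Nat.card S := by
  have h : (scaled R z 1).addSubgroupOf R.toAddSubgroup = f.toAddMonoidHom.ker := by
    ext r
    exact (hker r).symm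
  rw [AddSubgroup.relIndex, h]
  refine (AddSubgroup.index_ker f.toAddMonoidHom).trans ?_
  rw [AddMonoidHom.range_eq_top.2 hf]
  exact AddSubgroup.card_top

include hf hker hz0 in
theorem relIndex_scaled_succ (n : ℕ) :
    (scaled R z (n + 1)).relIndex (scaled R z n) = Nat.card S := by
  induction n with
  | zero => rw [scaled_zero, zero_add, relIndex_scaled_one R f hf hker]
  | succ n ih =>
    rw [scaled_succ R (n + 1), scaled_succ R n, AddSubgroup.relIndex_map_map_of_injective, ← scaled_succ,
      ih]
    exact (injective_iff_map_eq_zero _).2 hz0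

include hf hker hz0 hzR in
theorem relIndex_scaled_one_right (n : ℕ) :
    (scaled R z (n + 1)).relIndex (scaled R z 1) = Nat.card S ^ n := by
  induction n with
  | zero => rw [zero_add, AddSubgroup.relIndex_self, pow_zero]
  | succ n ih =>
    have hle : scaled R z (n + 1) ≤ scaled R z 1 := by
      clear ih
      induction n with
      | zero => exact le_rfl
      | succ n ih => exact (scaled_succ_le hzR _).trans ih
    rw [← AddSubgroup.relIndex_mul_relIndex _ _ _ (scaled_succ_le hzR (n + 1)) hle, ih,
      relIndex_scaled_succ R f hf hker hz0, pow_succ']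

/-- Reduction of units. -/
def unitReduction : unitSubgroup ι R →* Sˣ where
  toFun g := ⟨f ⟨ι g, g.2.1⟩, f ⟨ι (g : G)⁻¹, g.2.2⟩,
    by rw [← map_mul, ← map_one f]; congr 1; ext1; simp [← map_mul],
    by rw [← map_mul, ← map_one f]; congr 1; ext1; simp [← map_mul]⟩
  map_one' := by
    ext1
    change f _ = 1
    rw [← map_one f]
    congr 1
    ext1
    exact map_one ι
  map_mul' a b := by
    ext1
    change f _ = f _ * f _
    rw [← map_mul f]
    congr 1
    ext1
    exact map_mul ι _ _

variable (hunit : ∀ r : R, IsUnit (f r) → ∃ g ∈ unitSubgroup ι R, ι g = r)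

include hf hker hunit in
theorem relIndex_congrSubgroup_one :
    (congrSubgroup ι R hz 1).relIndex (unitSubgroup ι R) = Nat.card Sˣ := by
  have h : (congrSubgroup ι R hz 1).subgroupOf (unitSubgroup ι R) = (unitReduction ι R f).ker := by
    ext g
    have h1 : unitReduction ι R f g = 1 ↔ f (⟨ι g, g.2.1⟩ - 1) = 0 := by
      rw [map_sub, map_one, sub_eq_zero]
      exact Units.ext_iff
    rw [MonoidHom.mem_ker, h1, hker]
    exact ⟨fun h => h.2, fun h => ⟨g.2, h⟩⟩
  have hs : Function.Surjective (unitReduction ι R f) := by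
    intro s
    obtain ⟨r, hr⟩ := hf s
    obtain ⟨g, hg, hgr⟩ := hunit r (by rw [hr]; exact s.isUnit)
    refine ⟨⟨g, hg⟩, Units.ext ?_⟩
    rw [← hr]
    exact congrArg f (Subtype.ext hgr)
  rw [Subgroup.relIndex, h, Subgroup.index_ker, MonoidHom.range_eq_top.2 hs, Subgroup.card_top]

variable (hι : Function.Injective ι)

include hι hker hunit hzR in
theorem relIndex_congrSubgroup_succ (n : ℕ) :
    (congrSubgroup ι R hz (n + 1)).relIndex (congrSubgroup ι R hz 1) =
      (scaled R z (n + 1)).relIndex (scaled R z 1) := by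
  have hex (a : E) (ha : a ∈ scaled R z 1) : ∃ g ∈ unitSubgroup ι R, ι g = 1 + a := by
    have haR : a ∈ R := by
      have := scaled_succ_le hzR 0 ha
      rwa [scaled_zero] at this
    refine hunit (1 + ⟨a, haR⟩) ?_
    rw [map_add, map_one, (hker ⟨a, haR⟩).2 ha, add_zero]
    exact isUnit_one
  let e : congrSubgroup ι R hz 1 ≃ scaled R z 1 := Equiv.ofBijective
    (fun g => ⟨ι g - 1, g.2.2⟩) ⟨fun g g' h => Subtype.ext (hι (by
      simpa using congrArg Subtype.val h)), fun a => by
        obtain ⟨g, hg, hga⟩ := hex a a.2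
        have hga' : ι g - 1 = a := by rw [hga, add_sub_cancel_left]
        exact ⟨⟨g, hg, by rw [hga']; exact a.2⟩, Subtype.ext hga'⟩⟩
  refine Nat.card_congr (Quotient.congr e fun a b => ?_)
  rw [QuotientGroup.leftRel_apply, QuotientAddGroup.leftRel_apply]
  have h1 : ι ((a : G)⁻¹ * b) - 1 = ι (a : G)⁻¹ * (ι b - ι a) := by
    rw [mul_sub, ← map_mul, ← map_mul, inv_mul_cancel, map_one]
  have h2 : ι b - ι a = ι a * (ι ((a : G)⁻¹ * b) - 1) := by
    rw [h1, ← mul_assoc, ← map_mul, mul_inv_cancel, map_one, one_mul]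
  have h3 : ((-e a + e b : scaled R z 1) : E) = ι b - ι a := by
    change -(ι a - 1) + (ι b - 1) = _
    noncomm_ring
  rw [Subgroup.mem_subgroupOf, AddSubgroup.mem_addSubgroupOf, h3]
  constructor
  · intro h
    rw [h2]
    exact (mul_mem_scaled hz h.2 a.2.1.1).2
  · intro h
    refine ⟨(a⁻¹ * b : congrSubgroup ι R hz 1).2.1, ?_⟩
    change ι ((a : G)⁻¹ * b) - 1 ∈ _
    rw [h1]
    exact (mul_mem_scaled hz h a.2.1.2).2

include hf hker hunit hι hzR hz0 in
/-- The index in `Rˣ` of the units congruent to `1` modulo `zⁿ⁺¹`. -/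
theorem relIndex_congrSubgroup (n : ℕ) :
    (congrSubgroup ι R hz (n + 1)).relIndex (unitSubgroup ι R) =
      Nat.card S ^ n * Nat.card Sˣ := by
  have hle : congrSubgroup ι R hz (n + 1) ≤ congrSubgroup ι R hz 1 := fun g hg => ⟨hg.1, by
    have h : ∀ m, scaled R z (m + 1) ≤ scaled R z 1 := fun m => by
      induction m with
      | zero => exact le_rfl
      | succ m ih => exact (scaled_succ_le hzR _).trans ih
    exact h n hg.2⟩
  rw [← Subgroup.relIndex_mul_relIndex _ _ _ hle (congrSubgroup_le ι R hz 1),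
    relIndex_congrSubgroup_one ι R hz f hf hker hunit,
    relIndex_congrSubgroup_succ ι R hz f hker hzR hunit hι,
    relIndex_scaled_one_right R f hf hker hz0 hzR]

end UnitIndex

/-! ### The congruence subgroups of `GL(2)_𝒪 × GL(2)_𝒪 × GL(2)_𝒪` -/

section Congruence

open NumberField NumberField.HeightOneSpectrum

variable {k : Type*} [Field k] [NumberField k] (v : HeightOneSpectrum (𝓞 k))

/-- The ring of integral matrices. -/
def intSubring : Subring (Mat (Kv v)) where
  carrier := intMat v
  zero_mem' _ _ := zero_mem _
  one_mem' := one_mem_intMat v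
  add_mem' ha hb i j := add_mem (ha i j) (hb i j)
  neg_mem' ha i j := neg_mem (ha i j)
  mul_mem' := mul_mem_intMat v

/-- The residue field of `k_v`. -/
abbrev Res := IsLocalRing.ResidueField (Ov v)

/-- Reduction of integral matrices. -/
def matRed : intSubring v →+* Mat (Res v) where
  toFun a := Matrix.of fun i j => IsLocalRing.residue (Ov v) ⟨a.1 i j, a.2 i j⟩
  map_zero' := by
    ext i j
    exact map_zero (IsLocalRing.residue (Ov v))
  map_one' := by
    ext i j
    fin_cases i <;> fin_cases j
    · exact map_one (IsLocalRing.residue (Ov v))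
    · exact map_zero (IsLocalRing.residue (Ov v))
    · exact map_zero (IsLocalRing.residue (Ov v))
    · exact map_one (IsLocalRing.residue (Ov v))
  map_add' a b := by
    ext i j
    exact map_add (IsLocalRing.residue (Ov v)) ⟨a.1 i j, a.2 i j⟩ ⟨b.1 i j, b.2 i j⟩
  map_mul' a b := by
    ext i j
    rw [Matrix.mul_apply, Fin.sum_univ_two, Matrix.of_apply]
    simp only [Matrix.of_apply, ← map_mul, ← map_add]
    congr 1
    ext1
    exact (Matrix.mul_apply ..).trans (Fin.sum_univ_two _)

theorem matRed_apply (a : intSubring v) (i j : Fin 2) :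
    matRed v a i j = IsLocalRing.residue (Ov v) ⟨a.1 i j, a.2 i j⟩ := rfl

theorem matRed_surjective : Function.Surjective (matRed v) := by
  intro s
  choose x hx using fun i j => IsLocalRing.residue_surjective (s i j)
  exact ⟨⟨Matrix.of fun i j => (x i j : Kv v), fun i j => (x i j).2⟩,
    Matrix.ext fun i j => hx i j⟩

theorem residue_eq_zero_iff' (x : Ov v) :
    IsLocalRing.residue (Ov v) x = 0 ↔ (unif v : Kv v)⁻¹ * x ∈ Ov v := by
  rw [IsLocalRing.residue_eq_zero_iff, ← mem_Ov_unif_iff]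
  exact ⟨fun h => ⟨x.2, h⟩, fun ⟨_, h⟩ => h⟩

theorem det_mem_of_intMat {a : Mat (Kv v)} (ha : a ∈ intMat v) : a.det ∈ Ov v := by
  rw [Matrix.det_fin_two]
  exact sub_mem (mul_mem (ha _ _) (ha _ _)) (mul_mem (ha _ _) (ha _ _))

theorem inv_mem_intMat {a : Mat (Kv v)} (ha : a ∈ intMat v) (hdet : ‖a.det‖ = 1) :
    a⁻¹ ∈ intMat v := by
  have hd : a.det⁻¹ ∈ Ov v := by
    rw [← norm_le_one_iff, norm_inv, hdet, inv_one]
  rw [Matrix.inv_def, Ring.inverse_eq_inv']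
  intro i j
  rw [Matrix.smul_apply]
  refine mul_mem hd ?_
  rw [Matrix.adjugate_fin_two]
  fin_cases i <;> fin_cases j
  · exact ha _ _
  · exact neg_mem (ha _ _)
  · exact neg_mem (ha _ _)
  · exact ha _ _

theorem exists_unit_of_isUnit_matRed (a : intSubring v) (h : IsUnit (matRed v a)) :
    ∃ t : (Mat (Kv v))ˣ, (t : Mat (Kv v)) = a ∧ ((t⁻¹ : (Mat (Kv v))ˣ) : Mat (Kv v)) ∈ intMat v := by
  let d : Ov v := ⟨(a : Mat (Kv v)).det, det_mem_of_intMat v a.2⟩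
  have h1 : (matRed v a).det = IsLocalRing.residue (Ov v) d := by
    rw [Matrix.det_fin_two]
    simp only [matRed_apply, ← map_mul, ← map_sub]
    congr 1
    ext1
    exact (Matrix.det_fin_two _).symm
  have h3 : IsLocalRing.residue (Ov v) d ≠ 0 := by
    rw [← h1]
    exact ((Matrix.isUnit_iff_isUnit_det _).1 h).ne_zero
  have h2 : ‖(d : Kv v)‖ = 1 :=
    (isUnit_iff_norm_eq_one v d).1 ((IsLocalRing.residue_ne_zero_iff_isUnit d).1 h3)
  change ‖(a : Mat (Kv v)).det‖ = 1 at h2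
  have h4 : (a : Mat (Kv v)).det ≠ 0 := norm_ne_zero_iff.1 (by rw [h2]; exact one_ne_zero)
  exact ⟨⟨a, (a : Mat (Kv v))⁻¹, Matrix.mul_nonsing_inv _ h4.isUnit,
    Matrix.nonsing_inv_mul _ h4.isUnit⟩, rfl, inv_mem_intMat v a.2 h2⟩

/-- The algebra in which the elements of `G` are units. -/
abbrev PairAlg := Mat (Kv v) × (Mat (Kv v))ᵐᵒᵖ × Mat (Kv v)

/-- The inclusion of `G` in the algebra `M(2,2) × M(2,2)ᵒᵖ × M(2,2)`. -/
def pairIncl : PairGroup (Kv v) →* PairAlg v :=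
  MonoidHom.prodMap (Units.coeHom _) (MonoidHom.prodMap (Units.coeHom _) (Units.coeHom _))

theorem pairIncl_injective : Function.Injective (pairIncl v) := fun _ _ h =>
  Prod.ext (Units.ext (congrArg Prod.fst h)) (Prod.ext
    (Units.ext (congrArg (fun x => x.2.1) h)) (Units.ext (congrArg (fun x => x.2.2) h)))

/-- The integral elements of `M(2,2) × M(2,2)ᵒᵖ × M(2,2)`. -/
def pairSubring : Subring (PairAlg v) where
  carrier := {x | x.1 ∈ intMat v ∧ x.2.1.unop ∈ intMat v ∧ x.2.2 ∈ intMat v}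
  zero_mem' := ⟨(intSubring v).zero_mem, (intSubring v).zero_mem, (intSubring v).zero_mem⟩
  one_mem' := ⟨(intSubring v).one_mem, (intSubring v).one_mem, (intSubring v).one_mem⟩
  add_mem' ha hb := ⟨(intSubring v).add_mem ha.1 hb.1, (intSubring v).add_mem ha.2.1 hb.2.1,
    (intSubring v).add_mem ha.2.2 hb.2.2⟩
  neg_mem' ha := ⟨(intSubring v).neg_mem ha.1, (intSubring v).neg_mem ha.2.1,
    (intSubring v).neg_mem ha.2.2⟩
  mul_mem' ha hb := ⟨(intSubring v).mul_mem ha.1 hb.1, (intSubring v).mul_mem hb.2.1 ha.2.1,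
    (intSubring v).mul_mem ha.2.2 hb.2.2⟩

/-- The first component. -/
def pairFst : pairSubring v →+* intSubring v where
  toFun x := ⟨x.1.1, x.2.1⟩
  map_zero' := rfl
  map_one' := rfl
  map_add' _ _ := rfl
  map_mul' _ _ := rfl

/-- The second component. -/
def pairSnd : pairSubring v →+* (intSubring v)ᵐᵒᵖ where
  toFun x := MulOpposite.op ⟨x.1.2.1.unop, x.2.2.1⟩
  map_zero' := rfl
  map_one' := rfl
  map_add' _ _ := rfl
  map_mul' _ _ := rfl

/-- The third component. -/
def pairThd : pairSubring v →+* intSubring v where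
  toFun x := ⟨x.1.2.2, x.2.2.2⟩
  map_zero' := rfl
  map_one' := rfl
  map_add' _ _ := rfl
  map_mul' _ _ := rfl

/-- Reduction of integral elements of `M(2,2) × M(2,2)ᵒᵖ × M(2,2)`. -/
def pairRed : pairSubring v →+* Mat (Res v) × (Mat (Res v))ᵐᵒᵖ × Mat (Res v) :=
  ((matRed v).comp (pairFst v)).prod (((RingHom.op (matRed v)).comp (pairSnd v)).prod
    ((matRed v).comp (pairThd v)))

theorem pairRed_surjective : Function.Surjective (pairRed v) := by
  rintro ⟨a, b, c⟩
  obtain ⟨a', rfl⟩ := matRed_surjective v a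
  obtain ⟨b', hb⟩ := matRed_surjective v b.unop
  obtain ⟨c', rfl⟩ := matRed_surjective v c
  refine ⟨⟨(a'.1, MulOpposite.op b'.1, c'.1), a'.2, b'.2, c'.2⟩, Prod.ext rfl (Prod.ext ?_ rfl)⟩
  exact congrArg MulOpposite.op hb

/-- Multiplication by the uniformizer. -/
abbrev unifAlg (A : Type*) [Ring A] [Algebra (Kv v) A] : A := algebraMap (Kv v) A (unif v)

theorem unifAlg_comm {A : Type*} [Ring A] [Algebra (Kv v) A] (a : A) :
    unifAlg v A * a = a * unifAlg v A := Algebra.commutes _ a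

theorem unifAlg_mul {A : Type*} [Ring A] [Algebra (Kv v) A] (n : ℕ) (a : A) :
    unifAlg v A ^ n * a = (unif v : Kv v) ^ n • a := by
  rw [← map_pow, Algebra.smul_def]

theorem unifAlg_mul_eq_zero {A : Type*} [Ring A] [Algebra (Kv v) A] (a : A)
    (h : unifAlg v A * a = 0) : a = 0 := by
  rw [← pow_one (unifAlg v A), unifAlg_mul, pow_one] at h
  exact (smul_eq_zero.1 h).resolve_left (unif_ne_zero v)

/-- The matrices whose entries are divisible by the `n`-th power of the uniformizer. -/
def matBall (n : ℕ) : AddSubgroup (Mat (Kv v)) where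
  carrier := {a | ∀ i j, ‖a i j‖ ≤ ‖(unif v : Kv v)‖ ^ n}
  zero_mem' i j := by simp
  add_mem' ha hb i j := (IsUltrametricDist.norm_add_le_max _ _).trans (max_le (ha i j) (hb i j))
  neg_mem' ha i j := by
    rw [Matrix.neg_apply, norm_neg]
    exact ha i j

theorem norm_unif_pow_pos (n : ℕ) : 0 < ‖(unif v : Kv v)‖ ^ n :=
  pow_pos (norm_pos_iff.2 (unif_ne_zero v)) n

theorem inv_unif_mul_mem_iff (n : ℕ) (x : Kv v) :
    ((unif v : Kv v) ^ n)⁻¹ * x ∈ Ov v ↔ ‖x‖ ≤ ‖(unif v : Kv v)‖ ^ n := by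
  rw [← norm_le_one_iff, norm_mul, norm_inv, norm_pow, inv_mul_le_iff₀ (norm_unif_pow_pos v n),
    mul_one]

theorem mem_matBall_iff {n : ℕ} {a : Mat (Kv v)} :
    a ∈ matBall v n ↔ ∃ b ∈ intMat v, (unif v : Kv v) ^ n • b = a := by
  constructor
  · intro h
    refine ⟨((unif v : Kv v) ^ n)⁻¹ • a, fun i j => ?_, ?_⟩
    · exact (inv_unif_mul_mem_iff v n _).2 (h i j)
    · rw [smul_smul, mul_inv_cancel₀ (pow_ne_zero _ (unif_ne_zero v)), one_smul]
  · rintro ⟨b, hb, rfl⟩ i j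
    rw [Matrix.smul_apply, smul_eq_mul, norm_mul, norm_pow]
    exact mul_le_of_le_one_right (norm_unif_pow_pos v n).le ((norm_le_one_iff v _).2 (hb i j))

theorem mem_scaled_pairSubring {n : ℕ} {x : PairAlg v} :
    x ∈ scaled (pairSubring v) (unifAlg v (PairAlg v)) n ↔
      x.1 ∈ matBall v n ∧ x.2.1.unop ∈ matBall v n ∧ x.2.2 ∈ matBall v n := by
  rw [mem_scaled]
  simp only [mem_matBall_iff, unifAlg_mul]
  constructor
  · rintro ⟨r, hr, rfl⟩
    exact ⟨⟨_, hr.1, rfl⟩, ⟨_, hr.2.1, rfl⟩, ⟨_, hr.2.2, rfl⟩⟩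
  · rintro ⟨⟨a, ha, h1⟩, ⟨b, hb, h2⟩, ⟨c, hc, h3⟩⟩
    exact ⟨(a, MulOpposite.op b, c), ⟨ha, hb, hc⟩,
      Prod.ext h1 (Prod.ext (MulOpposite.unop_injective h2) h3)⟩

theorem matRed_eq_zero_iff (a : intSubring v) : matRed v a = 0 ↔ (a : Mat (Kv v)) ∈ matBall v 1 := by
  rw [← Matrix.ext_iff]
  refine forall_congr' fun i => forall_congr' fun j => ?_
  rw [matRed_apply, Matrix.zero_apply, residue_eq_zero_iff']
  have h := inv_unif_mul_mem_iff v 1 ((a : Mat (Kv v)) i j)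
  rwa [pow_one] at h

theorem pairRed_eq_zero_iff (x : pairSubring v) : pairRed v x = 0 ↔
    (x : PairAlg v) ∈ scaled (pairSubring v) (unifAlg v (PairAlg v)) 1 := by
  rw [mem_scaled_pairSubring, Prod.ext_iff, Prod.ext_iff]
  refine and_congr (matRed_eq_zero_iff v ⟨x.1.1, x.2.1⟩) (and_congr ?_
    (matRed_eq_zero_iff v ⟨x.1.2.2, x.2.2.2⟩))
  exact (MulOpposite.op_eq_zero_iff _).trans (matRed_eq_zero_iff v ⟨x.1.2.1.unop, x.2.2.1⟩)

theorem unifAlg_mem_pairSubring : unifAlg v (PairAlg v) ∈ pairSubring v := by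
  have h : ∀ i j, algebraMap (Kv v) (Mat (Kv v)) (unif v) i j ∈ Ov v := by
    intro i j
    rw [Matrix.algebraMap_matrix_apply]
    split_ifs
    exacts [(unif v).2, zero_mem _]
  exact ⟨h, h, h⟩

theorem exists_of_isUnit_pairRed (x : pairSubring v) (h : IsUnit (pairRed v x)) :
    ∃ g ∈ unitSubgroup (pairIncl v) (pairSubring v), pairIncl v g = x := by
  obtain ⟨h1, h23⟩ := Prod.isUnit_iff.1 h
  obtain ⟨h2, h3⟩ := Prod.isUnit_iff.1 h23
  have h2' : IsUnit (matRed v ⟨x.1.2.1.unop, x.2.2.1⟩) := isUnit_op.1 h2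
  obtain ⟨a, ha, ha'⟩ := exists_unit_of_isUnit_matRed v ⟨x.1.1, x.2.1⟩ h1
  obtain ⟨b, hb, hb'⟩ := exists_unit_of_isUnit_matRed v _ h2'
  obtain ⟨c, hc, hc'⟩ := exists_unit_of_isUnit_matRed v ⟨x.1.2.2, x.2.2.2⟩ h3
  have hx : pairIncl v (mkG a b c) = x :=
    Prod.ext ha (Prod.ext (MulOpposite.unop_injective hb) hc)
  refine ⟨mkG a b c, ⟨?_, ha', hb', hc'⟩, hx⟩
  rw [hx]
  exact x.2

/-- The congruence subgroup of level `n`. -/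
def congrK (n : ℕ) : Subgroup (PairGroup (Kv v)) :=
  congrSubgroup (pairIncl v) (pairSubring v) (unifAlg_comm v) n

theorem coe_unitSubgroup_pairIncl :
    (unitSubgroup (pairIncl v) (pairSubring v) : Set (PairGroup (Kv v))) = maxCompact v := by
  ext g
  constructor
  · rintro ⟨h, h'⟩ i j
    exact ⟨⟨h.1 i j, h'.1 i j⟩, ⟨h.2.1 i j, h'.2.1 i j⟩, ⟨h.2.2 i j, h'.2.2 i j⟩⟩
  · intro h
    exact ⟨⟨fun i j => (h i j).1.1, fun i j => (h i j).2.1.1, fun i j => (h i j).2.2.1⟩,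
      ⟨fun i j => (h i j).1.2, fun i j => (h i j).2.1.2, fun i j => (h i j).2.2.2⟩⟩

theorem mem_congrK_iff {n : ℕ} {g : PairGroup (Kv v)} : g ∈ congrK v n ↔ g ∈ maxCompact v ∧
    g.g11 - 1 ∈ matBall v n ∧ g.g12 - 1 ∈ matBall v n ∧ g.g2 - 1 ∈ matBall v n := by
  rw [← coe_unitSubgroup_pairIncl]
  exact and_congr Iff.rfl (mem_scaled_pairSubring v)

theorem isOpen_matBall (n : ℕ) : IsOpen (matBall v n : Set (Mat (Kv v))) := by
  have h : (matBall v n : Set (Mat (Kv v))) = (fun a => ((unif v : Kv v) ^ n)⁻¹ • a) ⁻¹' intMat v := by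
    ext a
    exact forall_congr' fun i => forall_congr' fun j => (inv_unif_mul_mem_iff v n _).symm
  rw [h]
  exact (isOpen_intMat v).preimage (continuous_const_smul _)

theorem isOpen_congrK (n : ℕ) : IsOpen (congrK v n : Set (PairGroup (Kv v))) := by
  have h : (congrK v n : Set (PairGroup (Kv v))) = maxCompact v ∩
      ((fun g => g.g11 - 1) ⁻¹' (matBall v n) ∩ ((fun g => g.g12 - 1) ⁻¹' (matBall v n) ∩
        (fun g => g.g2 - 1) ⁻¹' (matBall v n))) := by
    ext g
    exact mem_congrK_iff v
  rw [h]
  exact (isOpen_maxCompact v).inter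
    (((isOpen_matBall v n).preimage (continuous_g11.sub continuous_const)).inter
    (((isOpen_matBall v n).preimage (continuous_g12.sub continuous_const)).inter
    ((isOpen_matBall v n).preimage (continuous_g2.sub continuous_const))))

theorem isCompact_congrK (n : ℕ) : IsCompact (congrK v n : Set (PairGroup (Kv v))) :=
  (isCompact_maxCompact v).of_isClosed_subset (Subgroup.isClosed_of_isOpen _ (isOpen_congrK v n))
    fun _ hg => ((mem_congrK_iff v).1 hg).1

theorem card_units_mat : Nat.card (Mat (Res v))ˣ = (q v ^ 2 - 1) * (q v ^ 2 - q v) := by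
  have := Fintype.ofFinite (Res v)
  have h := Matrix.card_GL_field (𝔽 := Res v) 2
  rw [Fin.prod_univ_two] at h
  rw [q, Nat.card_eq_fintype_card (α := Res v)]
  simpa using h

theorem card_mat : Nat.card (Mat (Res v)) = q v ^ 4 := by
  have := Fintype.ofFinite (Res v)
  have h : Nat.card (Fin 2 → Fin 2 → Res v) = q v ^ 4 := by
    rw [Nat.card_fun, Nat.card_fun, ← pow_mul, Nat.card_fin]
    rfl
  exact h

theorem haarG_congrK (n : ℕ) : haarG v (congrK v (n + 1)) =
    ((((q v ^ 4) ^ n * ((q v ^ 2 - 1) * (q v ^ 2 - q v))) ^ 3 : ℕ) : ℝ≥0∞)⁻¹ := by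
  have hidx := relIndex_congrSubgroup (pairIncl v) (pairSubring v) (unifAlg_comm v) (pairRed v)
    (pairRed_surjective v) (pairRed_eq_zero_iff v) (unifAlg_mul_eq_zero v)
    (unifAlg_mem_pairSubring v) (exists_of_isUnit_pairRed v) (pairIncl_injective v) n
  have h1 : Nat.card (Mat (Res v))ᵐᵒᵖ = Nat.card (Mat (Res v)) :=
    Nat.card_congr MulOpposite.opEquiv.symm
  have h2 : Nat.card (Mat (Res v))ᵐᵒᵖˣ = Nat.card (Mat (Res v))ˣ :=
    Nat.card_congr (Units.opEquiv.toEquiv.trans MulOpposite.opEquiv.symm)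
  rw [Nat.card_prod, Nat.card_prod, Nat.card_congr MulEquiv.prodUnits.toEquiv, Nat.card_prod,
    Nat.card_congr MulEquiv.prodUnits.toEquiv, Nat.card_prod, h1, h2, card_mat, card_units_mat] at hidx
  have hidx' : (congrK v (n + 1)).relIndex (unitSubgroup (pairIncl v) (pairSubring v)) =
      ((q v ^ 4) ^ n * ((q v ^ 2 - 1) * (q v ^ 2 - q v))) ^ 3 := by
    rw [congrK, hidx]
    ring
  have hq := one_lt_q v
  have hne : ((q v ^ 4) ^ n * ((q v ^ 2 - 1) * (q v ^ 2 - q v))) ^ 3 ≠ 0 := by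
    have h3 : q v < q v ^ 2 := by nlinarith
    have h4 : q v ^ 2 - 1 ≠ 0 := by omega
    have h5 : q v ^ 2 - q v ≠ 0 := by omega
    have h6 : q v ≠ 0 := by omega
    positivity
  have h := relIndex_mul_measure (haarG v) (congrSubgroup_le (pairIncl v) (pairSubring v)
    (unifAlg_comm v) (n + 1)) (isOpen_congrK v (n + 1)).measurableSet (by
      change (congrK v (n + 1)).relIndex _ ≠ 0
      rw [hidx']
      exact hne)
  change ((congrK v (n + 1)).relIndex _ : ℝ≥0∞) * haarG v (congrK v (n + 1)) = _ at h
  rw [hidx', coe_unitSubgroup_pairIncl, (haarG_spec v).2, mul_comm] at h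
  exact ENNReal.eq_inv_of_mul_eq_one_left h

end Congruence

/-! ### The tangent lattice of an orbit -/

section Tangent

open scoped NNReal Pointwise
open NumberField NumberField.HeightOneSpectrum

theorem relIndex_ne_zero_of_isOpen {W : Type*} [AddGroup W] [TopologicalSpace W]
    [IsTopologicalAddGroup W] {A B : AddSubgroup W} (hA : IsOpen (A : Set W))
    (hB : IsCompact (B : Set W)) : A.relIndex B ≠ 0 := by
  have : CompactSpace B := isCompact_iff_compactSpace.1 hB
  have hopen : IsOpen (A.addSubgroupOf B : Set B) := hA.preimage continuous_subtype_val
  have : Finite (B ⧸ A.addSubgroupOf B) := AddSubgroup.quotient_finite_of_isOpen _ hopen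
  exact AddSubgroup.index_ne_zero_of_finite

variable {k : Type*} [Field k] [NumberField k] (v : HeightOneSpectrum (𝓞 k))

/-- The index of `M 𝒪²` in `𝒪²` is `|det M|⁻¹`. -/
theorem relIndex_mulVec (M : (Mat (Kv v))ˣ) (hM : (M : Mat (Kv v)) ∈ intMat v) :
    (((stdLattice v (Fin 2)).map (Matrix.mulVecLin (M : Mat (Kv v))).toAddMonoidHom).relIndex
      (stdLattice v (Fin 2)) : ℝ≥0∞) * ‖(M : Mat (Kv v)).det‖₊ = 1 := by
  let j : (Mat (Kv v))ˣ →* (Module.End (Kv v) (Fin 2 → Kv v))ˣ :=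
    Units.map (Matrix.toLinAlgEquiv' : Mat (Kv v) ≃ₐ[Kv v] _).toAlgHom.toRingHom.toMonoidHom
  have hj (a : (Mat (Kv v))ˣ) (w : Fin 2 → Kv v) : j a • w = (a : Mat (Kv v)) *ᵥ w := rfl
  have hc : ContinuousConstSMul (Module.End (Kv v) (Fin 2 → Kv v))ˣ (Fin 2 → Kv v) :=
    ⟨fun g => LinearMap.continuous_on_pi (g : Module.End (Kv v) (Fin 2 → Kv v))⟩
  have hchar := distribHaarChar_eq_normDet v j (AddEquiv.refl (Fin 2 → Kv v)) continuous_id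
    continuous_id (fun a w => by
      change j (scalarGL a) • w = (a : Kv v) • w
      rw [hj, scalarGL_val, Matrix.smul_mulVec, Matrix.one_mulVec]) (n := 1) (by simp) M
  borelize (Fin 2 → Kv v)
  let μ : Measure (Fin 2 → Kv v) := Measure.addHaar
  set L := stdLattice v (Fin 2)
  set L' := L.map (Matrix.mulVecLin (M : Mat (Kv v))).toAddMonoidHom with hL'
  have hset : (L' : Set (Fin 2 → Kv v)) = j M • (L : Set (Fin 2 → Kv v)) := rfl
  have hopen : IsOpen (L' : Set (Fin 2 → Kv v)) := by
    rw [hset]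
    exact (isOpen_stdLattice v).smul _
  have hle : L' ≤ L := by
    rintro _ ⟨f, hf, rfl⟩ i
    exact sum_mem fun l _ => mul_mem (hM i l) (hf l)
  have h := relIndex_add_measure μ hle hopen.measurableSet
    (relIndex_ne_zero_of_isOpen hopen (isCompact_stdLattice v))
  rw [hset, ← distribHaarChar_mul, hchar, pow_one, ← mul_assoc] at h
  have h0 : μ L ≠ 0 := ((isOpen_stdLattice v).measure_pos μ ⟨0, zero_mem _⟩).ne'
  have htop : μ L ≠ ∞ := (isCompact_stdLattice v).measure_lt_top.ne
  exact (ENNReal.mul_left_inj h0 htop).1 (h.trans (one_mul _).symm)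

/-- The companion matrix of `X² - t X + n`. -/
def companion {F : Type*} [Field F] (t n : F) : Mat F := !![0, -n; 1, t]

theorem disc_companion {F : Type*} [Field F] (t n : F) :
    disc (w (companion t n)) = t ^ 2 - 4 * n := by
  rw [disc_w, companion, Matrix.trace_fin_two_of, Matrix.det_fin_two_of]
  ring

theorem companion_mul_apply {F : Type*} [Field F] (t n : F) (b : Mat F) (j : Fin 2) :
    (companion t n * b) 0 j = -n * b 1 j ∧ (companion t n * b) 1 j = b 0 j + t * b 1 j := by
  constructor <;> simp only [Matrix.mul_apply, Fin.sum_univ_two] <;> simp [companion]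

theorem mul_companion_apply {F : Type*} [Field F] (t n : F) (b : Mat F) (i : Fin 2) :
    (b * companion t n) i 0 = b i 1 ∧ (b * companion t n) i 1 = -n * b i 0 + t * b i 1 := by
  constructor <;> simp only [Matrix.mul_apply, Fin.sum_univ_two] <;> simp [companion]
  ring

/-- The differential at `1` of the orbit map of `(1, u)`. -/
def diffMap {F : Type*} [Field F] (u : Mat F) : Mat F × Mat F × Mat F →+ PairSpace F where
  toFun a := ((a.1 + a.2.1 + (a.2.2 0 0 • 1 + a.2.2 0 1 • u),
    a.1 * u + u * a.2.1 + (a.2.2 1 0 • 1 + a.2.2 1 1 • u)) : Mat F × Mat F)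
  map_zero' := by
    refine PairSpace.ext' ?_ ?_
    · change (0 : Mat F) + 0 + ((0 : F) • 1 + (0 : F) • u) = 0
      simp
    · change (0 : Mat F) * u + u * 0 + ((0 : F) • 1 + (0 : F) • u) = 0
      simp
  map_add' a b := by
    refine PairSpace.ext' ?_ ?_
    · change (a.1 + b.1) + (a.2.1 + b.2.1) +
        ((a.2.2 0 0 + b.2.2 0 0) • (1 : Mat F) + (a.2.2 0 1 + b.2.2 0 1) • u) =
        (a.1 + a.2.1 + (a.2.2 0 0 • 1 + a.2.2 0 1 • u)) +
          (b.1 + b.2.1 + (b.2.2 0 0 • 1 + b.2.2 0 1 • u))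
      module
    · change (a.1 + b.1) * u + u * (a.2.1 + b.2.1) +
        ((a.2.2 1 0 + b.2.2 1 0) • (1 : Mat F) + (a.2.2 1 1 + b.2.2 1 1) • u) =
        (a.1 * u + u * a.2.1 + (a.2.2 1 0 • 1 + a.2.2 1 1 • u)) +
          (b.1 * u + u * b.2.1 + (b.2.2 1 0 • 1 + b.2.2 1 1 • u))
      rw [add_mul, mul_add]
      module

/-- The coordinates of `y₂ - u y₁` in `M(2,2) / F[u]`, for a companion matrix `u`. -/
def normalCoord {F : Type*} [Field F] (t n : F) : PairSpace F →+ (Fin 2 → F) where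
  toFun y := ![(y.2 - companion t n * y.1) 0 0 - (y.2 - companion t n * y.1) 1 1 +
      t * (y.2 - companion t n * y.1) 1 0,
    (y.2 - companion t n * y.1) 0 1 + n * (y.2 - companion t n * y.1) 1 0]
  map_zero' := by
    have h : (0 : PairSpace F).2 - companion t n * (0 : PairSpace F).1 = (0 : Mat F) := by
      change (0 : Mat F) - companion t n * 0 = 0
      simp
    rw [h]
    simp
  map_add' x y := by
    have h : (x + y).2 - companion t n * (x + y).1 =
        ((x.2 - companion t n * x.1) + (y.2 - companion t n * y.1) : Mat F) := by
      change (x.2 + y.2 : Mat F) - companion t n * (x.1 + y.1) = _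
      rw [mul_add]
      abel
    rw [h]
    funext i
    fin_cases i
    · simp only [Matrix.add_apply]
      simp
      ring
    · simp only [Matrix.add_apply]
      simp
      ring

/-- The matrix whose image describes the commutators with a companion matrix. -/
def commMat {F : Type*} [Field F] (t n : F) : Mat F := !![t, 2; 2 * n, t]

theorem normalCoord_diffMap {F : Type*} [Field F] (t n : F) (a : Mat F × Mat F × Mat F) :
    normalCoord t n (diffMap (companion t n) a) =
      commMat t n *ᵥ ![a.1 1 1 - a.1 0 0 - t * a.1 1 0, a.1 0 1 + n * a.1 1 0] := by
  have h : (diffMap (companion t n) a).2 - companion t n * (diffMap (companion t n) a).1 =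
      (a.1 * companion t n + companion t n * a.2.1 +
        (a.2.2 1 0 • 1 + a.2.2 1 1 • companion t n)) -
      companion t n * (a.1 + a.2.1 + (a.2.2 0 0 • 1 + a.2.2 0 1 • companion t n)) := rfl
  change ![_, _] = _
  rw [h]
  funext i
  have hc : companion t n 0 0 = 0 ∧ companion t n 0 1 = -n ∧ companion t n 1 0 = 1 ∧
      companion t n 1 1 = t := ⟨rfl, rfl, rfl, rfl⟩
  fin_cases i <;>
    simp [(companion_mul_apply t n _ _).1, (companion_mul_apply t n _ _).2,
      (mul_companion_apply t n _ _).1, (mul_companion_apply t n _ _).2, hc, commMat,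
      Matrix.mulVec, dotProduct, Fin.sum_univ_two] <;>
    ring

theorem exists_diffMap_eq {F : Type*} [Field F] (t n : F) (y : PairSpace F) (e f : F)
    (h : normalCoord t n y = commMat t n *ᵥ ![e, f]) :
    let W : Mat F := y.2 - companion t n * y.1
    let W' : Mat F := W - (!![0, f; 0, e] * companion t n - companion t n * !![0, f; 0, e])
    diffMap (companion t n) (!![0, f; 0, e], (y.1 : Mat F) - !![0, f; 0, e],
      !![0, 0; W' 0 0, W' 1 0]) = y := by
  intro W W'
  have h0 : W 0 0 - W 1 1 + t * W 1 0 = t * e + 2 * f := by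
    refine (congrFun h 0).trans ?_
    simp [commMat, Matrix.mulVec, dotProduct, Fin.sum_univ_two]
  have h1 : W 0 1 + n * W 1 0 = 2 * n * e + t * f := by
    refine (congrFun h 1).trans ?_
    simp [commMat, Matrix.mulVec, dotProduct, Fin.sum_univ_two]
  have hW : (y.2 : Mat F) = W + companion t n * y.1 := by simp [W]
  have hW' : W' 0 0 • (1 : Mat F) + W' 1 0 • companion t n = W' := by
    ext i j
    fin_cases i <;> fin_cases j <;>
      simp [W', companion]
    · linear_combination -h1
    · linear_combination h0
  refine PairSpace.ext' ?_ ?_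
  · change !![0, f; 0, e] + ((y.1 : Mat F) - !![0, f; 0, e]) +
      ((0 : F) • 1 + (0 : F) • companion t n) = y.1
    simp
  · change !![0, f; 0, e] * companion t n + companion t n * ((y.1 : Mat F) - !![0, f; 0, e]) +
      (W' 0 0 • 1 + W' 1 0 • companion t n) = y.2
    rw [hW', hW]
    simp only [W', mul_sub]
    abel

end Tangent

section TangentVolume

open scoped NNReal Pointwise
open NumberField NumberField.HeightOneSpectrum

variable {k : Type*} [Field k] [NumberField k] (v : HeightOneSpectrum (𝓞 k))

/-- The pairs of matrices that are divisible by the `m`-th power of the uniformizer. -/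
def pairBall (m : ℕ) : AddSubgroup (PairSpace (Kv v)) where
  carrier := {x | x.1 ∈ matBall v m ∧ x.2 ∈ matBall v m}
  zero_mem' := ⟨(matBall v m).zero_mem, (matBall v m).zero_mem⟩
  add_mem' ha hb := ⟨(matBall v m).add_mem ha.1 hb.1, (matBall v m).add_mem ha.2 hb.2⟩
  neg_mem' ha := ⟨(matBall v m).neg_mem ha.1, (matBall v m).neg_mem ha.2⟩

theorem mem_matBall_zero {a : Mat (Kv v)} : a ∈ matBall v 0 ↔ a ∈ intMat v := by
  refine forall_congr' fun i => forall_congr' fun j => ?_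
  rw [pow_zero, norm_le_one_iff]

theorem coe_pairBall_zero : (pairBall v 0 : Set (PairSpace (Kv v))) = integralPoints v := by
  rw [integralPoints_eq_prod]
  ext x
  exact and_congr (mem_matBall_zero v) (mem_matBall_zero v)

/-- The image under the differential of the triples of matrices divisible by the `m`-th power of
the uniformizer. -/
def tangent (u : Mat (Kv v)) (m : ℕ) : AddSubgroup (PairSpace (Kv v)) :=
  ((matBall v m).prod ((matBall v m).prod (matBall v m))).map (diffMap u)

variable {v} in
theorem mem_tangent {u : Mat (Kv v)} {m : ℕ} {y : PairSpace (Kv v)} : y ∈ tangent v u m ↔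
    ∃ a : Mat (Kv v) × Mat (Kv v) × Mat (Kv v), (a.1 ∈ matBall v m ∧ a.2.1 ∈ matBall v m ∧
      a.2.2 ∈ matBall v m) ∧ diffMap u a = y := Iff.rfl

theorem diffMap_smul {F : Type*} [Field F] (u : Mat F) (c : F) (a : Mat F × Mat F × Mat F) :
    diffMap u (c • a) = ((c • (diffMap u a).1, c • (diffMap u a).2) : Mat F × Mat F) := by
  refine PairSpace.ext' ?_ ?_
  · change c • a.1 + c • a.2.1 + ((c * a.2.2 0 0) • (1 : Mat F) + (c * a.2.2 0 1) • u) =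
      c • (a.1 + a.2.1 + (a.2.2 0 0 • 1 + a.2.2 0 1 • u))
    module
  · change c • a.1 * u + u * c • a.2.1 + ((c * a.2.2 1 0) • (1 : Mat F) + (c * a.2.2 1 1) • u) =
      c • (a.1 * u + u * a.2.1 + (a.2.2 1 0 • 1 + a.2.2 1 1 • u))
    rw [Matrix.smul_mul, Matrix.mul_smul]
    module

variable {v} {t n : Kv v}

theorem companion_mem_intMat (ht : t ∈ Ov v) (hn : n ∈ Ov v) : companion t n ∈ intMat v := by
  intro i j
  fin_cases i <;> fin_cases j
  · exact zero_mem _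
  · exact neg_mem hn
  · exact one_mem _
  · exact ht

theorem commMat_mem_intMat (ht : t ∈ Ov v) (hn : n ∈ Ov v) : commMat t n ∈ intMat v := by
  have h2 : (2 : Kv v) ∈ Ov v := by
    rw [← one_add_one_eq_two]
    exact add_mem (one_mem _) (one_mem _)
  intro i j
  fin_cases i <;> fin_cases j
  · exact ht
  · exact h2
  · exact mul_mem h2 hn
  · exact ht

theorem normalCoord_mem (ht : t ∈ Ov v) (hn : n ∈ Ov v) {y : PairSpace (Kv v)}
    (hy : y ∈ pairBall v 0) : normalCoord t n y ∈ stdLattice v (Fin 2) := by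
  have hW : (y.2 - companion t n * y.1 : Mat (Kv v)) ∈ intSubring v :=
    (intSubring v).sub_mem ((mem_matBall_zero v).1 hy.2)
      ((intSubring v).mul_mem (companion_mem_intMat ht hn) ((mem_matBall_zero v).1 hy.1))
  intro i
  fin_cases i
  · exact add_mem (sub_mem (hW 0 0) (hW 1 1)) (mul_mem ht (hW 1 0))
  · exact add_mem (hW 0 1) (mul_mem hn (hW 1 0))

theorem diffMap_mem_pairBall {u : Mat (Kv v)} (hu : u ∈ intMat v) {a : Mat (Kv v) × Mat (Kv v) × Mat (Kv v)}
    (h1 : a.1 ∈ intMat v) (h2 : a.2.1 ∈ intMat v) (h3 : a.2.2 ∈ intMat v) :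
    diffMap u a ∈ pairBall v 0 := by
  have hs {c : Kv v} (hc : c ∈ Ov v) {b : Mat (Kv v)} (hb : b ∈ intSubring v) :
      c • b ∈ intSubring v := fun i j => mul_mem hc (hb i j)
  refine ⟨(mem_matBall_zero v).2 ?_, (mem_matBall_zero v).2 ?_⟩
  · exact (intSubring v).add_mem ((intSubring v).add_mem h1 h2)
      ((intSubring v).add_mem (hs (h3 0 0) (intSubring v).one_mem) (hs (h3 0 1) hu))
  · exact (intSubring v).add_mem ((intSubring v).add_mem ((intSubring v).mul_mem h1 hu)
      ((intSubring v).mul_mem hu h2))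
      ((intSubring v).add_mem (hs (h3 1 0) (intSubring v).one_mem) (hs (h3 1 1) hu))

/-- The tangent lattice is the kernel of the normal coordinates modulo their values on
commutators. -/
theorem tangent_zero_eq (ht : t ∈ Ov v) (hn : n ∈ Ov v) : tangent v (companion t n) 0 =
    ((stdLattice v (Fin 2)).map (Matrix.mulVecLin (commMat t n)).toAddMonoidHom).comap
      (normalCoord t n) ⊓ pairBall v 0 := by
  have hu := companion_mem_intMat ht hn
  ext y
  constructor
  · rintro ⟨a, ⟨h1, h2, h3⟩, rfl⟩
    have h1 := (mem_matBall_zero v).1 h1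
    refine ⟨⟨![a.1 1 1 - a.1 0 0 - t * a.1 1 0, a.1 0 1 + n * a.1 1 0], fun i => ?_,
      (normalCoord_diffMap t n a).symm⟩, diffMap_mem_pairBall hu h1 ((mem_matBall_zero v).1 h2)
        ((mem_matBall_zero v).1 h3)⟩
    fin_cases i
    · exact sub_mem (sub_mem (h1 1 1) (h1 0 0)) (mul_mem ht (h1 1 0))
    · exact add_mem (h1 0 1) (mul_mem hn (h1 1 0))
  · rintro ⟨⟨c, hc, hcy⟩, hy⟩
    have hcy' : normalCoord t n y = commMat t n *ᵥ ![c 0, c 1] := by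
      rw [show ![c 0, c 1] = c from by ext i; fin_cases i <;> rfl]
      exact hcy.symm
    let A : Mat (Kv v) := !![0, c 1; 0, c 0]
    let W : Mat (Kv v) := y.2 - companion t n * y.1 - (A * companion t n - companion t n * A)
    have h : diffMap (companion t n) (A, (y.1 : Mat (Kv v)) - A, !![0, 0; W 0 0, W 1 0]) = y :=
      exists_diffMap_eq t n y (c 0) (c 1) hcy'
    have hy1 : (y.1 : Mat (Kv v)) ∈ intSubring v := (mem_matBall_zero v).1 hy.1
    have hy2 : (y.2 : Mat (Kv v)) ∈ intSubring v := (mem_matBall_zero v).1 hy.2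
    have hA : A ∈ intSubring v := by
      intro i j
      fin_cases i <;> fin_cases j
      exacts [zero_mem _, hc 1, zero_mem _, hc 0]
    have hu' : companion t n ∈ intSubring v := hu
    have hW : W ∈ intSubring v :=
      (intSubring v).sub_mem ((intSubring v).sub_mem hy2 ((intSubring v).mul_mem hu' hy1))
        ((intSubring v).sub_mem ((intSubring v).mul_mem hA hu') ((intSubring v).mul_mem hu' hA))
    have hC : (!![0, 0; W 0 0, W 1 0] : Mat (Kv v)) ∈ intMat v := by
      intro i j
      fin_cases i <;> fin_cases j
      exacts [zero_mem _, zero_mem _, hW 0 0, hW 1 0]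
    exact mem_tangent.2 ⟨(A, (y.1 : Mat (Kv v)) - A, !![0, 0; W 0 0, W 1 0]),
      ⟨(mem_matBall_zero v).2 hA, (mem_matBall_zero v).2 ((intSubring v).sub_mem hy1 hA),
      (mem_matBall_zero v).2 hC⟩, h⟩

theorem map_normalCoord (ht : t ∈ Ov v) (hn : n ∈ Ov v) :
    (pairBall v 0).map (normalCoord t n) = stdLattice v (Fin 2) := by
  refine le_antisymm ?_ fun c hc => ?_
  · rintro _ ⟨y, hy, rfl⟩
    exact normalCoord_mem ht hn hy
  · refine ⟨((0, !![c 0, c 1; 0, 0]) : Mat (Kv v) × Mat (Kv v)),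
      ⟨(matBall v 0).zero_mem, (mem_matBall_zero v).2 fun i j => ?_⟩, ?_⟩
    · fin_cases i <;> fin_cases j
      exacts [hc 0, hc 1, zero_mem _, zero_mem _]
    · change ![(!![c 0, c 1; 0, 0] - companion t n * 0 : Mat (Kv v)) 0 0 -
        (!![c 0, c 1; 0, 0] - companion t n * 0 : Mat (Kv v)) 1 1 +
        t * (!![c 0, c 1; 0, 0] - companion t n * 0 : Mat (Kv v)) 1 0,
        (!![c 0, c 1; 0, 0] - companion t n * 0 : Mat (Kv v)) 0 1 +
        n * (!![c 0, c 1; 0, 0] - companion t n * 0 : Mat (Kv v)) 1 0] = c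
      funext i
      fin_cases i <;> simp

theorem continuous_normalCoord : Continuous (normalCoord t n) := by
  have h : Continuous fun y : PairSpace (Kv v) => (y.2 - companion t n * y.1 : Mat (Kv v)) :=
    PairSpace.continuous_snd.sub (continuous_const.mul PairSpace.continuous_fst)
  refine continuous_pi fun i => ?_
  fin_cases i
  · exact ((h.matrix_elem 0 0).sub (h.matrix_elem 1 1)).add (continuous_const.mul (h.matrix_elem 1 0))
  · exact (h.matrix_elem 0 1).add (continuous_const.mul (h.matrix_elem 1 0))

variable (hd : disc (w (companion t n)) ≠ 0)

include hd in
theorem det_commMat_ne_zero : (commMat t n).det ≠ 0 := by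
  rw [disc_companion] at hd
  rw [commMat, Matrix.det_fin_two_of]
  contrapose hd
  linear_combination hd

include hd in
theorem isOpen_tangent_zero (ht : t ∈ Ov v) (hn : n ∈ Ov v) :
    IsOpen (tangent v (companion t n) 0 : Set (PairSpace (Kv v))) := by
  let j : (Mat (Kv v))ˣ →* (Module.End (Kv v) (Fin 2 → Kv v))ˣ :=
    Units.map (Matrix.toLinAlgEquiv' : Mat (Kv v) ≃ₐ[Kv v] _).toAlgHom.toRingHom.toMonoidHom
  have hc : ContinuousConstSMul (Module.End (Kv v) (Fin 2 → Kv v))ˣ (Fin 2 → Kv v) :=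
    ⟨fun g => LinearMap.continuous_on_pi (g : Module.End (Kv v) (Fin 2 → Kv v))⟩
  have hL : IsOpen ((stdLattice v (Fin 2)).map (Matrix.mulVecLin (commMat t n)).toAddMonoidHom :
      Set (Fin 2 → Kv v)) :=
    (isOpen_stdLattice v (ι := Fin 2)).smul
      (j (Matrix.GeneralLinearGroup.mkOfDetNeZero _ (det_commMat_ne_zero hd)))
  have hV : IsOpen (pairBall v 0 : Set (PairSpace (Kv v))) := by
    rw [coe_pairBall_zero]
    exact isOpen_integralPoints v
  rw [tangent_zero_eq ht hn]
  exact (hL.preimage continuous_normalCoord).inter hV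

include hd in
theorem haarV_tangent_zero (ht : t ∈ Ov v) (hn : n ∈ Ov v) :
    haarV v (tangent v (companion t n) 0) = ‖disc (w (companion t n))‖₊ := by
  have hopen := isOpen_tangent_zero hd ht hn
  have hrel : (tangent v (companion t n) 0).relIndex (pairBall v 0) =
      ((stdLattice v (Fin 2)).map (Matrix.mulVecLin (commMat t n)).toAddMonoidHom).relIndex
        (stdLattice v (Fin 2)) := by
    rw [tangent_zero_eq ht hn, AddSubgroup.inf_relIndex_right, AddSubgroup.relIndex_comap,
      map_normalCoord ht hn]
  have hdet : (commMat t n).det = disc (w (companion t n)) := by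
    rw [disc_companion, commMat, Matrix.det_fin_two_of]
    ring
  have h1 := relIndex_mulVec v
    (Matrix.GeneralLinearGroup.mkOfDetNeZero _ (det_commMat_ne_zero hd))
    (commMat_mem_intMat ht hn)
  change (((stdLattice v (Fin 2)).map (Matrix.mulVecLin (commMat t n)).toAddMonoidHom).relIndex
        (stdLattice v (Fin 2)) : ℝ≥0∞) * ‖(commMat t n).det‖₊ = 1 at h1
  rw [← hrel, hdet] at h1
  have hne : (tangent v (companion t n) 0).relIndex (pairBall v 0) ≠ 0 := by
    intro h0
    rw [h0] at h1
    simp at h1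
  have h2 := relIndex_add_measure (haarV v) (tangent_zero_eq ht hn ▸ inf_le_right)
    hopen.measurableSet hne
  rw [coe_pairBall_zero, (haarV_spec v).2, ← h1] at h2
  exact (ENNReal.mul_right_inj (by exact_mod_cast hne) (by simp)).1 h2

variable (v) in
/-- Multiplication by the `m`-th power of the uniformizer, as an element of the group. -/
def unifScale (m : ℕ) : PairGroup (Kv v) := inclFst (scalarGL (unifUnit v ^ m))

theorem unifScale_smul (m : ℕ) (x : PairSpace (Kv v)) : unifScale v m • x =
    (((unif v : Kv v) ^ m • x.1, (unif v : Kv v) ^ m • x.2) : Mat (Kv v) × Mat (Kv v)) :=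
  inclFst_scalar_smul _ x

theorem tangent_eq_smul (u : Mat (Kv v)) (m : ℕ) : (tangent v u m : Set (PairSpace (Kv v))) =
    unifScale v m • (tangent v u 0 : Set (PairSpace (Kv v))) := by
  ext y
  constructor
  · intro hy
    obtain ⟨a, ⟨h1, h2, h3⟩, rfl⟩ := mem_tangent.1 hy
    obtain ⟨b1, hb1, e1⟩ := (mem_matBall_iff v).1 h1
    obtain ⟨b2, hb2, e2⟩ := (mem_matBall_iff v).1 h2
    obtain ⟨b3, hb3, e3⟩ := (mem_matBall_iff v).1 h3
    refine ⟨diffMap u (b1, b2, b3), mem_tangent.2 ⟨(b1, b2, b3), ⟨(mem_matBall_zero v).2 hb1,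
      (mem_matBall_zero v).2 hb2, (mem_matBall_zero v).2 hb3⟩, rfl⟩, ?_⟩
    change unifScale v m • _ = _
    rw [unifScale_smul, ← diffMap_smul]
    exact congrArg _ (Prod.ext e1 (Prod.ext e2 e3))
  · rintro ⟨y, hy, rfl⟩
    obtain ⟨b, ⟨h1, h2, h3⟩, rfl⟩ := mem_tangent.1 hy
    refine mem_tangent.2 ⟨(unif v : Kv v) ^ m • b,
      ⟨(mem_matBall_iff v).2 ⟨_, (mem_matBall_zero v).1 h1, rfl⟩,
      (mem_matBall_iff v).2 ⟨_, (mem_matBall_zero v).1 h2, rfl⟩,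
      (mem_matBall_iff v).2 ⟨_, (mem_matBall_zero v).1 h3, rfl⟩⟩, ?_⟩
    rw [diffMap_smul]
    exact (unifScale_smul m _).symm

include hd in
theorem isOpen_tangent (ht : t ∈ Ov v) (hn : n ∈ Ov v) (m : ℕ) :
    IsOpen (tangent v (companion t n) m : Set (PairSpace (Kv v))) := by
  rw [tangent_eq_smul]
  exact (isOpen_tangent_zero hd ht hn).smul _

include hd in
theorem haarV_tangent (ht : t ∈ Ov v) (hn : n ∈ Ov v) (m : ℕ) :
    haarV v (tangent v (companion t n) m) =
      (‖(unif v : Kv v)‖₊ ^ (8 * m) : ℝ≥0) * ‖disc (w (companion t n))‖₊ := by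
  have hdet : (unifScale v m).g11.det * (unifScale v m).g12.det * (unifScale v m).g2.det =
      (unif v : Kv v) ^ (2 * m) := by
    have h1 : (unifScale v m).g11 = (unif v : Kv v) ^ m • 1 := scalarGL_val (unifUnit v ^ m)
    have h2 : (unifScale v m).g12 = 1 := rfl
    have h3 : (unifScale v m).g2 = 1 := rfl
    rw [h1, h2, h3, Matrix.det_smul]
    simp
    ring
  rw [tangent_eq_smul, ← distribHaarChar_mul, distribHaarChar_pairSpace, hdet,
    haarV_tangent_zero hd ht hn, nnnorm_pow, ← pow_mul,
    show 2 * m * 4 = 8 * m by ring]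

end TangentVolume

/-! ### The orbit of a congruence subgroup -/

section CongruenceOrbit

open scoped NNReal Pointwise Topology
open NumberField NumberField.HeightOneSpectrum Filter

variable {k : Type*} [Field k] [NumberField k] {v : HeightOneSpectrum (𝓞 k)}

theorem norm_unif_lt_one : ‖(unif v : Kv v)‖ < 1 := by
  rw [norm_unif]
  exact inv_lt_one_of_one_lt₀ (by exact_mod_cast one_lt_q v)

theorem matBall_anti {m n : ℕ} (h : m ≤ n) : matBall v n ≤ matBall v m := fun _ ha i j =>
  (ha i j).trans (pow_le_pow_of_le_one (norm_nonneg _) norm_unif_lt_one.le h)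

theorem pairBall_anti {m n : ℕ} (h : m ≤ n) : pairBall v n ≤ pairBall v m := fun _ ha =>
  ⟨matBall_anti h ha.1, matBall_anti h ha.2⟩

theorem mul_mem_matBall {m n : ℕ} {a b : Mat (Kv v)} (ha : a ∈ matBall v m)
    (hb : b ∈ matBall v n) : a * b ∈ matBall v (m + n) := by
  intro i j
  rw [Matrix.mul_apply, Fin.sum_univ_two, pow_add]
  have h (l : Fin 2) : ‖a i l * b l j‖ ≤ ‖(unif v : Kv v)‖ ^ m * ‖(unif v : Kv v)‖ ^ n := by
    rw [norm_mul]
    exact mul_le_mul (ha i l) (hb l j) (norm_nonneg _) (norm_unif_pow_pos v m).le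
  exact (IsUltrametricDist.norm_add_le_max _ _).trans (max_le (h 0) (h 1))

theorem mul_mem_matBall_left {m : ℕ} {a b : Mat (Kv v)} (ha : a ∈ matBall v 0)
    (hb : b ∈ matBall v m) : a * b ∈ matBall v m := by
  have := mul_mem_matBall ha hb
  rwa [zero_add] at this

theorem mul_mem_matBall_right {m : ℕ} {a b : Mat (Kv v)} (ha : a ∈ matBall v m)
    (hb : b ∈ matBall v 0) : a * b ∈ matBall v m := mul_mem_matBall ha hb

theorem smul_mem_matBall {m n : ℕ} {c : Kv v} (hc : ‖c‖ ≤ ‖(unif v : Kv v)‖ ^ m)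
    {b : Mat (Kv v)} (hb : b ∈ matBall v n) : c • b ∈ matBall v (m + n) := by
  intro i j
  rw [Matrix.smul_apply, smul_eq_mul, norm_mul, pow_add]
  exact mul_le_mul hc (hb i j) (norm_nonneg _) (norm_unif_pow_pos v m).le

theorem lin_mem_matBall {m : ℕ} {c : Mat (Kv v)} (hc : c ∈ matBall v m) {b₁ b₂ : Mat (Kv v)}
    (h₁ : b₁ ∈ matBall v 0) (h₂ : b₂ ∈ matBall v 0) (i : Fin 2) :
    c i 0 • b₁ + c i 1 • b₂ ∈ matBall v m :=
  add_mem (smul_mem_matBall (hc i 0) h₁) (smul_mem_matBall (hc i 1) h₂)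

theorem lin_mem_matBall' {m : ℕ} {c : Mat (Kv v)} (hc : c ∈ matBall v 0) {b₁ b₂ : Mat (Kv v)}
    (h₁ : b₁ ∈ matBall v m) (h₂ : b₂ ∈ matBall v m) (i : Fin 2) :
    c i 0 • b₁ + c i 1 • b₂ ∈ matBall v m := by
  have := add_mem (smul_mem_matBall (hc i 0) h₁) (smul_mem_matBall (hc i 1) h₂)
  rwa [zero_add] at this

theorem one_mem_matBall_zero : (1 : Mat (Kv v)) ∈ matBall v 0 :=
  (mem_matBall_zero v).2 (one_mem_intMat v)

theorem smul_mem_pairBall {m : ℕ} {g : PairGroup (Kv v)} (hg : g ∈ maxCompact v)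
    {y : PairSpace (Kv v)} (hy : y ∈ pairBall v m) : g • y ∈ pairBall v m := by
  have h1 : g.g11 ∈ matBall v 0 := (mem_matBall_zero v).2 fun i j => (hg i j).1.1
  have h2 : g.g12 ∈ matBall v 0 := (mem_matBall_zero v).2 fun i j => (hg i j).2.1.1
  have h3 : g.g2 ∈ matBall v 0 := (mem_matBall_zero v).2 fun i j => (hg i j).2.2.1
  exact ⟨mul_mem_matBall_right (mul_mem_matBall_left h1 (lin_mem_matBall' h3 hy.1 hy.2 0)) h2,
    mul_mem_matBall_right (mul_mem_matBall_left h1 (lin_mem_matBall' h3 hy.1 hy.2 1)) h2⟩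

theorem inv_mem_maxCompact {g : PairGroup (Kv v)} (hg : g ∈ maxCompact v) :
    g⁻¹ ∈ maxCompact v := by
  rw [← coe_unitSubgroup_pairIncl] at hg ⊢
  exact inv_mem hg

theorem congrK_anti {m n : ℕ} (h : m ≤ n) : congrK v n ≤ congrK v m := by
  intro g hg
  rw [mem_congrK_iff] at hg ⊢
  exact ⟨hg.1, matBall_anti h hg.2.1, matBall_anti h hg.2.2.1, matBall_anti h hg.2.2.2⟩

theorem exists_mem_congrK {m : ℕ} {a b c : Mat (Kv v)} (ha : a ∈ matBall v (m + 1))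
    (hb : b ∈ matBall v (m + 1)) (hc : c ∈ matBall v (m + 1)) :
    ∃ g ∈ congrK v (m + 1), g.g11 - 1 = a ∧ g.g12 - 1 = b ∧ g.g2 - 1 = c := by
  have h01 : 0 ≤ m + 1 := Nat.zero_le _
  have h11 : 1 ≤ m + 1 := Nat.le_add_left 1 m
  let x : PairAlg v := (a, MulOpposite.op b, c)
  have hx : x ∈ pairSubring v := ⟨(mem_matBall_zero v).1 (matBall_anti h01 ha),
    (mem_matBall_zero v).1 (matBall_anti h01 hb), (mem_matBall_zero v).1 (matBall_anti h01 hc)⟩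
  have hred : pairRed v ⟨x, hx⟩ = 0 := by
    rw [pairRed_eq_zero_iff, mem_scaled_pairSubring]
    exact ⟨matBall_anti h11 ha, matBall_anti h11 hb, matBall_anti h11 hc⟩
  obtain ⟨g, hg, hgx⟩ := exists_of_isUnit_pairRed v (1 + ⟨x, hx⟩) (by
    rw [map_add, map_one, hred, add_zero]
    exact isUnit_one)
  have h1 : pairIncl v g - 1 = x := by
    rw [hgx]
    exact add_sub_cancel_left (1 : PairAlg v) x
  have e1 : g.g11 - 1 = a := congrArg (fun z : PairAlg v => z.1) h1
  have e2 : g.g12 - 1 = b := congrArg (fun z : PairAlg v => z.2.1.unop) h1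
  have e3 : g.g2 - 1 = c := congrArg (fun z : PairAlg v => z.2.2) h1
  refine ⟨g, (mem_congrK_iff v).2 ⟨?_, e1 ▸ ha, e2 ▸ hb, e3 ▸ hc⟩, e1, e2, e3⟩
  rw [← coe_unitSubgroup_pairIncl]
  exact hg

/-- The orbit map agrees with its differential to first order. -/
theorem smul_w_sub_mem {u : Mat (Kv v)} (hu : u ∈ matBall v 0) {m : ℕ} {g : PairGroup (Kv v)}
    (ha : g.g11 - 1 ∈ matBall v m) (hb : g.g12 - 1 ∈ matBall v m) (hc : g.g2 - 1 ∈ matBall v m) :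
    g • w u - w u - diffMap u (g.g11 - 1, g.g12 - 1, g.g2 - 1) ∈ pairBall v (m + m) := by
  obtain ⟨a, hag⟩ : ∃ a, a = g.g11 - 1 := ⟨_, rfl⟩
  obtain ⟨b, hbg⟩ : ∃ b, b = g.g12 - 1 := ⟨_, rfl⟩
  obtain ⟨c, hcg⟩ : ∃ c, c = g.g2 - 1 := ⟨_, rfl⟩
  have ea : g.g11 = 1 + a := by rw [hag]; abel
  have eb : g.g12 = 1 + b := by rw [hbg]; abel
  have ec : g.g2 = 1 + c := by rw [hcg]; abel
  rw [← hag] at ha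
  rw [← hbg] at hb
  rw [← hcg] at hc
  have h0m : matBall v m ≤ matBall v 0 := matBall_anti (Nat.zero_le m)
  have hP (i : Fin 2) : c i 0 • (1 : Mat (Kv v)) + c i 1 • u ∈ matBall v m :=
    lin_mem_matBall hc one_mem_matBall_zero hu i
  have key (z : Mat (Kv v)) (hz : z ∈ matBall v 0) (p : Mat (Kv v)) (hp : p ∈ matBall v m) :
      (1 + a) * (z + p) * (1 + b) - z - (a * z + z * b + p) ∈ matBall v (m + m) := by
    have h : (1 + a) * (z + p) * (1 + b) - z - (a * z + z * b + p) =
        a * p + p * b + a * z * b + a * p * b := by noncomm_ring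
    rw [h]
    exact add_mem (add_mem (add_mem (mul_mem_matBall ha hp) (mul_mem_matBall hp hb))
      (mul_mem_matBall (mul_mem_matBall_right ha hz) hb))
      (mul_mem_matBall (mul_mem_matBall_right ha (h0m hp)) hb)
  have c0 : g.g2 0 0 • (1 : Mat (Kv v)) + g.g2 0 1 • u = 1 + (c 0 0 • 1 + c 0 1 • u) := by
    rw [ec]
    simp only [Matrix.add_apply]
    simp
    module
  have c1 : g.g2 1 0 • (1 : Mat (Kv v)) + g.g2 1 1 • u = u + (c 1 0 • 1 + c 1 1 • u) := by
    rw [ec]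
    simp only [Matrix.add_apply]
    simp
    module
  rw [← hag, ← hbg, ← hcg]
  constructor
  · change g.g11 * (g.g2 0 0 • (1 : Mat (Kv v)) + g.g2 0 1 • u) * g.g12 - 1 -
      (a + b + (c 0 0 • 1 + c 0 1 • u)) ∈ _
    rw [c0, ea, eb]
    have := key 1 one_mem_matBall_zero _ (hP 0)
    rwa [mul_one, one_mul] at this
  · change g.g11 * (g.g2 1 0 • (1 : Mat (Kv v)) + g.g2 1 1 • u) * g.g12 - u -
      (a * u + u * b + (c 1 0 • 1 + c 1 1 • u)) ∈ _
    rw [c1, ea, eb]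
    exact key u hu _ (hP 1)

theorem tendsto_zero_of_mem_pairBall {y : ℕ → PairSpace (Kv v)} (hy : ∀ i, y i ∈ pairBall v i) :
    Tendsto y atTop (𝓝 0) := by
  have hpow : Tendsto (fun i => ‖(unif v : Kv v)‖ ^ i) atTop (𝓝 0) :=
    tendsto_pow_atTop_nhds_zero_of_lt_one (norm_nonneg _) norm_unif_lt_one
  have key (z : ℕ → Mat (Kv v)) (hz : ∀ i, z i ∈ matBall v i) : Tendsto z atTop (𝓝 0) :=
    tendsto_pi_nhds.2 fun a => tendsto_pi_nhds.2 fun b =>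
      squeeze_zero_norm (fun i => hz i a b) hpow
  exact Tendsto.prodMk_nhds (key (fun i => (y i).1) fun i => (hy i).1)
    (key (fun i => (y i).2) fun i => (hy i).2)

theorem exists_pairBall_le {T : AddSubgroup (PairSpace (Kv v))}
    (hT : IsOpen (T : Set (PairSpace (Kv v)))) : ∃ c, pairBall v c ≤ T := by
  by_contra! h
  simp only [SetLike.not_le_iff_exists] at h
  choose y hy hyT using h
  have h1 := (tendsto_zero_of_mem_pairBall hy).eventually (hT.mem_nhds T.zero_mem)
  obtain ⟨i, hi⟩ := h1.exists
  exact hyT i hi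

theorem pairBall_le_tangent {u : Mat (Kv v)} {c : ℕ} (hc : pairBall v c ≤ tangent v u 0) (m : ℕ) :
    pairBall v (m + c) ≤ tangent v u m := by
  rintro y ⟨h1, h2⟩
  obtain ⟨b1, hb1, e1⟩ := (mem_matBall_iff v).1 h1
  obtain ⟨b2, hb2, e2⟩ := (mem_matBall_iff v).1 h2
  have hz : (((unif v : Kv v) ^ c • b1, (unif v : Kv v) ^ c • b2) : Mat (Kv v) × Mat (Kv v)) ∈
      tangent v u 0 := hc ⟨(mem_matBall_iff v).2 ⟨_, hb1, rfl⟩, (mem_matBall_iff v).2 ⟨_, hb2, rfl⟩⟩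
  rw [← SetLike.mem_coe, tangent_eq_smul]
  refine ⟨_, hz, ?_⟩
  refine (unifScale_smul m _).trans (PairSpace.ext' ?_ ?_)
  · change (unif v : Kv v) ^ m • (unif v : Kv v) ^ c • b1 = y.1
    rw [← e1, pow_add, mul_smul]
  · change (unif v : Kv v) ^ m • (unif v : Kv v) ^ c • b2 = y.2
    rw [← e2, pow_add, mul_smul]

theorem tangent_anti {u : Mat (Kv v)} {m n : ℕ} (h : m ≤ n) : tangent v u n ≤ tangent v u m := by
  intro y hy
  obtain ⟨a, ha, rfl⟩ := mem_tangent.1 hy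
  exact mem_tangent.2 ⟨a, ⟨matBall_anti h ha.1, matBall_anti h ha.2.1, matBall_anti h ha.2.2⟩, rfl⟩

theorem tangent_le_pairBall {u : Mat (Kv v)} (hu : u ∈ matBall v 0) (m : ℕ) :
    tangent v u m ≤ pairBall v m := by
  intro y hy
  obtain ⟨a, ha, rfl⟩ := mem_tangent.1 hy
  exact ⟨add_mem (add_mem ha.1 ha.2.1) (lin_mem_matBall ha.2.2 one_mem_matBall_zero hu 0),
    add_mem (add_mem (mul_mem_matBall_right ha.1 hu) (mul_mem_matBall_left hu ha.2.1))
      (lin_mem_matBall ha.2.2 one_mem_matBall_zero hu 1)⟩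

/-- For large `m`, the orbit of the congruence subgroup of level `m` is a translate of the tangent
lattice. -/
theorem image_congrK {u : Mat (Kv v)} (hu : u ∈ matBall v 0) {c : ℕ}
    (hc : pairBall v c ≤ tangent v u 0) {m : ℕ} (hm : c < m) :
    (fun g : PairGroup (Kv v) => g • w u) '' (congrK v m) = {y | y - w u ∈ tangent v u m} := by
  have hstep {i : ℕ} (hi : m ≤ i) : pairBall v (i + i) ≤ tangent v u (i + 1) := by
    have h : i + 1 + c ≤ i + i := by omega
    exact (pairBall_anti h).trans (pairBall_le_tangent hc (i + 1))
  ext y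
  constructor
  · rintro ⟨g, hg, rfl⟩
    have hg' := (mem_congrK_iff v).1 hg
    have h1 := tangent_anti (Nat.le_succ m)
      (hstep le_rfl (smul_w_sub_mem hu hg'.2.1 hg'.2.2.1 hg'.2.2.2))
    have h2 : diffMap u (g.g11 - 1, g.g12 - 1, g.g2 - 1) ∈ tangent v u m :=
      mem_tangent.2 ⟨(g.g11 - 1, g.g12 - 1, g.g2 - 1), hg'.2, rfl⟩
    have h3 := add_mem h1 h2
    rwa [sub_add_cancel] at h3
  · intro hy
    have happ (i : ℕ) : ∃ g ∈ congrK v m, g⁻¹ • y - w u ∈ tangent v u (m + i) := by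
      induction i with
      | zero => exact ⟨1, one_mem _, by rw [inv_one, one_smul]; exact hy⟩
      | succ i ih =>
        obtain ⟨g, hg, hgy⟩ := ih
        obtain ⟨a, ha, hay⟩ := mem_tangent.1 hgy
        obtain ⟨j, hj⟩ : ∃ j, m + i = j + 1 := ⟨m + i - 1, by omega⟩
        rw [hj] at ha
        obtain ⟨g', hg', e1, e2, e3⟩ := exists_mem_congrK ha.1 ha.2.1 ha.2.2
        rw [← hj] at ha hg'
        have hga : (g'.g11 - 1, g'.g12 - 1, g'.g2 - 1) = a := Prod.ext e1 (Prod.ext e2 e3)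
        have hQ := smul_w_sub_mem hu (g := g') (m := m + i) (by rw [e1]; exact ha.1)
          (by rw [e2]; exact ha.2.1) (by rw [e3]; exact ha.2.2)
        rw [hga, hay] at hQ
        refine ⟨g * g', mul_mem hg (congrK_anti (Nat.le_add_right m i) hg'), ?_⟩
        have h4 : (g * g')⁻¹ • y - w u = -(g'⁻¹ • (g' • w u - w u - (g⁻¹ • y - w u))) := by
          rw [sub_sub_sub_cancel_right, smul_sub, inv_smul_smul, mul_inv_rev, mul_smul, neg_sub]
        rw [h4]
        exact neg_mem (hstep (Nat.le_add_right m i)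
          (smul_mem_pairBall (inv_mem_maxCompact ((mem_congrK_iff v).1 hg').1) hQ))
    choose g hg hgy using happ
    have hlim : Tendsto (fun i => g i • w u) atTop (𝓝 y) := by
      have h0 : Tendsto (fun i => y - g i • w u) atTop (𝓝 0) := by
        refine tendsto_zero_of_mem_pairBall fun i => ?_
        have h5 : y - g i • w u = g i • ((g i)⁻¹ • y - w u) := by rw [smul_sub, smul_inv_smul]
        rw [h5]
        exact pairBall_anti (Nat.le_add_left i m)
          (smul_mem_pairBall ((mem_congrK_iff v).1 (hg i)).1 (tangent_le_pairBall hu _ (hgy i)))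
      have h6 := tendsto_const_nhds (x := y) |>.sub h0
      simpa using h6
    have hcomp : IsCompact ((fun g : PairGroup (Kv v) => g • w u) '' (congrK v m)) :=
      (isCompact_congrK v m).image (continuous_id.smul continuous_const)
    exact hcomp.isClosed.mem_of_tendsto hlim (Eventually.of_forall fun i => ⟨g i, hg i, rfl⟩)

end CongruenceOrbit

/-! ### Congruence subgroups of the units of a ramified quadratic order -/

section QuadCongruence

open NumberField NumberField.HeightOneSpectrum TrivSqZeroExt

variable {k : Type*} [Field k] [NumberField k] {v : HeightOneSpectrum (𝓞 k)}
  {u : Mat (Kv v)}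

/-- The order `𝒪[u]`. -/
def quadSubring (ht : u.trace ∈ Ov v) (hn : u.det ∈ Ov v) : Subring (Mat (Kv v)) where
  carrier := {a | ∃ x ∈ Ov v, ∃ y ∈ Ov v, a = x • 1 + y • u}
  zero_mem' := ⟨0, zero_mem _, 0, zero_mem _, by simp⟩
  one_mem' := ⟨1, one_mem _, 0, zero_mem _, by simp⟩
  add_mem' := by
    rintro _ _ ⟨x, hx, y, hy, rfl⟩ ⟨x', hx', y', hy', rfl⟩
    exact ⟨x + x', add_mem hx hx', y + y', add_mem hy hy', by module⟩
  neg_mem' := by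
    rintro _ ⟨x, hx, y, hy, rfl⟩
    exact ⟨-x, neg_mem hx, -y, neg_mem hy, by module⟩
  mul_mem' := by
    rintro _ _ ⟨x, hx, y, hy, rfl⟩ ⟨x', hx', y', hy', rfl⟩
    exact ⟨_, sub_mem (mul_mem hx hx') (mul_mem hn (mul_mem hy hy')), _,
      add_mem (add_mem (mul_mem hx hy') (mul_mem hy hx')) (mul_mem ht (mul_mem hy hy')),
      lin_mul_lin u x y x' y'⟩

variable (ht : u.trace ∈ Ov v) (hn : u.det ∈ Ov v)

theorem coord_mem_of_mem_quadSubring (hu : disc (w u) ≠ 0) {a : Mat (Kv v)}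
    (ha : a ∈ quadSubring ht hn) : coordX u a ∈ Ov v ∧ coordY u a ∈ Ov v := by
  obtain ⟨x, hx, y, hy, rfl⟩ := ha
  rw [coordX_lin hu, coordY_lin hu]
  exact ⟨hx, hy⟩

/-- The reduction of `x + y u`, for a double root `ρ` of the reduced characteristic polynomial. -/
def linRed (ρ : Res v) (x y : Ov v) : DualNumber (Res v) :=
  inl (IsLocalRing.residue (Ov v) x + IsLocalRing.residue (Ov v) y * ρ) +
    inr (IsLocalRing.residue (Ov v) y)

theorem fst_linRed (ρ : Res v) (x y : Ov v) : (linRed ρ x y).fst =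
    IsLocalRing.residue (Ov v) x + IsLocalRing.residue (Ov v) y * ρ := by simp [linRed]

theorem snd_linRed (ρ : Res v) (x y : Ov v) : (linRed ρ x y).snd =
    IsLocalRing.residue (Ov v) y := by simp [linRed]

variable (hu : disc (w u) ≠ 0) {ρ : Res v}
  (hρt : IsLocalRing.residue (Ov v) ⟨u.trace, ht⟩ = 2 * ρ)
  (hρn : IsLocalRing.residue (Ov v) ⟨u.det, hn⟩ = ρ ^ 2)

/-- The value of the reduction map at an element of the order. -/
def quadRedFun (ρ : Res v) (a : quadSubring ht hn) : DualNumber (Res v) :=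
  linRed ρ ⟨coordX u a, (coord_mem_of_mem_quadSubring ht hn hu a.2).1⟩
    ⟨coordY u a, (coord_mem_of_mem_quadSubring ht hn hu a.2).2⟩

theorem quadRedFun_lin (x y : Ov v) (h : (x : Kv v) • 1 + (y : Kv v) • u ∈ quadSubring ht hn) :
    quadRedFun ht hn hu ρ ⟨_, h⟩ = linRed ρ x y := by
  rw [quadRedFun]
  congr 1
  · exact Subtype.ext (coordX_lin hu _ _)
  · exact Subtype.ext (coordY_lin hu _ _)

theorem exists_eq_lin (a : quadSubring ht hn) : ∃ x y : Ov v,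
    (a : Mat (Kv v)) = (x : Kv v) • 1 + (y : Kv v) • u := by
  obtain ⟨x, hx, y, hy, h⟩ := a.2
  exact ⟨⟨x, hx⟩, ⟨y, hy⟩, h⟩

theorem quadRedFun_eq {a : quadSubring ht hn} {x y : Ov v}
    (h : (a : Mat (Kv v)) = (x : Kv v) • 1 + (y : Kv v) • u) :
    quadRedFun ht hn hu ρ a = linRed ρ x y := by
  obtain ⟨a, ha⟩ := a
  subst h
  exact quadRedFun_lin ht hn hu x y ha

include hρt hρn in
theorem linRed_mul (x y x' y' : Ov v) : linRed ρ (x * x' - ⟨u.det, hn⟩ * (y * y'))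
    (x * y' + y * x' + ⟨u.trace, ht⟩ * (y * y')) = linRed ρ x y * linRed ρ x' y' := by
  refine TrivSqZeroExt.ext ?_ ?_
  · rw [fst_mul, fst_linRed, fst_linRed, fst_linRed]
    simp only [map_add, map_sub, map_mul, hρt, hρn]
    ring
  · rw [snd_mul, snd_linRed, snd_linRed, snd_linRed, fst_linRed, fst_linRed]
    simp only [map_add, map_mul, hρt, smul_eq_mul, MulOpposite.smul_eq_mul_unop,
      MulOpposite.unop_op]
    ring

/-- The reduction of the order `𝒪[u]` modulo the uniformizer of `k_v`. -/
def quadRed : quadSubring ht hn →+* DualNumber (Res v) where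
  toFun := quadRedFun ht hn hu ρ
  map_zero' := by
    rw [quadRedFun_eq ht hn hu (x := 0) (y := 0) (by simp)]
    ext <;> simp [fst_linRed, snd_linRed]
  map_one' := by
    rw [quadRedFun_eq ht hn hu (x := 1) (y := 0) (by simp)]
    ext <;> simp [fst_linRed, snd_linRed]
  map_add' a b := by
    obtain ⟨x, y, h⟩ := exists_eq_lin ht hn a
    obtain ⟨x', y', h'⟩ := exists_eq_lin ht hn b
    rw [quadRedFun_eq ht hn hu h, quadRedFun_eq ht hn hu h',
      quadRedFun_eq ht hn hu (x := x + x') (y := y + y') (by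
        rw [Subring.coe_add, h, h']
        push_cast
        module)]
    ext
    · simp only [fst_linRed, fst_add, map_add]
      ring
    · simp only [snd_linRed, snd_add, map_add]
  map_mul' a b := by
    obtain ⟨x, y, h⟩ := exists_eq_lin ht hn a
    obtain ⟨x', y', h'⟩ := exists_eq_lin ht hn b
    rw [quadRedFun_eq ht hn hu h, quadRedFun_eq ht hn hu h', ← linRed_mul ht hn hρt hρn]
    refine quadRedFun_eq ht hn hu ?_
    rw [Subring.coe_mul, h, h', lin_mul_lin]
    rfl

theorem quadRed_eq {a : quadSubring ht hn} {x y : Ov v}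
    (h : (a : Mat (Kv v)) = (x : Kv v) • 1 + (y : Kv v) • u) :
    quadRed ht hn hu hρt hρn a = linRed ρ x y := quadRedFun_eq ht hn hu h

theorem quadRed_surjective : Function.Surjective (quadRed ht hn hu hρt hρn) := by
  intro s
  obtain ⟨y, hy⟩ := IsLocalRing.residue_surjective s.snd
  obtain ⟨x, hx⟩ := IsLocalRing.residue_surjective (s.fst - s.snd * ρ)
  refine ⟨⟨_, x, x.2, y, y.2, rfl⟩, ?_⟩
  rw [quadRed_eq ht hn hu hρt hρn (x := x) (y := y) rfl]
  ext
  · rw [fst_linRed, hx, hy, sub_add_cancel]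
  · rw [snd_linRed, hy]

include hu in
theorem mem_scaled_quadSubring {m : ℕ} {x y : Kv v} :
    x • 1 + y • u ∈ scaled (quadSubring ht hn) (unifAlg v (Mat (Kv v))) m ↔
      ‖x‖ ≤ ‖(unif v : Kv v)‖ ^ m ∧ ‖y‖ ≤ ‖(unif v : Kv v)‖ ^ m := by
  have h0 : (unif v : Kv v) ^ m ≠ 0 := pow_ne_zero _ (unif_ne_zero v)
  rw [mem_scaled, ← inv_unif_mul_mem_iff, ← inv_unif_mul_mem_iff]
  simp only [unifAlg_mul]
  constructor
  · rintro ⟨_, ⟨x', hx', y', hy', rfl⟩, h⟩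
    rw [smul_add, smul_smul, smul_smul] at h
    obtain ⟨rfl, rfl⟩ := lin_injective hu h
    rw [inv_mul_cancel_left₀ h0, inv_mul_cancel_left₀ h0]
    exact ⟨hx', hy'⟩
  · rintro ⟨hx, hy⟩
    refine ⟨_, ⟨_, hx, _, hy, rfl⟩, ?_⟩
    rw [smul_add, smul_smul, smul_smul, mul_inv_cancel_left₀ h0, mul_inv_cancel_left₀ h0]

theorem quadRed_eq_zero_iff (a : quadSubring ht hn) : quadRed ht hn hu hρt hρn a = 0 ↔
    (a : Mat (Kv v)) ∈ scaled (quadSubring ht hn) (unifAlg v (Mat (Kv v))) 1 := by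
  obtain ⟨x, y, h⟩ := exists_eq_lin ht hn a
  have h1 (z : Ov v) : IsLocalRing.residue (Ov v) z = 0 ↔
      ‖(z : Kv v)‖ ≤ ‖(unif v : Kv v)‖ ^ 1 := by
    rw [residue_eq_zero_iff', ← inv_unif_mul_mem_iff, pow_one]
  rw [quadRed_eq ht hn hu hρt hρn h, h, mem_scaled_quadSubring ht hn hu, ← h1, ← h1,
    TrivSqZeroExt.ext_iff, fst_linRed, snd_linRed, fst_zero, snd_zero]
  constructor
  · rintro ⟨hx, hy⟩
    rw [hy, zero_mul, add_zero] at hx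
    exact ⟨hx, hy⟩
  · rintro ⟨hx, hy⟩
    rw [hx, hy, zero_mul, add_zero]
    exact ⟨rfl, rfl⟩

/-- The inclusion of `k_v[u]ˣ` in the matrix algebra. -/
def quadIncl (u : Mat (Kv v)) : QuadUnits u →* Mat (Kv v) := (Units.coeHom _).comp QuadUnits.toMat

theorem quadIncl_apply (s : QuadUnits u) : quadIncl u s = (s.toMat : Mat (Kv v)) := rfl

theorem quadIncl_injective : Function.Injective (quadIncl u) := fun _ _ h =>
  QuadUnits.toMat_injective u (Units.ext h)

theorem exists_of_isUnit_quadRed (a : quadSubring ht hn)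
    (h : IsUnit (quadRed ht hn hu hρt hρn a)) :
    ∃ g ∈ unitSubgroup (quadIncl u) (quadSubring ht hn), quadIncl u g = a := by
  obtain ⟨x, y, hxy⟩ := exists_eq_lin ht hn a
  rw [quadRed_eq ht hn hu hρt hρn hxy, isUnit_iff_isUnit_fst, fst_linRed] at h
  let t : Ov v := ⟨u.trace, ht⟩
  let n : Ov v := ⟨u.det, hn⟩
  let d : Ov v := x ^ 2 + x * y * t + y ^ 2 * n
  have hd : (d : Kv v) = (a : Mat (Kv v)).det := by
    rw [hxy, det_lin]
    rfl
  have hres : IsLocalRing.residue (Ov v) d ≠ 0 := by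
    have h2 : IsLocalRing.residue (Ov v) d = (IsLocalRing.residue (Ov v) x +
        IsLocalRing.residue (Ov v) y * ρ) ^ 2 := by
      simp only [d, map_add, map_mul, map_pow]
      rw [hρt, hρn]
      ring
    rw [h2]
    exact pow_ne_zero _ h.ne_zero
  have hd1 : ‖(d : Kv v)‖ = 1 :=
    (isUnit_iff_norm_eq_one v d).1 ((IsLocalRing.residue_ne_zero_iff_isUnit d).1 hres)
  have hdi : (d : Kv v)⁻¹ ∈ Ov v := by rw [← norm_le_one_iff, norm_inv, hd1, inv_one]
  have hd0 : (a : Mat (Kv v)).det ≠ 0 := by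
    rw [← hd]
    exact norm_ne_zero_iff.1 (by rw [hd1]; exact one_ne_zero)
  let A : (Mat (Kv v))ˣ := ⟨a, (a : Mat (Kv v))⁻¹, Matrix.mul_nonsing_inv _ hd0.isUnit,
    Matrix.nonsing_inv_mul _ hd0.isUnit⟩
  obtain ⟨g, hg⟩ := QuadUnits.exists_toMat_eq hu A (by
    change Commute (a : Mat (Kv v)) u
    rw [hxy]
    exact commute_lin u _ _)
  have hga : quadIncl u g = a := congrArg Units.val hg
  refine ⟨g, ⟨by rw [hga]; exact a.2, ?_⟩, hga⟩
  have hinv : quadIncl u g⁻¹ = (a : Mat (Kv v))⁻¹ := by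
    rw [quadIncl_apply, map_inv, hg]
    rfl
  have hd0' := hd0
  rw [hinv, hxy, lin_mul_inv _ _ (by rw [← hxy]; exact hd0), ← hxy, ← hd]
  refine ⟨_, ?_, _, ?_, rfl⟩
  · rw [div_eq_mul_inv]
    exact mul_mem (add_mem x.2 (mul_mem y.2 ht)) hdi
  · rw [div_eq_mul_inv]
    exact mul_mem (neg_mem y.2) hdi

theorem card_dualNumber : Nat.card (DualNumber (Res v)) = q v ^ 2 := by
  have h : Nat.card (Res v × Res v) = q v ^ 2 := by
    rw [Nat.card_prod, sq]
    rfl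
  exact h

theorem card_units_dualNumber : Nat.card (DualNumber (Res v))ˣ = (q v - 1) * q v := by
  let e : (DualNumber (Res v))ˣ → (Res v)ˣ × Res v := fun s =>
    (Units.map (fstHom (Res v) (Res v) (Res v)).toRingHom.toMonoidHom s, s.val.snd)
  have he : Function.Bijective e := by
    constructor
    · intro s t h
      refine Units.ext (TrivSqZeroExt.ext ?_ ?_)
      · exact congrArg (fun z : (Res v)ˣ × Res v => (z.1 : Res v)) h
      · exact congrArg (fun z : (Res v)ˣ × Res v => z.2) h
    · rintro ⟨a, b⟩
      have hu : IsUnit (inl (a : Res v) + inr b : DualNumber (Res v)) := by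
        rw [isUnit_iff_isUnit_fst]
        simp
      obtain ⟨s, hs⟩ := hu
      refine ⟨s, Prod.ext (Units.ext ?_) ?_⟩
      · change (s : DualNumber (Res v)).fst = a
        rw [hs]
        simp
      · change (s : DualNumber (Res v)).snd = b
        rw [hs]
        simp
  rw [Nat.card_eq_of_bijective e he, Nat.card_prod, Nat.card_units]
  rfl

/-- The units of `𝒪[u]` congruent to `1` modulo the `m`-th power of the uniformizer. -/
def congrQuad (m : ℕ) : Subgroup (QuadUnits u) :=
  congrSubgroup (quadIncl u) (quadSubring ht hn) (unifAlg_comm v) m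

theorem IsStandardRepresentative.coe_unitSubgroup_quadIncl (hstd : IsStandardRepresentative v u) :
    (unitSubgroup (quadIncl u) (quadSubring hstd.trace_mem hstd.det_mem) : Set (QuadUnits u)) =
      integralUnits v u := by
  have key (s : QuadUnits u) : quadIncl u s ∈ quadSubring hstd.trace_mem hstd.det_mem ↔
      IsIntegral (Ov v) (s.toMat : Mat (Kv v)) := by
    rw [quadIncl_apply]
    obtain ⟨x, y, h⟩ := (commute_iff hstd.1 _).1 s.commute
    rw [h, hstd.isIntegral_lin_iff]
    constructor
    · rintro ⟨x', hx', y', hy', h'⟩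
      obtain ⟨rfl, rfl⟩ := lin_injective hstd.1 h'
      exact ⟨hx', hy'⟩
    · rintro ⟨hx, hy⟩
      exact ⟨x, hx, y, hy, rfl⟩
  ext s
  exact and_congr (key s) (key s⁻¹)

theorem continuous_quadIncl : Continuous (quadIncl u) :=
  Units.continuous_val.comp (continuous_toMat u)

include hu in
theorem mem_congrQuad_iff {m : ℕ} {s : QuadUnits u} : s ∈ congrQuad ht hn m ↔
    s ∈ unitSubgroup (quadIncl u) (quadSubring ht hn) ∧
      ‖coordX u (s.toMat - 1 : Mat (Kv v))‖ ≤ ‖(unif v : Kv v)‖ ^ m ∧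
      ‖coordY u (s.toMat - 1 : Mat (Kv v))‖ ≤ ‖(unif v : Kv v)‖ ^ m := by
  refine and_congr Iff.rfl ?_
  rw [quadIncl_apply, ← mem_scaled_quadSubring ht hn hu,
    coord_eq hu (s.commute.sub_left (Commute.one_left u))]

theorem IsStandardRepresentative.isOpen_congrQuad (hstd : IsStandardRepresentative v u) (m : ℕ) :
    IsOpen (congrQuad hstd.trace_mem hstd.det_mem m : Set (QuadUnits u)) := by
  have hX : Continuous fun s : QuadUnits u => coordX u (s.toMat - 1 : Mat (Kv v)) :=
    (continuous_coordX u).comp (continuous_quadIncl.sub continuous_const)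
  have hY : Continuous fun s : QuadUnits u => coordY u (s.toMat - 1 : Mat (Kv v)) :=
    (continuous_coordY u).comp (continuous_quadIncl.sub continuous_const)
  have hball : IsOpen {x : Kv v | ‖x‖ ≤ ‖(unif v : Kv v)‖ ^ m} := by
    have h : {x : Kv v | ‖x‖ ≤ ‖(unif v : Kv v)‖ ^ m} =
        (fun x => ((unif v : Kv v) ^ m)⁻¹ * x) ⁻¹' (Ov v) := by
      ext x
      exact (inv_unif_mul_mem_iff v m x).symm
    rw [h]
    exact (isOpen_Ov v).preimage (continuous_const_mul _)
  have h : (congrQuad hstd.trace_mem hstd.det_mem m : Set (QuadUnits u)) = integralUnits v u ∩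
      ((fun s : QuadUnits u => coordX u (s.toMat - 1 : Mat (Kv v))) ⁻¹'
          {x : Kv v | ‖x‖ ≤ ‖(unif v : Kv v)‖ ^ m} ∩
        (fun s : QuadUnits u => coordY u (s.toMat - 1 : Mat (Kv v))) ⁻¹'
          {x : Kv v | ‖x‖ ≤ ‖(unif v : Kv v)‖ ^ m}) := by
    ext s
    rw [← hstd.coe_unitSubgroup_quadIncl]
    exact mem_congrQuad_iff _ _ hstd.1
  rw [h]
  exact hstd.isOpen_integralUnits.inter ((hball.preimage hX).inter (hball.preimage hY))

theorem IsStandardRepresentative.haarQuad_congrQuad (hstd : IsStandardRepresentative v u)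
    (hρt : IsLocalRing.residue (Ov v) ⟨u.trace, hstd.trace_mem⟩ = 2 * ρ)
    (hρn : IsLocalRing.residue (Ov v) ⟨u.det, hstd.det_mem⟩ = ρ ^ 2) (m : ℕ) :
    haarQuad v u (congrQuad hstd.trace_mem hstd.det_mem (m + 1)) =
      (((q v ^ 2) ^ m * ((q v - 1) * q v) : ℕ) : ℝ≥0∞)⁻¹ := by
  have := quadUnits_polishSpace hstd.1
  have := hstd.haarQuad_spec.1
  have hidx := relIndex_congrSubgroup (quadIncl u) (quadSubring hstd.trace_mem hstd.det_mem)
    (unifAlg_comm v) (quadRed _ _ hstd.1 hρt hρn)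
    (quadRed_surjective _ _ hstd.1 hρt hρn) (quadRed_eq_zero_iff _ _ hstd.1 hρt hρn)
    (unifAlg_mul_eq_zero v)
    ⟨unif v, (unif v).2, 0, zero_mem _, by
      rw [zero_smul, add_zero]
      exact Algebra.algebraMap_eq_smul_one _⟩
    (exists_of_isUnit_quadRed _ _ hstd.1 hρt hρn) quadIncl_injective m
  rw [card_dualNumber, card_units_dualNumber] at hidx
  have hq := one_lt_q v
  have hne : (q v ^ 2) ^ m * ((q v - 1) * q v) ≠ 0 := by
    have h4 : q v - 1 ≠ 0 := by omega
    have h6 : q v ≠ 0 := by omega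
    positivity
  have h := relIndex_mul_measure (haarQuad v u) (congrSubgroup_le (quadIncl u)
    (quadSubring hstd.trace_mem hstd.det_mem) (unifAlg_comm v) (m + 1))
    (hstd.isOpen_congrQuad (m + 1)).measurableSet (by rw [hidx]; exact hne)
  rw [hidx, hstd.coe_unitSubgroup_quadIncl, hstd.haarQuad_spec.2, mul_comm] at h
  exact ENNReal.eq_inv_of_mul_eq_one_left h

end QuadCongruence

/-! ### Conjugation to a companion matrix -/

section Conjugation

variable {F : Type*} [Field F]

theorem exists_conj_companion {u : Mat F} (hu : disc (w u) ≠ 0) :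
    ∃ h : (Mat F)ˣ, (h : Mat F) * u = companion u.trace u.det * h := by
  have key (a b : F) (hd : u 1 0 * a ^ 2 + (u 1 1 - u 0 0) * (a * b) - u 0 1 * b ^ 2 ≠ 0) :
      ∃ h : (Mat F)ˣ, (h : Mat F) * u = companion u.trace u.det * h := by
    let P : Mat F := !![a, u 0 0 * a + u 0 1 * b; b, u 1 0 * a + u 1 1 * b]
    have hP : P.det ≠ 0 := by
      rw [Matrix.det_fin_two_of]
      intro h0
      exact hd (by linear_combination h0)
    have hmul : u * P = P * companion u.trace u.det := by
      ext i j
      fin_cases i <;> fin_cases j <;>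
        simp [P, companion, Matrix.mul_apply, Fin.sum_univ_two, Matrix.trace_fin_two,
          Matrix.det_fin_two] <;> ring
    lift P to (Mat F)ˣ using (Matrix.isUnit_iff_isUnit_det P).2 hP.isUnit with P'
    refine ⟨P'⁻¹, ?_⟩
    rw [Units.inv_mul_eq_iff_eq_mul, ← mul_assoc, ← hmul, Units.mul_inv_cancel_right]
  by_cases h10 : u 1 0 = 0
  · by_cases h01 : u 0 1 = 0
    · refine key 1 1 ?_
      rw [h10, h01]
      intro h0
      apply hu
      rw [disc_w, Matrix.trace_fin_two, Matrix.det_fin_two, h10]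
      linear_combination (u 1 1 - u 0 0) * h0
    · exact key 0 1 (by simpa using h01)
  · exact key 1 0 (by simpa using h10)

theorem trace_companion (t n : F) : (companion t n).trace = t := by
  simp [companion, Matrix.trace_fin_two]

theorem conj_lin {u c : Mat F} {h : (Mat F)ˣ} (hc : (h : Mat F) * u = c * h) (x y : F) :
    (h : Mat F) * (x • 1 + y • u) * (h⁻¹ : (Mat F)ˣ) = x • 1 + y • c := by
  rw [mul_add, add_mul, mul_smul_comm, mul_smul_comm, mul_one, smul_mul_assoc, smul_mul_assoc,
    Units.mul_inv, hc, Units.mul_inv_cancel_right]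

theorem mkG_conj_g11 (h : (Mat F)ˣ) (g : PairGroup F) :
    (mkG h h⁻¹ 1 * g * (mkG h h⁻¹ 1)⁻¹).g11 = h * g.g11 * (h⁻¹ : (Mat F)ˣ) := rfl

theorem mkG_conj_g12 (h : (Mat F)ˣ) (g : PairGroup F) :
    (mkG h h⁻¹ 1 * g * (mkG h h⁻¹ 1)⁻¹).g12 = h * g.g12 * (h⁻¹ : (Mat F)ˣ) :=
  (mul_assoc _ _ _).symm

theorem mkG_conj_g2 (h : (Mat F)ˣ) (g : PairGroup F) :
    (mkG h h⁻¹ 1 * g * (mkG h h⁻¹ 1)⁻¹).g2 = g.g2 := by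
  change 1 * g.g2 * ((1⁻¹ : (Mat F)ˣ) : Mat F) = g.g2
  rw [inv_one, Units.val_one, one_mul, mul_one]

theorem mkG_conj_smul_w {u c : Mat F} {h : (Mat F)ˣ} (hc : (h : Mat F) * u = c * h) :
    mkG h h⁻¹ 1 • w u = w c := by
  rw [smul_w]
  have e (i j : Fin 2) : (mkG h h⁻¹ 1).g2 i j = (1 : Mat F) i j := rfl
  refine PairSpace.ext' ?_ ?_
  · change (h : Mat F) * ((mkG h h⁻¹ 1).g2 0 0 • 1 + (mkG h h⁻¹ 1).g2 0 1 • u) *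
      (h⁻¹ : (Mat F)ˣ) = 1
    rw [conj_lin hc, e, e]
    simp
  · change (h : Mat F) * ((mkG h h⁻¹ 1).g2 1 0 • 1 + (mkG h h⁻¹ 1).g2 1 1 • u) *
      (h⁻¹ : (Mat F)ˣ) = c
    rw [conj_lin hc, e, e]
    simp

/-- The non-identity coset of the stabilizer consists of the elements that conjugate `u` to its
conjugate. -/
theorem smul_w_eq_iff {u : Mat F} (h2 : (2 : F) ≠ 0) (hu : disc (w u) ≠ 0) {τ : PairGroup F}
    (hτ : τ ∈ MulAction.stabilizer (PairGroup F) (w u)) (hτu : τ.g11 * conjMat u = u * τ.g11)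
    (g : PairGroup F) : g • w u = w u ↔ g ∈ centralStab u ∨ τ⁻¹ * g ∈ centralStab u := by
  constructor
  · intro hg
    refine (stabilizer_dichotomy h2 hu hg).imp (fun h => ⟨hg, h⟩) fun h => ?_
    refine ⟨mul_mem (inv_mem hτ) hg, ?_⟩
    have hg' : g.g11 * u = conjMat u * g.g11 := by
      rw [conjMat] at h ⊢
      rw [sub_mul, ← h, mul_sub]
      simp
    have hτ' : ((τ.1⁻¹ : (Mat F)ˣ) : Mat F) * u = conjMat u * (τ.1⁻¹ : (Mat F)ˣ) := by
      rw [Units.inv_mul_eq_iff_eq_mul, ← mul_assoc]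
      change u = τ.g11 * conjMat u * _
      rw [hτu]
      exact (Units.mul_inv_cancel_right u τ.1).symm
    have hτ'' : ((τ.1⁻¹ : (Mat F)ˣ) : Mat F) * conjMat u = u * (τ.1⁻¹ : (Mat F)ˣ) := by
      rw [conjMat] at hτ' ⊢
      rw [mul_sub, hτ', sub_mul]
      simp
    change (τ.1⁻¹ : (Mat F)ˣ) * g.g11 * u = u * ((τ.1⁻¹ : (Mat F)ˣ) * g.g11)
    rw [mul_assoc, hg', ← mul_assoc, hτ'', mul_assoc]
  · rintro (h | h)
    · exact h.1
    · have := mul_mem hτ h.1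
      rwa [mul_inv_cancel_left] at this

theorem notMem_centralStab {u : Mat F} (h2 : (2 : F) ≠ 0) (hu : disc (w u) ≠ 0)
    {τ : PairGroup F} (hτu : τ.g11 * conjMat u = u * τ.g11) : τ ∉ centralStab u := by
  rintro ⟨-, h⟩
  refine conjMat_ne h2 hu (τ.1.isUnit.mul_left_cancel ?_)
  change τ.g11 * conjMat u = τ.g11 * u
  rw [hτu]
  exact h.symm

theorem g11_mul_conjMat {u : Mat F} {τ g : PairGroup F} (hτu : τ.g11 * conjMat u = u * τ.g11)
    (hg : τ⁻¹ * g ∈ centralStab u) : g.g11 * conjMat u = u * g.g11 := by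
  have e : g.g11 = τ.g11 * (τ⁻¹ * g).g11 := by rw [← g11_mul, mul_inv_cancel_left]
  have h : Commute (τ⁻¹ * g).g11 (conjMat u) := by
    rw [conjMat]
    exact ((Commute.one_right _).smul_right _).sub_right hg.2
  rw [e, mul_assoc, h.eq, ← mul_assoc, hτu, mul_assoc]

end Conjugation

section ConjCongruence

open NumberField NumberField.HeightOneSpectrum

variable {k : Type*} [Field k] [NumberField k] {v : HeightOneSpectrum (𝓞 k)}
  {u : Mat (Kv v)} {h : (Mat (Kv v))ˣ}

/-- The conjugate of a congruence subgroup by `(h, h⁻¹, 1)`. -/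
def conjK (h : (Mat (Kv v))ˣ) (m : ℕ) : Subgroup (PairGroup (Kv v)) :=
  (congrK v m).comap (MulAut.conj (mkG h h⁻¹ 1)).toMonoidHom

theorem mem_conjK {m : ℕ} {g : PairGroup (Kv v)} :
    g ∈ conjK h m ↔ mkG h h⁻¹ 1 * g * (mkG h h⁻¹ 1)⁻¹ ∈ congrK v m := Iff.rfl

theorem isOpen_conjK (h : (Mat (Kv v))ˣ) (m : ℕ) :
    IsOpen (conjK h m : Set (PairGroup (Kv v))) :=
  (isOpen_congrK v m).preimage
    ((continuous_mul_const (mkG h h⁻¹ 1)⁻¹).comp (continuous_const_mul (mkG h h⁻¹ 1)))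

theorem isCompact_conjK (h : (Mat (Kv v))ˣ) (m : ℕ) :
    IsCompact (conjK h m : Set (PairGroup (Kv v))) :=
  (((Homeomorph.mulLeft (mkG h h⁻¹ 1)).trans
    (Homeomorph.mulRight (mkG h h⁻¹ 1)⁻¹)).isCompact_preimage).2 (isCompact_congrK v m)

theorem haarG_conjK (h : (Mat (Kv v))ˣ) (m : ℕ) :
    haarG v (conjK h m) = haarG v (congrK v m) :=
  haarG_conj v (mkG h h⁻¹ 1) (congrK v m)

theorem lin_companion_mem_matBall_iff {t n : Kv v} (ht : t ∈ Ov v) (hn : n ∈ Ov v) {m : ℕ}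
    {x y : Kv v} : x • 1 + y • companion t n ∈ matBall v m ↔
      ‖x‖ ≤ ‖(unif v : Kv v)‖ ^ m ∧ ‖y‖ ≤ ‖(unif v : Kv v)‖ ^ m := by
  constructor
  · intro h
    have h0 := h 0 0
    have h1 := h 1 0
    simp [companion] at h0 h1
    exact ⟨h0, h1⟩
  · rintro ⟨hx, hy⟩
    exact add_mem (smul_mem_matBall (n := 0) hx one_mem_matBall_zero)
      (smul_mem_matBall (n := 0) hy ((mem_matBall_zero v).2 (companion_mem_intMat ht hn)))

variable (ht : u.trace ∈ Ov v) (hn : u.det ∈ Ov v) (hu : disc (w u) ≠ 0)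
  (hh : (h : Mat (Kv v)) * u = companion u.trace u.det * h)

include ht hn hu hh in
theorem conj_mem_matBall_iff {m : ℕ} {a : Mat (Kv v)} (ha : Commute a u) :
    h * a * (h⁻¹ : (Mat (Kv v))ˣ) ∈ matBall v m ↔
      ‖coordX u a‖ ≤ ‖(unif v : Kv v)‖ ^ m ∧ ‖coordY u a‖ ≤ ‖(unif v : Kv v)‖ ^ m := by
  conv_lhs => rw [← coord_eq hu ha, conj_lin hh]
  exact lin_companion_mem_matBall_iff ht hn

theorem mem_quadSubring_iff (hu : disc (w u) ≠ 0) {a : Mat (Kv v)} (ha : Commute a u) :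
    a ∈ quadSubring ht hn ↔ ‖coordX u a‖ ≤ 1 ∧ ‖coordY u a‖ ≤ 1 := by
  rw [norm_le_one_iff, norm_le_one_iff]
  refine ⟨coord_mem_of_mem_quadSubring ht hn hu, fun h => ?_⟩
  exact ⟨_, h.1, _, h.2, (coord_eq hu ha).symm⟩

theorem gMat_mem_intMat {s : Mat (Kv v)} (hx : ‖coordX u s⁻¹‖ ≤ 1) (hy : ‖coordY u s⁻¹‖ ≤ 1)
    (ht : u.trace ∈ Ov v) (hn : u.det ∈ Ov v) : gMat u s ∈ intMat v := by
  rw [norm_le_one_iff] at hx hy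
  intro i j
  fin_cases i <;> fin_cases j
  · exact hx
  · exact hy
  · exact mul_mem (neg_mem hn) hy
  · exact add_mem hx (mul_mem ht hy)

theorem coord_sub_one (hu : disc (w u) ≠ 0) {a : Mat (Kv v)} (ha : Commute a u) :
    coordX u (a - 1) = coordX u a - 1 ∧ coordY u (a - 1) = coordY u a := by
  obtain ⟨x, y, rfl⟩ := (commute_iff hu a).1 ha
  have e : x • (1 : Mat (Kv v)) + y • u - 1 = (x - 1) • 1 + y • u := by module
  rw [e, coordX_lin hu, coordX_lin hu, coordY_lin hu, coordY_lin hu]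
  exact ⟨rfl, rfl⟩

theorem toMat_mul_inv (s : QuadUnits u × QuadUnits u) :
    ((s.1.toMat : Mat (Kv v)) * (s.2.toMat : Mat (Kv v)))⁻¹ = quadIncl u (s.1 * s.2)⁻¹ := by
  rw [quadIncl_apply, map_inv, map_mul, Matrix.coe_units_inv, Units.val_mul]

include hh hu ht hn in
theorem conj_psi_integral {s : QuadUnits u × QuadUnits u}
    (h₁ : s.1 ∈ unitSubgroup (quadIncl u) (quadSubring ht hn))
    (h₂ : s.2 ∈ unitSubgroup (quadIncl u) (quadSubring ht hn)) :
    (mkG h h⁻¹ 1 * psi u s * (mkG h h⁻¹ 1)⁻¹).g11 ∈ intMat v ∧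
      (mkG h h⁻¹ 1 * psi u s * (mkG h h⁻¹ 1)⁻¹).g12 ∈ intMat v ∧
      (mkG h h⁻¹ 1 * psi u s * (mkG h h⁻¹ 1)⁻¹).g2 ∈ intMat v := by
  have key {r : QuadUnits u} (hr : r ∈ unitSubgroup (quadIncl u) (quadSubring ht hn)) :
      ‖coordX u (quadIncl u r)‖ ≤ 1 ∧ ‖coordY u (quadIncl u r)‖ ≤ 1 :=
    (mem_quadSubring_iff ht hn hu r.commute).1 hr.1
  refine ⟨?_, ?_, ?_⟩
  · rw [mkG_conj_g11, ← mem_matBall_zero, psi_g11,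
      conj_mem_matBall_iff ht hn hu hh s.1.commute, pow_zero]
    exact key h₁
  · rw [mkG_conj_g12, ← mem_matBall_zero, psi_g12,
      conj_mem_matBall_iff ht hn hu hh s.2.commute, pow_zero]
    exact key h₂
  · rw [mkG_conj_g2, psi_g2 hu]
    have := key (inv_mem (mul_mem h₁ h₂))
    exact gMat_mem_intMat (by rw [toMat_mul_inv]; exact this.1)
      (by rw [toMat_mul_inv]; exact this.2) ht hn

include hu hh in
theorem preimage_psi_conjK (m : ℕ) : psi u ⁻¹' (conjK h m) =
    (congrQuad ht hn m : Set (QuadUnits u)) ×ˢ (congrQuad ht hn m : Set (QuadUnits u)) := by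
  have hinv (s : QuadUnits u × QuadUnits u) : (mkG h h⁻¹ 1 * psi u s * (mkG h h⁻¹ 1)⁻¹)⁻¹ =
      mkG h h⁻¹ 1 * psi u s⁻¹ * (mkG h h⁻¹ 1)⁻¹ := by
    rw [psi_inv hu]
    group
  have hsub (a : Mat (Kv v)) : (h : Mat (Kv v)) * a * (h⁻¹ : (Mat (Kv v))ˣ) - 1 =
      h * (a - 1) * (h⁻¹ : (Mat (Kv v))ˣ) := by
    rw [mul_sub, sub_mul, mul_one, Units.mul_inv]
  have hco (r : QuadUnits u) : Commute ((r.toMat : Mat (Kv v)) - 1) u :=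
    r.commute.sub_left (Commute.one_left u)
  ext s
  rw [Set.mem_preimage, Set.mem_prod, SetLike.mem_coe, SetLike.mem_coe, SetLike.mem_coe, mem_conjK,
    mem_congrK_iff]
  constructor
  · rintro ⟨h0, h1, h2, -⟩
    rw [mkG_conj_g11, psi_g11, hsub, conj_mem_matBall_iff ht hn hu hh (hco _)] at h1
    rw [mkG_conj_g12, psi_g12, hsub, conj_mem_matBall_iff ht hn hu hh (hco _)] at h2
    rw [mem_congrQuad_iff ht hn hu, mem_congrQuad_iff ht hn hu]
    have e1 (r : QuadUnits u) (hr : ∀ i j, ((h : Mat (Kv v)) * r.toMat *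
        (h⁻¹ : (Mat (Kv v))ˣ)) i j ∈ Ov v) : quadIncl u r ∈ quadSubring ht hn := by
      have hr' := (mem_matBall_zero v).2 hr
      rw [conj_mem_matBall_iff ht hn hu hh r.commute, pow_zero] at hr'
      exact (mem_quadSubring_iff ht hn hu r.commute).2 hr'
    refine ⟨⟨⟨e1 _ fun i j => ?_, e1 _ fun i j => ?_⟩, h1⟩,
      ⟨e1 _ fun i j => ?_, e1 _ fun i j => ?_⟩, h2⟩
    · exact (h0 i j).1.1
    · have := (h0 i j).1.2
      rw [hinv] at this
      exact this
    · have := (h0 i j).2.1.1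
      rw [mkG_conj_g12] at this
      exact this
    · have := (h0 i j).2.1.2
      rw [hinv, mkG_conj_g12] at this
      exact this
  · rintro ⟨h1, h2⟩
    have h3 := inv_mem (mul_mem h1 h2)
    rw [mem_congrQuad_iff ht hn hu] at h1 h2 h3
    have i1 := conj_psi_integral ht hn hu hh (s := s) h1.1 h2.1
    have i2 := conj_psi_integral ht hn hu hh (s := s⁻¹) (inv_mem h1.1) (inv_mem h2.1)
    rw [← hinv] at i2
    refine ⟨fun i j => ⟨⟨i1.1 i j, i2.1 i j⟩, ⟨i1.2.1 i j, i2.2.1 i j⟩, i1.2.2 i j, i2.2.2 i j⟩,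
      ?_, ?_, ?_⟩
    · rw [mkG_conj_g11, psi_g11, hsub, conj_mem_matBall_iff ht hn hu hh (hco _)]
      exact h1.2
    · rw [mkG_conj_g12, psi_g12, hsub, conj_mem_matBall_iff ht hn hu hh (hco _)]
      exact h2.2
    · rw [mkG_conj_g2, psi_g2 hu]
      obtain ⟨e1, e2⟩ := coord_sub_one hu ((s.1 * s.2)⁻¹).commute
      have h4 := h3.2
      rw [e1, e2] at h4
      have e3 := toMat_mul_inv s
      rw [quadIncl_apply] at e3
      have hY := h4.2
      have hmul {c y : Kv v} (hc : c ∈ Ov v) (hy : ‖y‖ ≤ ‖(unif v : Kv v)‖ ^ m) :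
          ‖c * y‖ ≤ ‖(unif v : Kv v)‖ ^ m := by
        rw [norm_mul]
        exact (mul_le_of_le_one_left (norm_nonneg _) ((norm_le_one_iff v c).2 hc)).trans hy
      rw [gMat, e3]
      intro i j
      fin_cases i <;> fin_cases j
      · exact h4.1
      · change ‖coordY u _ - 0‖ ≤ _
        rw [sub_zero]
        exact hY
      · change ‖-u.det * coordY u _ - 0‖ ≤ _
        rw [sub_zero]
        exact hmul (neg_mem hn) hY
      · change ‖coordX u _ + u.trace * coordY u _ - 1‖ ≤ _
        rw [add_sub_right_comm]
        exact (IsUltrametricDist.norm_add_le_max _ _).trans (max_le h4.1 (hmul ht hY))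

/-- For large `m`, the conjugated congruence subgroup contains no element that conjugates `u` to
its conjugate. -/
theorem g11_mul_conjMat_ne (ht : u.trace ∈ Ov v) (hn : u.det ∈ Ov v)
    (hh : (h : Mat (Kv v)) * u = companion u.trace u.det * h) {m : ℕ}
    (hm : ‖(unif v : Kv v)‖ ^ m < ‖(2 : Kv v)‖) {g : PairGroup (Kv v)} (hg : g ∈ conjK h m) :
    g.g11 * conjMat u ≠ u * g.g11 := by
  intro hgu
  have h1 := ((mem_congrK_iff v).1 (mem_conjK.1 hg)).2.1
  rw [mkG_conj_g11] at h1
  set c := companion u.trace u.det with hc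
  have hcc : (h : Mat (Kv v)) * conjMat u = conjMat c * h := by
    rw [conjMat, conjMat, mul_sub, hh, sub_mul, hc, trace_companion]
    simp
  have hc0 : c ∈ matBall v 0 := (mem_matBall_zero v).2 (companion_mem_intMat ht hn)
  have hc1 : conjMat c ∈ matBall v 0 := by
    rw [conjMat, hc, trace_companion]
    refine sub_mem (smul_mem_matBall (m := 0) ?_ one_mem_matBall_zero) hc0
    rwa [pow_zero, norm_le_one_iff]
  obtain ⟨a, ha⟩ : ∃ a, a = (h : Mat (Kv v)) * g.g11 * (h⁻¹ : (Mat (Kv v))ˣ) := ⟨_, rfl⟩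
  rw [← ha] at h1
  have e : a * conjMat c = c * a := by
    have e1 : conjMat c = h * conjMat u * (h⁻¹ : (Mat (Kv v))ˣ) := by
      rw [hcc, Units.mul_inv_cancel_right]
    have e2 : c * h = h * u := hh.symm
    rw [ha, e1, ← mul_assoc c, ← mul_assoc c, e2, mul_assoc (h : Mat (Kv v)) u, ← hgu]
    simp only [mul_assoc, Units.inv_mul_cancel_left]
  have h2 : conjMat c - c = c * (a - 1) - (a - 1) * conjMat c := by
    rw [mul_sub, sub_mul, e, mul_one, one_mul]
    abel
  have h3 : conjMat c - c ∈ matBall v m := by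
    rw [h2]
    exact sub_mem (mul_mem_matBall_left hc0 h1) (mul_mem_matBall_right h1 hc1)
  have h4 : (conjMat c - c) 1 0 = -2 := by
    simp [conjMat, hc, companion]
    norm_num
  have h5 := h3 1 0
  rw [h4, norm_neg] at h5
  exact absurd h5 (not_le.2 hm)

end ConjCongruence

/-! ### The orbital constant -/

section OrbitalConstant

open scoped NNReal Pointwise
open NumberField NumberField.HeightOneSpectrum

variable {k : Type*} [Field k] [NumberField k] {v : HeightOneSpectrum (𝓞 k)}
  {u : Mat (Kv v)} {h : (Mat (Kv v))ˣ}

theorem norm_det_of_mem_maxCompact {g : PairGroup (Kv v)} (hg : g ∈ maxCompact v) :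
    ‖g.g11.det * g.g12.det * g.g2.det‖ = 1 := by
  have key {a b : Mat (Kv v)} (ha : a ∈ intMat v) (hb : b ∈ intMat v) (hab : a * b = 1) :
      ‖a.det‖ = 1 := by
    have h1 := (norm_le_one_iff v _).2 (det_mem_of_intMat v ha)
    have h2 := (norm_le_one_iff v _).2 (det_mem_of_intMat v hb)
    have h3 : ‖a.det‖ * ‖b.det‖ = 1 := by rw [← norm_mul, ← Matrix.det_mul, hab]; simp
    exact eq_of_le_of_ge h1 (by
      rw [← h3]
      exact mul_le_of_le_one_right (norm_nonneg _) h2)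
  rw [norm_mul, norm_mul,
    key (fun i j => (hg i j).1.1) (fun i j => (hg i j).1.2) (by
      rw [← g11_mul, mul_inv_cancel, g11_one]),
    key (fun i j => (hg i j).2.1.1) (fun i j => (hg i j).2.1.2) (by
      rw [← g12_mul, inv_mul_cancel, g12_one]),
    key (fun i j => (hg i j).2.2.1) (fun i j => (hg i j).2.2.2) (by
      rw [← g2_mul, mul_inv_cancel, g2_one])]
  norm_num

theorem discDensity_of_mem_congrK {m : ℕ} {g : PairGroup (Kv v)} (hg : g ∈ congrK v m)
    (x : PairSpace (Kv v)) : discDensity v (g • x) = discDensity v x := by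
  rw [discDensity, discDensity, disc_smul, norm_mul, norm_pow,
    norm_det_of_mem_maxCompact ((mem_congrK_iff v).1 hg).1, one_pow, one_mul]

theorem image_conjK {c : Mat (Kv v)} (hc : (h : Mat (Kv v)) * u = c * h) (m : ℕ) :
    (fun g : PairGroup (Kv v) => g • w u) '' (conjK h m) = (mkG h h⁻¹ 1 • ·) ⁻¹'
      ((fun g : PairGroup (Kv v) => g • w c) '' (congrK v m)) := by
  have hγ := mkG_conj_smul_w hc
  ext y
  constructor
  · rintro ⟨g, hg, rfl⟩
    refine ⟨_, mem_conjK.1 hg, ?_⟩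
    change (mkG h h⁻¹ 1 * g * (mkG h h⁻¹ 1)⁻¹) • w c = mkG h h⁻¹ 1 • g • w u
    rw [← hγ, ← mul_smul, ← mul_smul, inv_mul_cancel_right]
  · rintro ⟨g, hg, hy⟩
    refine ⟨(mkG h h⁻¹ 1)⁻¹ * g * mkG h h⁻¹ 1, ?_, ?_⟩
    · rw [SetLike.mem_coe, mem_conjK]
      have e : mkG h h⁻¹ 1 * ((mkG h h⁻¹ 1)⁻¹ * g * mkG h h⁻¹ 1) * (mkG h h⁻¹ 1)⁻¹ = g := by group
      rw [e]
      exact hg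
    · change ((mkG h h⁻¹ 1)⁻¹ * g * mkG h h⁻¹ 1) • w u = y
      have hy' : g • w c = mkG h h⁻¹ 1 • y := hy
      rw [mul_smul, mul_smul, hγ, hy', inv_smul_smul]

/-- The orbit of an open set of group elements being open, so is the whole orbit. -/
theorem isOpen_orbit_of_isOpen_image {G X : Type*} [Group G] [TopologicalSpace X] [MulAction G X]
    [ContinuousConstSMul G X] {x : X} {U : Set G} (h1 : 1 ∈ U)
    (hU : IsOpen ((fun g : G => g • x) '' U)) : IsOpen (MulAction.orbit G x) := by
  have h : MulAction.orbit G x = ⋃ g : G, g • ((fun g : G => g • x) '' U) := by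
    ext y
    rw [Set.mem_iUnion]
    constructor
    · rintro ⟨g, rfl⟩
      exact ⟨g, x, ⟨1, h1, one_smul G x⟩, rfl⟩
    · rintro ⟨g, _, ⟨g', -, rfl⟩, rfl⟩
      exact ⟨g * g', mul_smul g g' x⟩
  rw [h]
  exact isOpen_iUnion fun g => hU.smul g

theorem orbitNu_image_conjK {t n : Kv v} (hd : disc (w (companion t n)) ≠ 0) (ht : t ∈ Ov v)
    (hn : n ∈ Ov v) (hh : (h : Mat (Kv v)) * u = companion t n * h) {m : ℕ}
    (him : (fun g : PairGroup (Kv v) => g • w (companion t n)) '' (congrK v m) =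
      {y | y - w (companion t n) ∈ tangent v (companion t n) m}) :
    MeasurableSet (MulAction.orbit (PairGroup (Kv v)) (w u)) ∧
    MeasurableSet ((fun g : PairGroup (Kv v) => g • w u) '' (conjK h m)) ∧
    orbitNu v (w u) ((fun g : PairGroup (Kv v) => g • w u) '' (conjK h m)) =
      discDensity v (w (companion t n)) * ((‖(unif v : Kv v)‖₊ ^ (8 * m) : ℝ≥0) *
        ‖disc (w (companion t n))‖₊) := by
  set c := companion t n
  have hopen : IsOpen ((fun g : PairGroup (Kv v) => g • w c) '' (congrK v m)) := by
    rw [him]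
    exact (isOpen_tangent hd ht hn m).preimage (continuous_id.sub continuous_const)
  have hopen' : IsOpen ((fun g : PairGroup (Kv v) => g • w u) '' (conjK h m)) := by
    rw [image_conjK hh]
    exact hopen.preimage (continuous_const_smul _)
  have hO := (isOpen_orbit_of_isOpen_image (one_mem (conjK h m)) hopen').measurableSet
  refine ⟨hO, hopen'.measurableSet, ?_⟩
  have horb : MulAction.orbit (PairGroup (Kv v)) (w c) =
      MulAction.orbit (PairGroup (Kv v)) (w u) :=
    MulAction.orbit_eq_iff.2 ⟨_, mkG_conj_smul_w hh⟩
  have hsub : (fun g : PairGroup (Kv v) => g • w c) '' (congrK v m) ⊆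
      MulAction.orbit (PairGroup (Kv v)) (w u) := by
    rw [← horb]
    rintro _ ⟨g, -, rfl⟩
    exact ⟨g, rfl⟩
  have hvol : haarV v ((fun g : PairGroup (Kv v) => g • w c) '' (congrK v m)) =
      (‖(unif v : Kv v)‖₊ ^ (8 * m) : ℝ≥0) * ‖disc (w c)‖₊ := by
    rw [him, ← haarV_tangent hd ht hn m]
    have e : {y | y - w c ∈ tangent v c m} = (· + -w c) ⁻¹' (tangent v c m) := by
      ext y
      change y - w c ∈ tangent v c m ↔ y + -w c ∈ tangent v c m
      rw [sub_eq_add_neg]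
    rw [e, measure_preimage_add_right]
  rw [image_conjK hh, ← Measure.map_apply (measurable_const_smul _) hopen.measurableSet,
    map_smul_orbitNu v _ hO, orbitNu, withDensity_apply _ hopen.measurableSet,
    Measure.restrict_restrict_of_subset hsub, ← hvol, ← setLIntegral_const]
  refine setLIntegral_congr_fun hopen.measurableSet ?_
  rintro _ ⟨g, hg, rfl⟩
  exact discDensity_of_mem_congrK hg _

theorem integrable_orbitNu_iff (x : PairSpace (Kv v)) (f : PairSpace (Kv v) → ℂ) :
    Integrable f (orbitNu v x) ↔ IntegrableOn (fun y => f y * ((‖disc y‖ ^ 2)⁻¹ : ℝ))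
      (MulAction.orbit (PairGroup (Kv v)) x) (haarV v) := by
  rw [orbitNu, integrable_withDensity_iff_integrable_smul' (measurable_discDensity v)
    (Filter.Eventually.of_forall fun _ => ENNReal.ofReal_lt_top), IntegrableOn]
  refine integrable_congr (Filter.Eventually.of_forall fun y => ?_)
  change (discDensity v y).toReal • f y = f y * ((‖disc y‖ ^ 2)⁻¹ : ℝ)
  rw [discDensity, ENNReal.toReal_ofReal (by positivity), mul_comm, Complex.real_smul]

theorem integral_orbitNu (x : PairSpace (Kv v)) (f : PairSpace (Kv v) → ℂ) :
    ∫ y, f y ∂(orbitNu v x) = ∫ y in MulAction.orbit (PairGroup (Kv v)) x,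
      f y * ((‖disc y‖ ^ 2)⁻¹ : ℝ) ∂(haarV v) := by
  rw [orbitNu, integral_withDensity_eq_integral_toReal_smul (measurable_discDensity v)
    (Filter.Eventually.of_forall fun _ => ENNReal.ofReal_lt_top)]
  refine integral_congr_ae (Filter.Eventually.of_forall fun y => ?_)
  change (discDensity v y).toReal • f y = f y * ((‖disc y‖ ^ 2)⁻¹ : ℝ)
  rw [discDensity, ENNReal.toReal_ofReal (by positivity), mul_comm, Complex.real_smul]

/-- A subgroup on which all the volumes are known determines the quotient measure. -/
theorem quotientMeasure_eq {τ : PairGroup (Kv v)} {U : Subgroup (PairGroup (Kv v))}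
    [SFinite (stabilizerMeasure v u)] [IsFiniteMeasureOnCompacts (stabilizerMeasure v u)]
    (hl : stabilizerMeasure v u ≠ 0)
    (D : OrbitMeasures (w u) (identityComponent (w u)) τ (stabilizerMeasure v u)
      (orbitNu v (w u)))
    (hUo : IsOpen (U : Set (PairGroup (Kv v)))) (hUc : IsCompact (U : Set (PairGroup (Kv v))))
    (hUx : MeasurableSet ((fun g : PairGroup (Kv v) => g • w u) '' U))
    (hτ : ∀ g ∈ U, τ⁻¹ * g ∉ identityComponent (w u))
    {β : ℝ≥0∞} (hβ : stabilizerMeasure v u U *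
      orbitNu v (w u) ((fun g : PairGroup (Kv v) => g • w u) '' U) = β)
    (hβ0 : β ≠ 0) (hβtop : β ≠ ∞) :
    quotientMeasure v u = (haarG v U / β) •
      (orbitNu v (w u)).bind (fibreCount (w u) (identityComponent (w u)) τ) := by
  have hb : (orbitNu v (w u)).bind (fibreMeasure (w u) τ (stabilizerMeasure v u)) U = β := by
    rw [D.bind_fibreMeasure_subgroup U hUo.measurableSet hUx hτ, hβ]
  have hG := D.eq_smul_bind (haarG v) hUc
    ⟨1, by rw [hUo.interior_eq]; exact one_mem U⟩ (by rwa [hb]) (by rwa [hb])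
  rw [hb] at hG
  have hq : IsQuotientMeasure v u ((haarG v U / β) •
      (orbitNu v (w u)).bind (fibreCount (w u) (identityComponent (w u)) τ)) := by
    refine ⟨D.smulInvariantMeasure_bind _, fun f hf => ?_⟩
    rw [lintegral_smul_measure, D.lintegral_bind_fibreCount hf]
    conv_lhs => rw [hG]
    rw [lintegral_smul_measure]
  have huniq : ∃! μ', IsQuotientMeasure v u μ' :=
    ⟨_, hq, fun μ' hμ' => D.quotientMeasure_unique hl hμ'.2 hq.2⟩
  rw [quotientMeasure, dif_pos huniq]
  exact huniq.unique huniq.choose_spec.1 hq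

theorem orbitalConstant_eq {τ : PairGroup (Kv v)} [SFinite (stabilizerMeasure v u)]
    (D : OrbitMeasures (w u) (identityComponent (w u)) τ (stabilizerMeasure v u)
      (orbitNu v (w u))) {c : ℝ≥0∞} (hc0 : c ≠ 0) (hctop : c ≠ ∞)
    (hq : quotientMeasure v u = c •
      (orbitNu v (w u)).bind (fibreCount (w u) (identityComponent (w u)) τ))
    {B : Set (PairSpace (Kv v))} (hB : MeasurableSet B) (hB0 : orbitNu v (w u) B ≠ 0)
    (hBtop : orbitNu v (w u) B ≠ ∞) : orbitalConstant v u = 2 * c.toReal := by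
  have hmap := D.map_bind_fibreCount c
  rw [← hq] at hmap
  have hm := D.measurable_out_smul
  have h2c : 2 * c ≠ ∞ := ENNReal.mul_ne_top (by norm_num) hctop
  have hmain : IsOrbitalConstant v u (2 * c.toReal) := by
    refine ⟨mul_pos two_pos (ENNReal.toReal_pos hc0 hctop), fun f hf => ?_⟩
    have hf' : Integrable f ((quotientMeasure v u).map
        fun c : PairGroup (Kv v) ⧸ identityComponent (w u) => c.out • w u) := by
      rw [hmap]
      exact ((integrable_orbitNu_iff _ f).2 hf).smul_measure h2c
    refine ⟨(integrable_map_measure hf'.1 hm.aemeasurable).1 hf', ?_⟩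
    rw [← integral_map hm.aemeasurable hf'.1, hmap, integral_smul_measure, integral_orbitNu,
      ENNReal.toReal_mul, Complex.real_smul]
    norm_num
  have huniq : ∃! b, IsOrbitalConstant v u b := by
    refine ⟨_, hmain, fun b hb => ?_⟩
    let f : PairSpace (Kv v) → ℂ := B.indicator fun _ => 1
    have hfi : Integrable f (orbitNu v (w u)) :=
      (integrable_indicator_iff hB).2 (integrableOn_const hBtop)
    have hf := (integrable_orbitNu_iff _ f).1 hfi
    have h1 := (hb.2 f hf).2.symm.trans (hmain.2 f hf).2
    rw [← integral_orbitNu, integral_indicator_const _ hB, Complex.real_smul, mul_one] at h1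
    have h3 : (((orbitNu v (w u)).real B : ℝ) : ℂ) ≠ 0 :=
      Complex.ofReal_ne_zero.2 (ENNReal.toReal_ne_zero.2 ⟨hB0, hBtop⟩)
    exact Complex.ofReal_injective (mul_right_cancel₀ h3 (by exact_mod_cast h1))
  rw [orbitalConstant, dif_pos huniq]
  exact huniq.unique huniq.choose_spec.1 hmain

theorem IsStandardRepresentative.stabilizerMeasure_conjK (hstd : IsStandardRepresentative v u)
    {ρ : Res v} (hρt : IsLocalRing.residue (Ov v) ⟨u.trace, hstd.trace_mem⟩ = 2 * ρ)
    (hρn : IsLocalRing.residue (Ov v) ⟨u.det, hstd.det_mem⟩ = ρ ^ 2)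
    (hh : (h : Mat (Kv v)) * u = companion u.trace u.det * h) (m : ℕ) :
    stabilizerMeasure v u (conjK h (m + 1)) =
      ((((q v ^ 2) ^ m * ((q v - 1) * q v)) ^ 2 : ℕ) : ℝ≥0∞)⁻¹ := by
  have := quadUnits_polishSpace hstd.1
  have := quadUnits_locallyCompactSpace hstd.1
  have := hstd.haarQuad_spec.1
  rw [hstd.stabilizerMeasure_apply (isOpen_conjK h (m + 1)).measurableSet,
    preimage_psi_conjK hstd.trace_mem hstd.det_mem hstd.1 hh, Measure.prod_prod,
    hstd.haarQuad_congrQuad hρt hρn, ← sq, Nat.cast_pow, ENNReal.inv_pow]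

theorem exists_pow_norm_unif_lt {ε : ℝ} (hε : 0 < ε) (c : ℕ) :
    ∃ m, c ≤ m ∧ ‖(unif v : Kv v)‖ ^ (m + 1) < ε := by
  obtain ⟨n, hn⟩ := exists_pow_lt_of_lt_one hε (norm_unif_lt_one (v := v))
  exact ⟨max c n, le_max_left _ _, (pow_le_pow_of_le_one (norm_nonneg _) norm_unif_lt_one.le
    ((le_max_right c n).trans (Nat.le_succ _))).trans_lt hn⟩

theorem IsStandardRepresentative.orbitMeasures (hstd : IsStandardRepresentative v u)
    (hO : MeasurableSet (MulAction.orbit (PairGroup (Kv v)) (w u))) :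
    ∃ τ : PairGroup (Kv v), τ.g11 * conjMat u = u * τ.g11 ∧
      OrbitMeasures (w u) (centralStab u) τ (stabilizerMeasure v u) (orbitNu v (w u)) := by
  obtain ⟨τ, hτ, hτu⟩ := exists_mem_stabilizer_conj u
  have h2 := two_ne_zero_Kv v
  exact ⟨τ, hτu, smul_w_eq_iff h2 hstd.1 hτ hτu, notMem_centralStab h2 hstd.1 hτu,
    fun _ hh => hstd.map_mul_stabilizerMeasure hh, hstd.ae_mem_centralStab, hO,
    map_smul_orbitNu v _ hO, ae_mem_orbitNu v _ hO⟩

theorem volume_identity {Q d : ℝ} (hQ : 1 < Q) (hd : 0 < d) (m : ℕ) :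
    d ^ 2 / (2 * ((((Q ^ 4) ^ m * ((Q ^ 2 - 1) * (Q ^ 2 - Q))) ^ 3)⁻¹ /
      ((((Q ^ 2) ^ m * ((Q - 1) * Q)) ^ 2)⁻¹ * ((d ^ 2)⁻¹ * (Q⁻¹ ^ (8 * (m + 1)) * d))))) =
    2⁻¹ * d * (1 - Q⁻¹) * (1 - (Q ^ 2)⁻¹) ^ 3 := by
  have h0 : Q ≠ 0 := by positivity
  have h1 : Q - 1 ≠ 0 := (sub_pos.2 hQ).ne'
  have h2 : Q ^ 2 - 1 ≠ 0 := (sub_pos.2 (one_lt_pow₀ hQ two_ne_zero)).ne'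
  have h3 : Q ^ 2 - Q = Q * (Q - 1) := by ring
  have h4 : Q⁻¹ ^ (8 * (m + 1)) = ((Q ^ m) ^ 8 * Q ^ 8)⁻¹ := by
    rw [inv_pow, mul_add, pow_add, mul_comm 8 m, pow_mul]
  have h5 : (Q ^ 4) ^ m = (Q ^ m) ^ 4 := by rw [← pow_mul, ← pow_mul, mul_comm]
  have h6 : (Q ^ 2) ^ m = (Q ^ m) ^ 2 := by rw [← pow_mul, ← pow_mul, mul_comm]
  rw [h3, h4, h5, h6]
  have h7 : Q ^ m ≠ 0 := pow_ne_zero m h0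
  generalize Q ^ m = R at h7
  field_simp

theorem IsStandardRepresentative.localDensity_eq (hstd : IsStandardRepresentative v u)
    {ρ : Res v} (hρt : IsLocalRing.residue (Ov v) ⟨u.trace, hstd.trace_mem⟩ = 2 * ρ)
    (hρn : IsLocalRing.residue (Ov v) ⟨u.det, hstd.det_mem⟩ = ρ ^ 2) :
    localDensity v u = 2⁻¹ * ‖disc (w u)‖ * (1 - (q v : ℝ)⁻¹) * (1 - ((q v : ℝ) ^ 2)⁻¹) ^ 3 := by
  have ht := hstd.trace_mem
  have hn := hstd.det_mem
  obtain ⟨h, hh⟩ := exists_conj_companion hstd.1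
  have hdisc : disc (w (companion u.trace u.det)) = disc (w u) := by
    rw [disc_companion, disc_w]
  have hd : disc (w (companion u.trace u.det)) ≠ 0 := hdisc ▸ hstd.1
  have hc0 : companion u.trace u.det ∈ matBall v 0 :=
    (mem_matBall_zero v).2 (companion_mem_intMat ht hn)
  obtain ⟨c, hc⟩ := exists_pairBall_le (isOpen_tangent hd ht hn 0)
  obtain ⟨m, hcm, hm⟩ := exists_pow_norm_unif_lt (v := v)
    (norm_pos_iff.2 (two_ne_zero_Kv v)) c
  obtain ⟨hO, hB, hν⟩ := orbitNu_image_conjK hd ht hn hh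
    (image_congrK hc0 hc (Nat.lt_succ_of_le hcm))
  have hl := hstd.stabilizerMeasure_conjK hρt hρn hh m
  have hG := (haarG_conjK h (m + 1)).trans (haarG_congrK v m)
  obtain ⟨τ, hτu, D⟩ := hstd.orbitMeasures hO
  have hHU : ∀ g ∈ conjK h (m + 1), τ⁻¹ * g ∉ centralStab u := fun g hg hgτ =>
    g11_mul_conjMat_ne ht hn hh hm hg (g11_mul_conjMat hτu hgτ)
  rw [← identityComponent_w (two_ne_zero_Kv v) hstd.1] at D hHU
  have hq := one_lt_q v
  have hq0 : q v ≠ 0 := by omega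
  have hq1 : q v - 1 ≠ 0 := by omega
  have hd0 : 0 < ‖disc (w u)‖ := norm_pos_iff.2 hstd.1
  rw [hdisc] at hν
  have hu0 : ‖(unif v : Kv v)‖₊ ≠ 0 := nnnorm_ne_zero_iff.2 (unif_ne_zero v)
  have hd1 : ‖disc (w u)‖₊ ≠ 0 := nnnorm_ne_zero_iff.2 hstd.1
  have hB0 : orbitNu v (w u) ((fun g : PairGroup (Kv v) => g • w u) '' (conjK h (m + 1))) ≠ 0 := by
    rw [hν]
    refine mul_ne_zero (ENNReal.ofReal_pos.2 (by positivity)).ne' (mul_ne_zero ?_ ?_)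
    · exact ENNReal.coe_ne_zero.2 (pow_ne_zero _ hu0)
    · exact ENNReal.coe_ne_zero.2 hd1
  have hBtop : orbitNu v (w u) ((fun g : PairGroup (Kv v) => g • w u) '' (conjK h (m + 1))) ≠ ∞ := by
    rw [hν]
    exact ENNReal.mul_ne_top ENNReal.ofReal_ne_top
      (ENNReal.mul_ne_top ENNReal.coe_ne_top ENNReal.coe_ne_top)
  have hl0 : stabilizerMeasure v u (conjK h (m + 1)) ≠ 0 := by
    rw [hl]
    exact ENNReal.inv_ne_zero.2 (ENNReal.natCast_ne_top _)
  have hltop : stabilizerMeasure v u (conjK h (m + 1)) ≠ ∞ := by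
    rw [hl]
    refine ENNReal.inv_ne_top.2 (Nat.cast_ne_zero.2 ?_)
    positivity
  have := hstd.sFinite_stabilizerMeasure
  have := hstd.isFiniteMeasureOnCompacts_stabilizerMeasure _ (isOpen_conjK h (m + 1)) hltop
  have hQ := quotientMeasure_eq hstd.stabilizerMeasure_ne_zero D (isOpen_conjK h (m + 1))
    (isCompact_conjK h (m + 1)) hB hHU rfl (mul_ne_zero hl0 hB0) (ENNReal.mul_ne_top hltop hBtop)
  have hG0 : haarG v (conjK h (m + 1)) ≠ 0 :=
    ((isOpen_conjK h (m + 1)).measure_pos _ ⟨1, one_mem _⟩).ne'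
  have hGtop : haarG v (conjK h (m + 1)) ≠ ∞ := (isCompact_conjK h (m + 1)).measure_lt_top.ne
  have hb := orbitalConstant_eq D (ENNReal.div_ne_zero.2 ⟨hG0, ENNReal.mul_ne_top hltop hBtop⟩)
    (ENNReal.div_ne_top hGtop (mul_ne_zero hl0 hB0)) hQ hB hB0 hBtop
  have hqq : q v ≤ q v ^ 2 := Nat.le_self_pow two_ne_zero _
  have hq2 : 1 ≤ q v ^ 2 := hq.le.trans hqq
  rw [localDensity, hb, ENNReal.toReal_div, ENNReal.toReal_mul, hG, hl, hν,
    ← volume_identity (Q := q v) (by exact_mod_cast hq) hd0 m]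
  simp only [discDensity, ENNReal.toReal_mul, ENNReal.toReal_inv, ENNReal.toReal_natCast,
    ENNReal.coe_toReal, NNReal.coe_pow, coe_nnnorm, norm_unif, hdisc,
    ENNReal.toReal_ofReal (inv_nonneg.2 (sq_nonneg ‖disc (w u)‖))]
  push_cast [Nat.cast_sub hq.le, Nat.cast_sub hqq, Nat.cast_sub hq2]
  rfl

end OrbitalConstant

/-! ### Ramified quadratic extensions -/

section Ramification

/-- In a Dedekind domain, an ideal divisible by a square is not radical. -/
theorem exists_mul_self_mem_of_sq_dvd {S : Type*} [CommRing S] [IsDedekindDomain S]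
    {Q I : Ideal S} (hQ : Q ≠ ⊤) (hI : I ≠ 0) (h : Q ^ 2 ∣ I) : ∃ z : S, z * z ∈ I ∧ z ∉ I := by
  obtain ⟨J, rfl⟩ := h
  have hQJ : Q * J ≠ 0 := fun h1 => hI (by rw [sq, mul_assoc, h1, mul_zero])
  have hnle : ¬ Q * J ≤ Q ^ 2 * J := by
    intro h
    obtain ⟨I, hI⟩ := Ideal.dvd_iff_le.2 h
    have h2 : Q * J * 1 = Q * J * (Q * I) := by
      rw [mul_one, ← mul_assoc, mul_right_comm Q J Q, ← sq]
      exact hI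
    have h3 : Q ∣ 1 := ⟨I, mul_left_cancel₀ hQJ h2⟩
    exact hQ (Ideal.isUnit_iff.1 (isUnit_of_dvd_one h3))
  obtain ⟨z, hz, hz'⟩ := SetLike.not_le_iff_exists.1 hnle
  refine ⟨z, ?_, hz'⟩
  have h4 : Q * J * (Q * J) = Q ^ 2 * J * J := by
    rw [mul_mul_mul_comm, ← sq, mul_assoc]
  have h5 : z * z ∈ Q ^ 2 * J * J := h4 ▸ Ideal.mul_mem_mul hz hz
  exact Ideal.mul_le_left h5

/-- Over a discrete valuation ring, ramification produces a nilpotent modulo the uniformizer. -/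
theorem exists_mul_self_mem_of_ramified {A S : Type*} [CommRing A] [IsDomain A]
    [IsDiscreteValuationRing A] [CommRing S] [IsDedekindDomain S] [Algebra A S]
    [Algebra.IsIntegral A S] (hinj : Function.Injective (algebraMap A S)) {ϖ : A}
    (hϖ : Irreducible ϖ) {Q : Ideal S} (hQ : Q.IsMaximal) (he : 1 < Q.ramificationIdx A) :
    ∃ z : S, z * z ∈ Ideal.span {algebraMap A S ϖ} ∧ z ∉ Ideal.span {algebraMap A S ϖ} := by
  have hp : Q.under A = IsLocalRing.maximalIdeal A :=
    IsLocalRing.eq_maximalIdeal (Ideal.isMaximal_comap_of_isIntegral_of_isMaximal Q)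
  have hmap : (Q.under A).map (algebraMap A S) = Ideal.span {algebraMap A S ϖ} := by
    rw [hp, hϖ.maximalIdeal_eq, Ideal.map_span, Set.image_singleton]
  have h0 : Ideal.span {algebraMap A S ϖ} ≠ ⊥ := by
    rw [Ne, Ideal.span_singleton_eq_bot, map_eq_zero_iff _ hinj]
    exact hϖ.ne_zero
  rw [Ideal.IsDedekindDomain.ramificationIdx_eq_multiplicity (Q.under A) Q (by rwa [hmap]),
    hmap] at he
  exact exists_mul_self_mem_of_sq_dvd hQ.ne_top h0
    (pow_dvd_of_le_multiplicity (Nat.succ_le_of_lt he))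

end Ramification

section QuadraticField

open NumberField NumberField.HeightOneSpectrum

/-- `θ` generates the quadratic field `L` and has the characteristic polynomial of `u`. -/
structure IsQuadraticRoot {F L : Type*} [Field F] [Field L] [Algebra F L] (u : Mat F) (θ : L) :
    Prop where
  finrank_eq : Module.finrank F L = 2
  mul_self : θ * θ = u.trace • θ - u.det • 1
  eq_zero : ∀ x y : F, x • (1 : L) + y • θ = 0 → x = 0 ∧ y = 0

theorem exists_isQuadraticRoot_splittingField {F : Type*} [Field F] {u : Mat F} {p : Polynomial F}
    (hp : p = Polynomial.C 1 * Polynomial.X ^ 2 + Polynomial.C u.trace * Polynomial.X +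
      Polynomial.C u.det) (h2 : Module.finrank F p.SplittingField = 2) :
    ∃ θ : p.SplittingField, IsQuadraticRoot u θ := by
  have hdeg : (p.map (algebraMap F p.SplittingField)).degree ≠ 0 := by
    rw [Polynomial.degree_map, hp, Polynomial.degree_quadratic one_ne_zero]
    norm_num
  obtain ⟨α, hα⟩ := (Polynomial.SplittingField.splits p).exists_eval_eq_zero hdeg
  have hα' : α ^ 2 + algebraMap F _ u.trace * α + algebraMap F _ u.det = 0 := by
    have hpm := congrArg (Polynomial.map (algebraMap F p.SplittingField)) hp
    rw [hpm] at hα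
    simpa using hα
  have hmul : (-α) * (-α) = u.trace • (-α) - u.det • 1 := by
    rw [Algebra.smul_def, Algebra.smul_def]
    linear_combination hα'
  have hnot (r : F) : -α ≠ algebraMap F _ r := by
    intro hr
    rw [hr] at hmul
    have hmul' : r * r = u.trace * r - u.det := by
      refine (algebraMap F p.SplittingField).injective ?_
      rw [Algebra.smul_def, Algebra.smul_def] at hmul
      simpa using hmul
    have hfac : p = (Polynomial.X + Polynomial.C r) *
        (Polynomial.X + Polynomial.C (u.trace - r)) := by
      have : u.det = r * (u.trace - r) := by linear_combination hmul'
      rw [hp, this]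
      simp only [map_mul, map_sub, map_one]
      ring
    have hs : p.Splits := by
      rw [hfac]
      exact (Polynomial.Splits.X_add_C r).mul (Polynomial.Splits.X_add_C _)
    have htop := (Polynomial.IsSplittingField.splits_iff p.SplittingField p).1 hs
    have h1 := Subalgebra.bot_eq_top_iff_finrank_eq_one.1 htop.symm
    omega
  refine ⟨-α, h2, hmul, fun x y hxy => ?_⟩
  have hy : y = 0 := by
    by_contra hy
    refine hnot (-(y⁻¹ * x)) ?_
    rw [map_neg, map_mul, Algebra.algebraMap_eq_smul_one, Algebra.algebraMap_eq_smul_one,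
      smul_mul_smul_comm, one_mul, mul_smul, eq_neg_iff_add_eq_zero, ← smul_right_inj hy,
      smul_add, smul_smul y y⁻¹, mul_inv_cancel₀ hy, one_smul, smul_zero, add_comm]
    exact hxy
  rw [hy, zero_smul, add_zero] at hxy
  exact ⟨(smul_eq_zero.1 hxy).resolve_right one_ne_zero, hy⟩

theorem exists_isQuadraticRoot {F : Type*} [Field F] {u : Mat F}
    (h2 : Module.finrank F (orbitField (w u)) = 2) :
    ∃ θ : orbitField (w u), IsQuadraticRoot u θ := by
  have e0 : coeff0 (w u) = 1 := by simp [coeff0, quadForm, w]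
  have e2 : coeff2 (w u) = u.det := by simp [coeff2, quadForm, w]
  have e1 : coeff1 (w u) = u.trace := by
    simp [coeff1, quadForm, w, Matrix.det_fin_two, Matrix.trace_fin_two]
    ring
  exact exists_isQuadraticRoot_splittingField (by rw [e0, e1, e2]) h2

namespace IsQuadraticRoot

section General

variable {F L : Type*} [Field F] [Field L] [Algebra F L] {u : Mat F} {θ : L}
  (hθ : IsQuadraticRoot u θ)
include hθ

theorem linearIndependent : LinearIndependent F ![1, θ] := LinearIndependent.pair_iff.2 hθ.eq_zero

/-- The basis `1, θ`. -/
def basis : Module.Basis (Fin 2) F L :=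
  basisOfLinearIndependentOfCardEqFinrank hθ.linearIndependent
    (by rw [Fintype.card_fin, hθ.finrank_eq])

theorem basis_zero : hθ.basis 0 = 1 := by simp [basis]

theorem basis_one : hθ.basis 1 = θ := by simp [basis]

theorem exists_eq (l : L) : ∃ x y : F, l = x • 1 + y • θ := by
  refine ⟨hθ.basis.repr l 0, hθ.basis.repr l 1, ?_⟩
  conv_lhs => rw [← hθ.basis.sum_repr l]
  rw [Fin.sum_univ_two, basis_zero, basis_one]

theorem injective {x y x' y' : F} (h : x • (1 : L) + y • θ = x' • 1 + y' • θ) :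
    x = x' ∧ y = y' := by
  have := hθ.eq_zero (x - x') (y - y') (by
    rw [sub_smul, sub_smul]
    linear_combination h)
  exact ⟨sub_eq_zero.1 this.1, sub_eq_zero.1 this.2⟩

theorem mul_lin (x y x' y' : F) : (x • (1 : L) + y • θ) * (x' • 1 + y' • θ) =
    (x * x' - u.det * (y * y')) • 1 + (x * y' + y * x' + u.trace * (y * y')) • θ := by
  have h : (x • (1 : L) + y • θ) * (x' • 1 + y' • θ) =
      (x * x') • 1 + (x * y' + y * x') • θ + (y * y') • (θ * θ) := by
    simp only [Algebra.smul_def, map_add, map_mul]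
    ring
  rw [h, hθ.mul_self]
  module

theorem leftMulMatrix : Algebra.leftMulMatrix hθ.basis θ = companion u.trace u.det := by
  have h0 : θ * hθ.basis 0 = (0 : F) • hθ.basis 0 + (1 : F) • hθ.basis 1 := by
    rw [basis_zero, basis_one]
    simp
  have h1 : θ * hθ.basis 1 = (-u.det) • hθ.basis 0 + u.trace • hθ.basis 1 := by
    rw [basis_zero, basis_one, hθ.mul_self]
    module
  ext i j
  rw [Algebra.leftMulMatrix_eq_repr_mul]
  fin_cases j
  · change hθ.basis.repr (θ * hθ.basis 0) i = _
    rw [h0, map_add, map_smul, map_smul, Module.Basis.repr_self, Module.Basis.repr_self]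
    fin_cases i <;> simp [companion]
  · change hθ.basis.repr (θ * hθ.basis 1) i = _
    rw [h1, map_add, map_smul, map_smul, Module.Basis.repr_self, Module.Basis.repr_self]
    fin_cases i <;> simp [companion]

theorem trace_lin (x y : F) : Algebra.trace F L (x • 1 + y • θ) = 2 * x + y * u.trace := by
  have h1 : Algebra.trace F L 1 = 2 := by
    rw [← map_one (algebraMap F L), Algebra.trace_algebraMap, hθ.finrank_eq]
    norm_num
  have h2 : Algebra.trace F L θ = u.trace := by
    rw [Algebra.trace_eq_matrix_trace hθ.basis, hθ.leftMulMatrix, trace_companion]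
  rw [map_add, map_smul, map_smul, h1, h2, smul_eq_mul, smul_eq_mul, mul_comm x]

theorem discr_lin (b : Fin 2 → L) {x y x' y' : F} (h0 : b 0 = x • 1 + y • θ)
    (h1 : b 1 = x' • 1 + y' • θ) :
    Algebra.discr F b = (x * y' - x' * y) ^ 2 * disc (w u) := by
  rw [Algebra.discr_def, Matrix.det_fin_two]
  simp only [Algebra.traceMatrix_apply, Algebra.traceForm_apply, h0, h1, hθ.mul_lin,
    hθ.trace_lin, disc_w]
  ring

theorem exists_algHom (hu : disc (w u) ≠ 0) :
    ∃ f : L →ₐ[F] Mat F, Function.Injective f ∧ f θ = u := by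
  obtain ⟨h, hh⟩ := exists_conj_companion hu
  have hh' : (h⁻¹ : (Mat F)ˣ) * companion u.trace u.det * (h : Mat F) = u := by
    rw [mul_assoc, ← hh, Units.inv_mul_cancel_left]
  let c : Mat F →ₐ[F] Mat F :=
    { toFun := fun a => (h⁻¹ : (Mat F)ˣ) * a * (h : Mat F)
      map_one' := by rw [mul_one, Units.inv_mul]
      map_zero' := by rw [mul_zero, zero_mul]
      map_mul' := fun a b => by
        simp only [mul_assoc, Units.mul_inv_cancel_left]
      map_add' := fun a b => by rw [mul_add, add_mul]
      commutes' := fun r => by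
        rw [← Algebra.commutes, mul_assoc, Units.inv_mul, mul_one] }
  refine ⟨c.comp (Algebra.leftMulMatrix hθ.basis), RingHom.injective (c.comp
    (Algebra.leftMulMatrix hθ.basis)).toRingHom, ?_⟩
  change (h⁻¹ : (Mat F)ˣ) * Algebra.leftMulMatrix hθ.basis θ * (h : Mat F) = u
  rw [hθ.leftMulMatrix, hh']

end General

end IsQuadraticRoot

end QuadraticField

/-! ### The ring of integers of the quadratic field attached to a standard representative -/

section LocalQuadratic

open NumberField NumberField.HeightOneSpectrum

variable {k : Type*} [Field k] [NumberField k] {v : HeightOneSpectrum (𝓞 k)}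
  {u : Mat (Kv v)} {L : Type*} [Field L] [Algebra (Kv v) L] [Algebra (Ov v) L]
  [IsScalarTower (Ov v) (Kv v) L] {θ : L}

namespace IsQuadraticRoot

variable (hθ : IsQuadraticRoot u θ) (hstd : IsStandardRepresentative v u)
include hθ hstd

theorem isIntegral_lin_iff (x y : Kv v) :
    IsIntegral (Ov v) (x • (1 : L) + y • θ) ↔ x ∈ Ov v ∧ y ∈ Ov v := by
  obtain ⟨f, hf, hfu⟩ := hθ.exists_algHom hstd.1
  rw [← isIntegral_algHom_iff (f.restrictScalars (Ov v)) hf, ← hstd.isIntegral_lin_iff]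
  have e : f.restrictScalars (Ov v) (x • (1 : L) + y • θ) = x • 1 + y • u := by
    change f _ = _
    rw [map_add, map_smul, map_smul, map_one, hfu]
  rw [e]

theorem exists_coord (z : integralClosure (Ov v) L) : ∃ x y : Ov v,
    (z : L) = (x : Kv v) • 1 + (y : Kv v) • θ := by
  obtain ⟨x, y, h⟩ := hθ.exists_eq (z : L)
  have hz := z.2
  rw [mem_integralClosure_iff, h, hθ.isIntegral_lin_iff hstd] at hz
  exact ⟨⟨x, hz.1⟩, ⟨y, hz.2⟩, h⟩

theorem mem_integralClosure (x y : Ov v) :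
    (x : Kv v) • 1 + (y : Kv v) • θ ∈ integralClosure (Ov v) L := by
  rw [mem_integralClosure_iff, hθ.isIntegral_lin_iff hstd]
  exact ⟨x.2, y.2⟩

/-- A reduced characteristic polynomial of a ramified quadratic extension has a double root. -/
theorem exists_double_root {Q : Ideal (integralClosure (Ov v) L)} (hQ : Q.IsMaximal)
    (he : 1 < Q.ramificationIdx (Ov v)) : ∃ ρ : Res v,
      IsLocalRing.residue (Ov v) ⟨u.trace, hstd.trace_mem⟩ = 2 * ρ ∧
      IsLocalRing.residue (Ov v) ⟨u.det, hstd.det_mem⟩ = ρ ^ 2 := by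
  have : CharZero (Kv v) := charZero_of_injective_algebraMap (algebraMap k (Kv v)).injective
  have : FiniteDimensional (Kv v) L := Module.finite_of_finrank_pos (by
    rw [hθ.finrank_eq]
    exact two_pos)
  have := integralClosure.isDedekindDomain (Ov v) (Kv v) L
  have hinj : Function.Injective (algebraMap (Ov v) (integralClosure (Ov v) L)) := by
    intro a b hab
    have h1 : algebraMap (Ov v) L a = algebraMap (Ov v) L b :=
      congrArg (fun z : integralClosure (Ov v) L => (z : L)) hab
    rw [IsScalarTower.algebraMap_apply (Ov v) (Kv v) L,
      IsScalarTower.algebraMap_apply (Ov v) (Kv v) L b] at h1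
    exact Subtype.ext ((algebraMap (Kv v) L).injective h1)
  obtain ⟨z, hz, hz'⟩ := exists_mul_self_mem_of_ramified hinj (irreducible_unif v) hQ he
  rw [Ideal.mem_span_singleton'] at hz hz'
  obtain ⟨s, hs⟩ := hz
  obtain ⟨x, y, hxy⟩ := hθ.exists_coord hstd z
  obtain ⟨x', y', hs'⟩ := hθ.exists_coord hstd s
  let t : Ov v := ⟨u.trace, hstd.trace_mem⟩
  let n : Ov v := ⟨u.det, hstd.det_mem⟩
  have hunif (a : Kv v) (l : L) : (a • l) * algebraMap (Ov v) L (unif v) =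
      (a * (unif v : Kv v)) • l := by
    rw [IsScalarTower.algebraMap_apply (Ov v) (Kv v) L, mul_comm, mul_comm a, mul_smul,
      Algebra.smul_def (unif v : Kv v)]
    rfl
  have hs2 : (s : L) * algebraMap (Ov v) L (unif v) = (z : L) * z :=
    congrArg (fun z : integralClosure (Ov v) L => (z : L)) hs
  rw [hxy, hθ.mul_lin, hs', add_mul, hunif, hunif] at hs2
  obtain ⟨e1, e2⟩ := hθ.injective hs2
  have e1' : x' * unif v = x * x - n * (y * y) := Subtype.ext e1
  have e2' : y' * unif v = x * y + y * x + t * (y * y) := Subtype.ext e2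
  have hres : IsLocalRing.residue (Ov v) (unif v) = 0 := by
    rw [IsLocalRing.residue_eq_zero_iff]
    exact (irreducible_unif v).not_isUnit
  have r1 := congrArg (IsLocalRing.residue (Ov v)) e1'
  have r2 := congrArg (IsLocalRing.residue (Ov v)) e2'
  simp only [map_add, map_sub, map_mul, hres, mul_zero] at r1 r2
  set X := IsLocalRing.residue (Ov v) x with hX
  set Y := IsLocalRing.residue (Ov v) y with hY
  have hY0 : Y ≠ 0 := by
    intro hY0
    rw [hY0, mul_zero, mul_zero, sub_zero] at r1
    have hX0 : X = 0 := mul_self_eq_zero.1 r1.symm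
    have hdvd (a : Ov v) (ha : IsLocalRing.residue (Ov v) a = 0) : ∃ b, b * unif v = a := by
      rw [IsLocalRing.residue_eq_zero_iff, (irreducible_unif v).maximalIdeal_eq,
        Ideal.mem_span_singleton'] at ha
      exact ha
    obtain ⟨b, hb⟩ := hdvd x hX0
    obtain ⟨c, hc⟩ := hdvd y hY0
    refine hz' ⟨⟨_, hθ.mem_integralClosure hstd b c⟩, Subtype.ext ?_⟩
    change ((b : Kv v) • (1 : L) + (c : Kv v) • θ) * algebraMap (Ov v) L (unif v) = z
    rw [add_mul, hunif, hunif, hxy, ← hb, ← hc]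
    rfl
  refine ⟨-(X / Y), ?_, ?_⟩
  · change IsLocalRing.residue (Ov v) t = _
    have h1 : Y * (X + X + IsLocalRing.residue (Ov v) t * Y) = 0 := by linear_combination -r2
    have h2 := (mul_eq_zero.1 h1).resolve_left hY0
    field_simp
    linear_combination h2
  · change IsLocalRing.residue (Ov v) n = _
    field_simp
    linear_combination r1

end IsQuadraticRoot

theorem IsQuadraticRoot.span_discr_eq {n : ℕ} (hn : n = 2) (hθ : IsQuadraticRoot u θ)
    (hstd : IsStandardRepresentative v u) {D : Ov v} (hD : (D : Kv v) = disc (w u)) :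
    Ideal.span {d : Ov v | ∃ b : Fin n → integralClosure (Ov v) L,
      algebraMap (Ov v) (Kv v) d = Algebra.discr (Kv v) (fun i => (b i : L))} =
    Ideal.span {D} := by
  subst hn
  refine le_antisymm (Ideal.span_le.2 ?_) (Ideal.span_le.2 ?_)
  · rintro d ⟨b, hb⟩
    obtain ⟨x, y, h0⟩ := hθ.exists_coord hstd (b 0)
    obtain ⟨x', y', h1⟩ := hθ.exists_coord hstd (b 1)
    rw [hθ.discr_lin _ h0 h1, ← hD] at hb
    refine Ideal.mem_span_singleton'.2 ⟨(x * y' - x' * y) ^ 2, Subtype.ext ?_⟩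
    exact hb.symm
  · refine Set.singleton_subset_iff.2 (Ideal.subset_span ⟨![⟨_, hθ.mem_integralClosure hstd 1 0⟩,
      ⟨_, hθ.mem_integralClosure hstd 0 1⟩], ?_⟩)
    rw [hθ.discr_lin _ rfl rfl, ← hD]
    have e0 : ((0 : Ov v) : Kv v) = 0 := rfl
    have e1 : ((1 : Ov v) : Kv v) = 1 := rfl
    rw [e0, e1]
    change (D : Kv v) = _
    ring

theorem card_quotient_span {D : Ov v} (hD : D ≠ 0) :
    ((Nat.card (Ov v ⧸ Ideal.span {D}) : ℕ) : ℝ)⁻¹ = ‖(D : Kv v)‖ := by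
  obtain ⟨n, a, rfl⟩ := IsDiscreteValuationRing.eq_unit_mul_pow_irreducible hD
    (irreducible_unif v)
  have hm : Ideal.span {(a : Ov v) * unif v ^ n} = IsLocalRing.maximalIdeal (Ov v) ^ n := by
    rw [Ideal.span_singleton_mul_left_unit a.isUnit, (irreducible_unif v).maximalIdeal_eq,
      Ideal.span_singleton_pow]
  have h0 : IsLocalRing.maximalIdeal (Ov v) ≠ ⊥ := IsDiscreteValuationRing.not_a_field _
  have hcard : Nat.card (Ov v ⧸ IsLocalRing.maximalIdeal (Ov v) ^ n) = q v ^ n :=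
    cardQuot_pow_of_prime h0
  have ha := (isUnit_iff_norm_eq_one v a).1 a.isUnit
  have hna : (((a : Ov v) * unif v ^ n : Ov v) : Kv v) = (a : Ov v) * (unif v : Kv v) ^ n := rfl
  rw [hm, hcard, hna, norm_mul, ha, one_mul, norm_pow, norm_unif, Nat.cast_pow, inv_pow]

theorem IsStandardRepresentative.discNorm_inv (hstd : IsStandardRepresentative v u)
    (h2 : Module.finrank (Kv v) (orbitField (w u)) = 2) :
    (discNorm v u : ℝ)⁻¹ = ‖disc (w u)‖ := by
  obtain ⟨θ, hθ⟩ := exists_isQuadraticRoot h2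
  have hD : disc (w u) ∈ Ov v := by
    rw [disc_w]
    exact sub_mem (pow_mem hstd.trace_mem 2) (mul_mem (ofNat_mem (Ov v) 4) hstd.det_mem)
  have h := IsQuadraticRoot.span_discr_eq h2 hθ hstd (D := ⟨_, hD⟩) rfl
  rw [discNorm, relativeDiscriminant, h, card_quotient_span]
  exact fun h0 => hstd.1 (congrArg Subtype.val h0)

end LocalQuadratic

end QuatPair

end

theorem mainTheorem4 {k : Type*} [Field k] [NumberField k]
    {B : Type*} [Ring B] [Algebra k B] [Algebra.IsCentral k B] [IsSimpleRing B]
    (hB : Module.finrank k B = 4)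
    (v : HeightOneSpectrum (𝓞 k))
    (φ : v.adicCompletion k ⊗[k] B ≃ₐ[v.adicCompletion k]
      Matrix (Fin 2) (Fin 2) (v.adicCompletion k))
    (u : v.adicCompletion k ⊗[k] B)
    (hstd : QuatPair.IsStandardRepresentative v (φ u))
    (htype : QuatPair.IsTypeUrRm v (φ u)) :
    QuatPair.localDensity v (φ u) =
      2⁻¹ * (QuatPair.discNorm v (φ u) : ℝ)⁻¹ * (1 - (QuatPair.q v : ℝ)⁻¹)
        * (1 - ((QuatPair.q v : ℝ) ^ 2)⁻¹) ^ 3 := by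
  obtain ⟨h2, Q, hQ, he⟩ := htype
  obtain ⟨θ, hθ⟩ := QuatPair.exists_isQuadraticRoot h2
  obtain ⟨ρ, hρt, hρn⟩ := hθ.exists_double_root hstd hQ he
  rw [hstd.localDensity_eq hρt hρn, hstd.discNorm_inv h2]
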